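/- Let $m\ge 3$, and let $Q^{*m}=SO^0_{2,m}/SO_2SO_m$ be the complex hyperbolic quadric. With $T_{p_0}Q^{*m}\cong\mathfrak m=\left\{\begin{pmatrix}0&X^t\\X&0\end{pmatrix}: X\in\mathbb R^{m\times 2}\right\}$ at the base point $p_0=eK$, it carries the invariant Riemannian metric $g$ with $g(X,Y)=\operatorname{tr}(X^tY)$, the invariant complex structure $J=\mathrm{Ad}(j)$, $j=\begin{pmatrix}0&1\\-1&0\end{pmatrix}\oplus I_m$, and the invariant circle bundle $\mathfrak A$ of real structures with fibre $\mathfrak A_{p_0}=\{\lambda A_0:\lambda\in S^1\}$, $A_0=\mathrm{Ad}(\mathrm{diag}(1,-1,1,\dots,1))$, where $i$ acts as $J$. For $A\in\mathfrak A_p$ put $V(A)=\{X: AX=X\}$. A nonzero $X\in T_pQ^{*m}$ is *singular* if it is tangent to more than one maximal flat; it is *$\mathfrak A$-principal* if $X\in V(A)$ for some $A\in\mathfrak A_p$, and *$\mathfrak A$-isotropic* if $X/\|X\|=(Z_1+JZ_2)/\sqrt2$ for some $A\in\mathfrak A_p$ and orthonormal $Z_1,Z_2\in V(A)$. Let $M$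 be a smooth (immersed) real hypersurface in $Q^{*m}$, with (local) unit normal vector field $N$, Reeb vector field $\xi=-JN$, shape operator $SX=-\bar\nabla_XN$ ($\bar\nabla$ the Levi-Civita connection of $Q^{*m}$), and Levi-Civita connection $\nabla$ and curvature tensor $R$ of the induced metric. Let $R_\xi Y=R(Y,\xi)\xi$ be its structure Jacobi operator. Suppose that $M$ is Hopf, i.e. $S\xi=\alpha\xi$ for a function $\alpha$, and that $R_\xi$ is Reeb parallel, i.e. $\nabla_\xi R_\xi=0$. Then $N$ is singular: at each point of $M$, $N$ is singular, and it is $\mathfrak A$-isotropic or $\mathfrak A$-principal. If $M$ is connected, then either $N$ is $\mathfrak A$-isotropic at all points of $M$ or $N$ is $\mathfrak A$-principal at all points of $M$. -/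

import Mathlib

open scoped Manifold ContDiff Matrix

noncomputable section

/-! ### Riemannian geometry in a coordinate domain

A metric on (an open part of) a finite-dimensional real vector space `E` is a function
`g : E → E →L[ℝ] E →L[ℝ] ℝ`.  Tangent vectors are elements of `E`. -/

namespace Coord

variable {E : Type*} [NormedAddCommGroup E] [NormedSpace ℝ E]

/-- The Christoffel symbols of the first kind, as the linear form
`w ↦ (1/2) (u g(v, w) + v g(u, w) - w g(u, v))` for constant vector fields `u, v, w`. -/
def koszul (g : E → E →L[ℝ] E →L[ℝ] ℝ) (x u v : E) : E →L[ℝ] ℝ :=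
  (1 / 2 : ℝ) • (fderiv ℝ g x u v + fderiv ℝ g x v u - ((fderiv ℝ g x).flip u).flip v)

/-- The Christoffel symbols `Γ_x(u, v)` of the Levi-Civita connection of `g`: the vector with
`g_x(Γ_x(u, v), w) = koszul g x u v w` for all `w`. -/
def christoffel (g : E → E →L[ℝ] E →L[ℝ] ℝ) (x u v : E) : E :=
  (g x).inverse (koszul g x u v)

/-- The Levi-Civita covariant derivative `(∇_u Y)(x)` of the vector field `Y`. -/
def covDeriv (g : E → E →L[ℝ] E →L[ℝ] ℝ) (Y : E → E) (x u : E) : E :=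
  fderiv ℝ Y x u + christoffel g x u (Y x)

/-- The Riemannian curvature tensor `R_x(u, v) w`, where
`R(X, Y) Z = ∇_X ∇_Y Z - ∇_Y ∇_X Z - ∇_[X, Y] Z`: the right-hand side is evaluated on the
constant fields `u, v, w`. -/
def curvature (g : E → E →L[ℝ] E →L[ℝ] ℝ) (x u v w : E) : E :=
  covDeriv g (fun y => christoffel g y v w) x u - covDeriv g (fun y => christoffel g y u w) x v

/-- The Jacobi operator `R_X Y = R(Y, X) X` of the vector field `X`, at the point `x`. -/
def jacobiOp (g : E → E →L[ℝ] E →L[ℝ] ℝ) (X : E → E) (x y : E) : E :=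
  curvature g x y (X x) (X x)

/-- The covariant derivative `(∇_u T) y = ∇_u (T Y) - T (∇_u Y)` of an endomorphism field `T`,
evaluated on the constant field `Y = y`. -/
def covDerivEnd (g : E → E →L[ℝ] E →L[ℝ] ℝ) (T : E → E → E) (x u y : E) : E :=
  covDeriv g (fun z => T z y) x u - T x (covDeriv g (fun _ => y) x u)

end Coord

/-! ### The complex hyperbolic quadric

`SO⁰(2, m) / SO(2) SO(m)` is the manifold of the planes `P` of `ℝ² ⊕ ℝᵐ` on which the form
`-|a|² + |b|²` is negative definite.  Each of them is the graph `{(a, W a)}` of exactly one real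
`m × 2` matrix `W` with `1 - Wᵀ W` positive definite, the base point being `W = 0`; the coset of
`(A, B; C, D)` is `W = C A⁻¹`.  This identifies the quadric, as a manifold, with an open set of
matrices, on which the group acts by `W ↦ (C + D W) (A + B W)⁻¹`; the differential of this map is
`X ↦ (D - W' B) X (A + B W)⁻¹`, where `W'` is the image of `W`.  At `W = 0` the tangent vector `X`
is the element `(0, Xᵀ; X, 0)` of `𝔪`.  All tensors below are the invariant ones. -/

namespace HypQuadric

/-- The real `m × 2` matrices, as a normed space (all norms on it are equivalent): the points and the
tangent vectors of the quadric. -/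
abbrev Vec (m : ℕ) : Type := Fin m → Fin 2 → ℝ

variable {m : ℕ}

/-- The element `W` of `Vec m`, for the operations of matrix algebra. -/
def mat (W : Vec m) : Matrix (Fin m) (Fin 2) ℝ := Matrix.of W

theorem mat_add (X Y : Vec m) : mat (X + Y) = mat X + mat Y := rfl

theorem mat_smul (c : ℝ) (X : Vec m) : mat (c • X) = c • mat X := rfl

/-- The complex hyperbolic quadric `Q*ᵐ`, in its global chart. -/
def domain (m : ℕ) : Set (Vec m) :=
  {W | (1 - (mat W)ᵀ * mat W).PosDef}

/-- The absolute value of the form, restricted to the plane `P = {(a, W a)} ≅ ℝ²`. -/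
def gram (W : Vec m) : Matrix (Fin 2) (Fin 2) ℝ := 1 - (mat W)ᵀ * mat W

/-- The inverse matrix of the form on `Pᗮ ≅ (ℝ² ⊕ ℝᵐ) / P ≅ ℝᵐ`. -/
def cogram (W : Vec m) : Matrix (Fin m) (Fin m) ℝ := 1 - mat W * (mat W)ᵀ

/-- The adjoint `Pᗮ → P` of the tangent vector `X : P → Pᗮ`; this is `Xᵀ` at `W = 0`. -/
def adj (W X : Vec m) : Matrix (Fin 2) (Fin m) ℝ :=
  (gram W)⁻¹ * (mat X)ᵀ * (cogram W)⁻¹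

/-- The invariant Riemannian metric `g(X, Y) = tr(X^* Y)`; at `W = 0` it is `tr(Xᵀ Y)`. -/
def metric (W : Vec m) : Vec m →L[ℝ] Vec m →L[ℝ] ℝ :=
  (LinearMap.mk₂ ℝ (fun X Y => Matrix.trace (adj W X * mat Y))
    (by intro X X' Y; simp [adj, mat_add, Matrix.mul_add, Matrix.add_mul])
    (by intro c X Y; simp [adj, mat_smul])
    (by intro X Y Y'; simp [mat_add, Matrix.mul_add])
    (by intro c X Y; simp [mat_smul])).toContinuousBilinearMap

/-- The invariant complex structure `J`: composition with the rotation by a right angle of the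
plane `P`, for the definite form `gram W` on it.  At `W = 0` it is `Ad(j)`, with
`j = (0, 1; -1, 0) ⊕ 1`. -/
def J (W X : Vec m) : Vec m :=
  Matrix.of.symm (mat X * (Real.sqrt (gram W).det • ((gram W)⁻¹ * !![0, -1; 1, 0])))

/-- The circle `𝔄` of real structures (conjugations) at `W`: composition with the orthogonal
reflections `r` in lines of the plane `P`.  At `W = 0` these are the maps `λ A₀`, `|λ| = 1`, with
`A₀ = Ad(diag(1, -1, 1, …, 1))`. -/
def conjugations (W : Vec m) : Set (Vec m → Vec m) :=
  {A | ∃ r : Matrix (Fin 2) (Fin 2) ℝ,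
    rᵀ * gram W * r = gram W ∧ r.det = -1 ∧ A = fun X => Matrix.of.symm (mat X * r)}

/-- `X` is `𝔄`-principal: a nonzero vector with `A X = X` for some conjugation `A`. -/
def IsPrincipal (W X : Vec m) : Prop :=
  X ≠ 0 ∧ ∃ A ∈ conjugations W, A X = X

/-- `X` is `𝔄`-isotropic: a nonzero vector with `X / ‖X‖ = (Z₁ + J Z₂) / √2` for some conjugation
`A` and orthonormal `Z₁, Z₂` in the `(+1)`-eigenspace of `A`. -/
def IsIsotropic (W X : Vec m) : Prop :=
  X ≠ 0 ∧ ∃ A ∈ conjugations W, ∃ Z₁ Z₂ : Vec m,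
    A Z₁ = Z₁ ∧ A Z₂ = Z₂ ∧
    metric W Z₁ Z₁ = 1 ∧ metric W Z₂ Z₂ = 1 ∧ metric W Z₁ Z₂ = 0 ∧
    (Real.sqrt (metric W X X))⁻¹ • X = (Real.sqrt 2)⁻¹ • (Z₁ + J W Z₂)

/-- The vanishing of the Lie bracket `[X, Y]` in `𝔰𝔬(2, m)` of `X, Y ∈ 𝔪 ≅ Hom(P, Pᗮ)`; its two
diagonal blocks are `X^* Y - Y^* X` and `X Y^* - Y X^*`. -/
def Commuting (W X Y : Vec m) : Prop :=
  adj W X * mat Y = adj W Y * mat X ∧ mat X * adj W Y = mat Y * adj W X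

/-- The Cartan subspaces of `𝔪`, i.e. the maximal commutative ones: these are the tangent spaces
of the maximal flats through `W`. -/
def IsCartan (W : Vec m) (L : Submodule ℝ (Vec m)) : Prop :=
  Maximal (fun L' : Submodule ℝ (Vec m) => ∀ X ∈ L', ∀ Y ∈ L', Commuting W X Y) L

/-- `X` is singular: a nonzero vector that is tangent to more than one maximal flat. -/
def IsSingular (W X : Vec m) : Prop :=
  X ≠ 0 ∧ ∃ L₁ L₂, IsCartan W L₁ ∧ IsCartan W L₂ ∧ L₁ ≠ L₂ ∧ X ∈ L₁ ∧ X ∈ L₂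

end HypQuadric

/-! ### Parametrized hypersurfaces

`F : E → Vec m` is an immersion of an open set of `E` into the quadric, with
`dim E = 2 m - 1`, and `N` is a unit normal vector field along `F`.  Tangent vectors of the
hypersurface are elements of `E`. -/

namespace HypQuadric

section Local

variable {m : ℕ} {E : Type*} [NormedAddCommGroup E] [NormedSpace ℝ E]

/-- `n` is a unit normal vector at the point `W` to the image of the linear map `T`. -/
def IsUnitNormal (W : Vec m) (T : E →L[ℝ] Vec m)
    (n : Vec m) : Prop :=
  metric W n n = 1 ∧ ∀ u, metric W n (T u) = 0

/-- `N` is a smooth unit normal vector field along `F` on `U`. -/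
def IsUnitNormalField (F : E → Vec m) (U : Set E)
    (N : E → Vec m) : Prop :=
  ContDiffOn ℝ ∞ N U ∧ ∀ x ∈ U, IsUnitNormal (F x) (fderiv ℝ F x) (N x)

/-- The metric `g` induced by the immersion `F`. -/
def inducedMetric (F : E → Vec m) (x : E) : E →L[ℝ] E →L[ℝ] ℝ :=
  (metric (F x)).bilinearComp (fderiv ℝ F x) (fderiv ℝ F x)

/-- The tangent vector of the hypersurface whose image under the (injective) differential of `F`
is `X`; it is used only for `X` tangent to the hypersurface. -/
def pullTangent (F : E → Vec m) (x : E) (X : Vec m) : E :=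
  Function.invFun (fderiv ℝ F x) X

/-- The Reeb vector field `ξ = -J N`. -/
def reeb (F N : E → Vec m) (x : E) : E :=
  pullTangent F x (-J (F x) (N x))

/-- The derivative `∇̄_u N` of the vector field `N` along `F`, for the Levi-Civita connection `∇̄` of
the quadric. -/
def ambientDeriv (F N : E → Vec m) (x u : E) : Vec m :=
  fderiv ℝ N x u + Coord.christoffel metric (F x) (fderiv ℝ F x u) (N x)

/-- The shape operator `S u = -∇̄_u N`. -/
def shapeOperator (F N : E → Vec m) (x u : E) : E :=
  pullTangent F x (-ambientDeriv F N x u)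

/-- The structure Jacobi operator `R_ξ Y = R(Y, ξ) ξ`, where `R` is the curvature tensor of the
induced metric. -/
def structureJacobi (F N : E → Vec m) (x y : E) : E :=
  Coord.jacobiOp (inducedMetric F) (reeb F N) x y

end Local

/-! ### Real hypersurfaces -/

section Global

variable {m : ℕ} {M : Type*} [TopologicalSpace M]
  [ChartedSpace (EuclideanSpace ℝ (Fin (2 * m - 1))) M]

/-- `f` is a smooth immersion into the quadric of the manifold `M` of dimension `2 m - 1`. -/
def IsRealHypersurface (f : M → Vec m) : Prop :=
  (∀ p, f p ∈ domain m) ∧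
  ContMDiff 𝓘(ℝ, EuclideanSpace ℝ (Fin (2 * m - 1))) 𝓘(ℝ, Vec m) ∞ f ∧
  ∀ p, Function.Injective
    (mfderiv 𝓘(ℝ, EuclideanSpace ℝ (Fin (2 * m - 1))) 𝓘(ℝ, Vec m) f p)

/-- `n` is a unit normal vector of the hypersurface at its point `p`. -/
def IsUnitNormalAt (f : M → Vec m) (p : M)
    (n : Vec m) : Prop :=
  IsUnitNormal (E := EuclideanSpace ℝ (Fin (2 * m - 1))) (f p)
    (mfderiv 𝓘(ℝ, EuclideanSpace ℝ (Fin (2 * m - 1))) 𝓘(ℝ, Vec m) f p) n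

/-- The hypersurface is Hopf: `S ξ = α ξ` for a function `α`, in each chart and for each local unit
normal vector field. -/
def IsHopf (f : M → Vec m) : Prop :=
  ∀ c ∈ atlas (EuclideanSpace ℝ (Fin (2 * m - 1))) M, ∀ U, IsOpen U → U ⊆ c.target →
    ∀ N, IsUnitNormalField (f ∘ c.symm) U N → ∀ x ∈ U, ∃ α : ℝ,
      shapeOperator (f ∘ c.symm) N x (reeb (f ∘ c.symm) N x) = α • reeb (f ∘ c.symm) N x

/-- The structure Jacobi operator is Reeb parallel: `∇_ξ R_ξ = 0`, in each chart and for each local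
unit normal vector field. -/
def HasReebParallelJacobi (f : M → Vec m) : Prop :=
  ∀ c ∈ atlas (EuclideanSpace ℝ (Fin (2 * m - 1))) M, ∀ U, IsOpen U → U ⊆ c.target →
    ∀ N, IsUnitNormalField (f ∘ c.symm) U N → ∀ x ∈ U, ∀ y,
      Coord.covDerivEnd (inducedMetric (f ∘ c.symm)) (structureJacobi (f ∘ c.symm) N) x
        (reeb (f ∘ c.symm) N x) y = 0

end Global

end HypQuadric

end

/-!
A unit normal vector `n` of the hypersurface at `W` is a linear map `P → Pᗮ`.  Put
`q = tr ((n^* n)²)` (`quart`) and let `b = n n^* n - q n` (`defect`) be the component of the Jordan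
triple `n n^* n` orthogonal to `n`.  Then `|b|² = (2 q - 1) (1 - q) / 2` (`metric_defect_defect`), so
that `b = 0` if and only if `q = 1 / 2` or `q = 1`.  If `b = 0` and `q = 1 / 2`, then `n^* n = 1 / 2`
and `n` is `𝔄`-isotropic; if `q = 1`, then `n^* n` is the projection of `P` to a line and `n` is
`𝔄`-principal, being fixed by the reflection `2 n^* n - 1`.  In both cases `n` commutes with two
vectors that do not commute with one another, and maximal commutative subspaces containing these
are different Cartan subspaces containing `n`.

It remains to see that `b = 0` (`IsHypersurfaceOn.defect_eq_zero`).  The triple product `X Y^* Z` and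
`J` are parallel.  Since `∇̄_ξ N = α J N` on a Hopf hypersurface, `q` is constant along `ξ` and
`∇_ξ b = α J b`, `∇_ξ (J b) = -α b`.  Let `u, v, w` be the values of the second fundamental form on
`(J b, J b)`, `(b, b)`, `(J b, b)`, and `e = (2 q - 1) |b|²`.  The Codazzi equation expresses the
derivatives of `u, v, w` along `ξ`, and gives `dα(b) = 2 |b|²`.  By the Gauss equation, the
values of the form of `R_ξ` on the same pairs are `α u`, `α v - e`, `α w`, and `∇_ξ R_ξ = 0` becomes
```
(ξα) u = -α² w,   (ξα) v = α² w,   (ξα) w = (3 / 2) α e + (α² / 2) (u - v).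
```
Where `b ≠ 0`, the function `e` does not vanish and `α` vanishes on no open set.  If `ξα = 0` on an
open set where `α ≠ 0`, then `w = 0`, and the equations for `ξw` and `(ξα) w` contradict each other.
Where `α ≠ 0` and `ξα ≠ 0`, one has `v = -u` and `α (u² + w²) + (3 / 2) e u = 0`, and the derivative of
this relation along `ξ` is `-α e w = 0`; then `w = 0`, so that `u = v = 0` and `e = 0`, which is
impossible as well (`reeb_system_false`).

On a connected hypersurface `q` is continuous with values in `{1 / 2, 1}`, hence constant.

The quadric is treated in its global chart: the Christoffel symbols are the explicit polynomials
`conn` in `W`, `(1 - Wᵀ W)⁻¹` and the two vectors, and `cov` is the resulting covariant derivative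
along a map.  Tangent vectors of the hypersurface are handled through their images in the quadric.
-/

noncomputable section

section

attribute [local instance] Matrix.normedAddCommGroup Matrix.normedSpace

/-! ### Differential calculus of matrix-valued functions -/

namespace MatCalc

variable {D : Type*} [NormedAddCommGroup D] [NormedSpace ℝ D]
  {l m n : Type*} [Fintype l] [Fintype m] [Fintype n]

/-- Matrix multiplication as a continuous bilinear map. -/
def mulCLM (l m n : Type*) [Fintype l] [Fintype m] [Fintype n] :
    Matrix l m ℝ →L[ℝ] Matrix m n ℝ →L[ℝ] Matrix l n ℝ :=
  (LinearMap.mk₂ ℝ (fun A B => A * B)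
    (fun _ _ _ => Matrix.add_mul _ _ _) (fun _ _ _ => Matrix.smul_mul _ _ _)
    (fun _ _ _ => Matrix.mul_add _ _ _) (fun _ _ _ => Matrix.mul_smul _ _ _)).toContinuousBilinearMap

/-- Transposition as a continuous linear map. -/
def transposeCLM (l m : Type*) [Fintype l] [Fintype m] : Matrix l m ℝ →L[ℝ] Matrix m l ℝ :=
  (Matrix.transposeLinearEquiv l m ℝ ℝ).toLinearMap.toContinuousLinearMap

/-- The trace as a continuous linear map. -/
def traceCLM (l : Type*) [Fintype l] : Matrix l l ℝ →L[ℝ] ℝ :=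
  (Matrix.traceLinearMap l ℝ ℝ).toContinuousLinearMap

theorem contDiffAt_mul {f : D → Matrix l m ℝ} {g : D → Matrix m n ℝ} {x : D} {k : WithTop ℕ∞}
    (hf : ContDiffAt ℝ k f x) (hg : ContDiffAt ℝ k g x) :
    ContDiffAt ℝ k (fun y => f y * g y) x :=
  (mulCLM l m n).isBoundedBilinearMap.contDiff.contDiffAt.comp x (hf.prodMk hg)

theorem hasFDerivAt_mul {f : D → Matrix l m ℝ} {g : D → Matrix m n ℝ} {x : D}
    (hf : DifferentiableAt ℝ f x) (hg : DifferentiableAt ℝ g x) :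
    HasFDerivAt (fun y => f y * g y)
      ((mulCLM l m n).precompR D (f x) (fderiv ℝ g x)
        + (mulCLM l m n).precompL D (fderiv ℝ f x) (g x)) x :=
  (mulCLM l m n).hasFDerivAt_of_bilinear hf.hasFDerivAt hg.hasFDerivAt

theorem differentiableAt_mul {f : D → Matrix l m ℝ} {g : D → Matrix m n ℝ} {x : D}
    (hf : DifferentiableAt ℝ f x) (hg : DifferentiableAt ℝ g x) :
    DifferentiableAt ℝ (fun y => f y * g y) x :=
  (hasFDerivAt_mul hf hg).differentiableAt

theorem fderiv_mul_apply {f : D → Matrix l m ℝ} {g : D → Matrix m n ℝ} {x : D}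
    (hf : DifferentiableAt ℝ f x) (hg : DifferentiableAt ℝ g x) (u : D) :
    fderiv ℝ (fun y => f y * g y) x u = f x * fderiv ℝ g x u + fderiv ℝ f x u * g x := by
  exact DFunLike.congr_fun (hasFDerivAt_mul hf hg).fderiv u

theorem contDiffAt_transpose {f : D → Matrix l m ℝ} {x : D} {k : WithTop ℕ∞}
    (hf : ContDiffAt ℝ k f x) : ContDiffAt ℝ k (fun y => (f y)ᵀ) x :=
  (transposeCLM l m).contDiff.contDiffAt.comp x hf

theorem differentiableAt_transpose {f : D → Matrix l m ℝ} {x : D}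
    (hf : DifferentiableAt ℝ f x) : DifferentiableAt ℝ (fun y => (f y)ᵀ) x :=
  (transposeCLM l m).differentiableAt.comp x hf

theorem fderiv_transpose_apply {f : D → Matrix l m ℝ} {x : D}
    (hf : DifferentiableAt ℝ f x) (u : D) :
    fderiv ℝ (fun y => (f y)ᵀ) x u = (fderiv ℝ f x u)ᵀ := by
  exact DFunLike.congr_fun ((transposeCLM l m).hasFDerivAt.comp x hf.hasFDerivAt).fderiv u

theorem contDiffAt_trace {f : D → Matrix l l ℝ} {x : D} {k : WithTop ℕ∞}
    (hf : ContDiffAt ℝ k f x) : ContDiffAt ℝ k (fun y => (f y).trace) x :=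
  (traceCLM l).contDiff.contDiffAt.comp x hf

theorem fderiv_trace_apply {f : D → Matrix l l ℝ} {x : D}
    (hf : DifferentiableAt ℝ f x) (u : D) :
    fderiv ℝ (fun y => (f y).trace) x u = (fderiv ℝ f x u).trace := by
  exact DFunLike.congr_fun ((traceCLM l).hasFDerivAt.comp x hf.hasFDerivAt).fderiv u

theorem contDiffAt_matrix {f : D → Matrix l m ℝ} {x : D} {k : WithTop ℕ∞} :
    ContDiffAt ℝ k f x ↔ ∀ i j, ContDiffAt ℝ k (fun y => f y i j) x := by
  refine (contDiffAt_pi (𝕜 := ℝ) (Φ := f)).trans (forall_congr' fun i => ?_)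
  exact contDiffAt_pi (𝕜 := ℝ) (Φ := fun y => f y i)

variable [DecidableEq l]

theorem contDiffAt_det {f : D → Matrix l l ℝ} {x : D} {k : WithTop ℕ∞}
    (hf : ContDiffAt ℝ k f x) : ContDiffAt ℝ k (fun y => (f y).det) x := by
  simp only [Matrix.det_apply]
  refine ContDiffAt.sum fun σ _ => ContDiffAt.const_smul _ ?_
  exact contDiffAt_prod fun i _ => contDiffAt_matrix.1 hf _ _

theorem contDiffAt_inv {f : D → Matrix l l ℝ} {x : D} {k : WithTop ℕ∞}
    (hf : ContDiffAt ℝ k f x) (h : (f x).det ≠ 0) : ContDiffAt ℝ k (fun y => (f y)⁻¹) x := by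
  rw [contDiffAt_matrix]
  intro i j
  simp only [Matrix.inv_def, Matrix.smul_apply, Matrix.adjugate_apply, smul_eq_mul,
    Ring.inverse_eq_inv']
  refine ((contDiffAt_det hf).inv h).mul (contDiffAt_det ?_)
  rw [contDiffAt_matrix]
  intro a b
  by_cases hab : a = j
  · subst hab; simpa using contDiffAt_const
  · simpa [Matrix.updateRow_ne hab] using contDiffAt_matrix.1 hf a b

theorem fderiv_inv_apply {f : D → Matrix l l ℝ} {x : D} (hf : ContDiffAt ℝ 1 f x)
    (h : (f x).det ≠ 0) (u : D) :
    fderiv ℝ (fun y => (f y)⁻¹) x u = -((f x)⁻¹ * fderiv ℝ f x u * (f x)⁻¹) := by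
  have hi : DifferentiableAt ℝ (fun y => (f y)⁻¹) x :=
    (contDiffAt_inv hf h).differentiableAt one_ne_zero
  have hfd := hf.differentiableAt one_ne_zero
  have hev : (fun y => (f y)⁻¹ * f y) =ᶠ[nhds x] fun _ => 1 := by
    filter_upwards [(contDiffAt_det hf).continuousAt.eventually_ne h] with y hy
    exact Matrix.nonsing_inv_mul _ (isUnit_iff_ne_zero.2 hy)
  have h1 := fderiv_mul_apply hi hfd u
  rw [hev.fderiv_eq] at h1
  simp only [fderiv_fun_const, Pi.zero_apply, zero_apply] at h1
  have h2 : fderiv ℝ (fun y => (f y)⁻¹) x u * f x = -((f x)⁻¹ * fderiv ℝ f x u) := by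
    rw [eq_neg_iff_add_eq_zero, add_comm]; exact h1.symm
  calc _ = fderiv ℝ (fun y => (f y)⁻¹) x u * f x * (f x)⁻¹ := by
        rw [Matrix.mul_assoc, Matrix.mul_nonsing_inv _ (isUnit_iff_ne_zero.2 h), Matrix.mul_one]
    _ = _ := by rw [h2, Matrix.neg_mul]

end MatCalc

/-! ### The invariant tensors of the quadric at a point -/

namespace HypQuadric

open MatCalc

variable {m : ℕ}

theorem gram_transpose (W : Vec m) : (gram W)ᵀ = gram W := by
  simp [gram, Matrix.transpose_sub, Matrix.transpose_mul]

theorem cogram_transpose (W : Vec m) : (cogram W)ᵀ = cogram W := by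
  simp [cogram, Matrix.transpose_sub, Matrix.transpose_mul]

theorem gram_inv_transpose (W : Vec m) : ((gram W)⁻¹)ᵀ = (gram W)⁻¹ := by
  rw [Matrix.transpose_nonsing_inv, gram_transpose]

theorem cogram_inv_transpose (W : Vec m) : ((cogram W)⁻¹)ᵀ = (cogram W)⁻¹ := by
  rw [Matrix.transpose_nonsing_inv, cogram_transpose]

theorem gram_posDef {W : Vec m} (hW : W ∈ domain m) : (gram W).PosDef := hW

theorem gram_det_pos {W : Vec m} (hW : W ∈ domain m) : 0 < (gram W).det := (gram_posDef hW).det_pos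

theorem cogram_det (W : Vec m) : (cogram W).det = (gram W).det :=
  Matrix.det_one_sub_mul_comm _ _

theorem cogram_det_pos {W : Vec m} (hW : W ∈ domain m) : 0 < (cogram W).det := by
  rw [cogram_det]; exact gram_det_pos hW

theorem gram_mul_inv {W : Vec m} (hW : W ∈ domain m) : gram W * (gram W)⁻¹ = 1 :=
  Matrix.mul_nonsing_inv _ (isUnit_iff_ne_zero.2 (gram_det_pos hW).ne')

theorem gram_inv_mul {W : Vec m} (hW : W ∈ domain m) : (gram W)⁻¹ * gram W = 1 :=
  Matrix.nonsing_inv_mul _ (isUnit_iff_ne_zero.2 (gram_det_pos hW).ne')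

theorem cogram_mul_inv {W : Vec m} (hW : W ∈ domain m) : cogram W * (cogram W)⁻¹ = 1 :=
  Matrix.mul_nonsing_inv _ (isUnit_iff_ne_zero.2 (cogram_det_pos hW).ne')

theorem cogram_inv_mul {W : Vec m} (hW : W ∈ domain m) : (cogram W)⁻¹ * cogram W = 1 :=
  Matrix.nonsing_inv_mul _ (isUnit_iff_ne_zero.2 (cogram_det_pos hW).ne')

/-- The coefficient `(1 - Wᵀ W)⁻¹ Wᵀ` of the Levi-Civita connection of the quadric. -/
def connCoeff (W : Vec m) : Matrix (Fin 2) (Fin m) ℝ := (gram W)⁻¹ * (mat W)ᵀ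

theorem connCoeff_eq {W : Vec m} (hW : W ∈ domain m) :
    connCoeff W = (mat W)ᵀ * (cogram W)⁻¹ := by
  have h : gram W * (mat W)ᵀ = (mat W)ᵀ * cogram W := by
    simp [gram, cogram, Matrix.sub_mul, Matrix.mul_sub, Matrix.mul_assoc]
  calc connCoeff W = (gram W)⁻¹ * ((mat W)ᵀ * cogram W) * (cogram W)⁻¹ := by
        rw [Matrix.mul_assoc, Matrix.mul_assoc, cogram_mul_inv hW, Matrix.mul_one, connCoeff]
    _ = _ := by rw [← h, ← Matrix.mul_assoc, gram_inv_mul hW, Matrix.one_mul]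

theorem mul_connCoeff {W : Vec m} (hW : W ∈ domain m) :
    mat W * connCoeff W = (cogram W)⁻¹ - 1 := by
  have h : mat W * (mat W)ᵀ = 1 - cogram W := by simp [cogram]
  rw [connCoeff_eq hW, ← Matrix.mul_assoc, h, Matrix.sub_mul, cogram_mul_inv hW, Matrix.one_mul]

theorem connCoeff_transpose (W : Vec m) : (connCoeff W)ᵀ = mat W * (gram W)⁻¹ := by
  rw [connCoeff, Matrix.transpose_mul, gram_inv_transpose, Matrix.transpose_transpose]

theorem connCoeff_transpose' {W : Vec m} (hW : W ∈ domain m) :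
    (connCoeff W)ᵀ = (cogram W)⁻¹ * mat W := by
  rw [connCoeff_eq hW, Matrix.transpose_mul, cogram_inv_transpose, Matrix.transpose_transpose]

theorem adj_add (W X Y : Vec m) : adj W (X + Y) = adj W X + adj W Y := by
  simp [adj, mat_add, Matrix.mul_add, Matrix.add_mul]

theorem adj_smul (W : Vec m) (c : ℝ) (X : Vec m) : adj W (c • X) = c • adj W X := by
  simp [adj, mat_smul]

theorem adj_neg (W X : Vec m) : adj W (-X) = -adj W X := by
  simpa using adj_smul W (-1) X

theorem adj_sub (W X Y : Vec m) : adj W (X - Y) = adj W X - adj W Y := by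
  rw [sub_eq_add_neg, adj_add, adj_neg, sub_eq_add_neg]

theorem mat_neg (X : Vec m) : mat (-X) = -mat X := rfl

theorem mat_sub (X Y : Vec m) : mat (X - Y) = mat X - mat Y := rfl

theorem mat_of (A : Matrix (Fin m) (Fin 2) ℝ) : mat (Matrix.of.symm A) = A := rfl

theorem mat_injective : Function.Injective (mat : Vec m → _) := fun _ _ h => h

theorem metric_apply (W X Y : Vec m) : metric W X Y = (adj W X * mat Y).trace := rfl

/-- Transposition exchanges `X^*` and `X` up to the Gram matrices. -/
theorem adj_transpose (W X : Vec m) :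
    (adj W X)ᵀ = (cogram W)⁻¹ * mat X * (gram W)⁻¹ := by
  simp [adj, Matrix.transpose_mul, gram_inv_transpose, cogram_inv_transpose, Matrix.mul_assoc]

theorem metric_comm (W X Y : Vec m) : metric W X Y = metric W Y X := by
  rw [metric_apply, metric_apply, ← Matrix.trace_transpose, Matrix.transpose_mul, adj_transpose,
    adj]
  rw [Matrix.mul_assoc (cogram W)⁻¹, ← Matrix.mul_assoc, Matrix.trace_mul_comm,
    Matrix.mul_assoc (mat X), ← Matrix.mul_assoc (gram W)⁻¹, Matrix.trace_mul_comm]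

theorem cogram_inv_posDef {W : Vec m} (hW : W ∈ domain m) : ((cogram W)⁻¹).PosDef := by
  have h : (cogram W)⁻¹ = 1 + mat W * (gram W)⁻¹ * (mat W)ᴴ := by
    have := mul_connCoeff hW
    rw [connCoeff, ← Matrix.mul_assoc] at this
    rw [Matrix.conjTranspose_eq_transpose_of_trivial, this]; abel
  rw [h]
  exact Matrix.PosDef.one.add_posSemidef
    ((gram_posDef hW).inv.posSemidef.mul_mul_conjTranspose_same _)

open scoped MatrixOrder in
/-- A positive definite matrix is `Cᵀ C` for an invertible matrix `C`. -/
theorem exists_eq_transpose_mul_self {n : Type*} [Fintype n] [DecidableEq n] {A : Matrix n n ℝ}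
    (hA : A.PosDef) : ∃ C : Matrix n n ℝ, IsUnit C.det ∧ A = Cᵀ * C := by
  obtain ⟨C, hC, h⟩ := CStarAlgebra.isStrictlyPositive_iff_eq_star_mul_self.mp
    hA.isStrictlyPositive
  exact ⟨C, (Matrix.isUnit_iff_isUnit_det _).1 hC, h⟩

theorem metric_self_pos {W : Vec m} (hW : W ∈ domain m) {X : Vec m} (hX : X ≠ 0) :
    0 < metric W X X := by
  obtain ⟨C, hC, hG⟩ := exists_eq_transpose_mul_self (gram_posDef hW).inv
  obtain ⟨B, hB, hH⟩ := exists_eq_transpose_mul_self (cogram_inv_posDef hW)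
  have h1 : metric W X X = ((B * mat X * Cᵀ)ᴴ * (B * mat X * Cᵀ)).trace := by
    rw [metric_apply, adj, hG, hH, Matrix.conjTranspose_eq_transpose_of_trivial]
    simp only [Matrix.transpose_mul, Matrix.transpose_transpose, Matrix.mul_assoc]
    rw [Matrix.trace_mul_comm]
    simp only [Matrix.mul_assoc]
  rw [h1]
  refine lt_of_le_of_ne (Matrix.posSemidef_conjTranspose_mul_self _).trace_nonneg
    fun h0 => hX ?_
  have h3 := Matrix.trace_conjTranspose_mul_self_eq_zero_iff.1 h0.symm
  have hC' : IsUnit (Cᵀ).det := by rwa [Matrix.det_transpose]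
  apply mat_injective
  calc mat X = B⁻¹ * (B * mat X * Cᵀ) * (Cᵀ)⁻¹ := by
        rw [Matrix.mul_assoc, Matrix.mul_assoc, Matrix.mul_nonsing_inv _ hC', Matrix.mul_one,
          ← Matrix.mul_assoc, Matrix.nonsing_inv_mul _ hB, Matrix.one_mul]
    _ = mat 0 := by rw [h3, Matrix.mul_zero, Matrix.zero_mul]; rfl

theorem metric_self_eq_zero {W : Vec m} (hW : W ∈ domain m) {X : Vec m} :
    metric W X X = 0 ↔ X = 0 :=
  ⟨fun h => by_contra fun hX => (metric_self_pos hW hX).ne' h, fun h => by simp [h]⟩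

theorem metric_injective {W : Vec m} (hW : W ∈ domain m) : Function.Injective (metric W) := by
  rw [injective_iff_map_eq_zero]
  intro X hX
  exact (metric_self_eq_zero hW).1 (by rw [hX]; rfl)

/-- The matrix of the complex structure: `J X = X j`. -/
def jMat (W : Vec m) : Matrix (Fin 2) (Fin 2) ℝ :=
  Real.sqrt (gram W).det • ((gram W)⁻¹ * !![0, -1; 1, 0])

theorem mat_J (W X : Vec m) : mat (J W X) = mat X * jMat W := rfl

/-- The Christoffel symbols `X K Y + Y K X` of the quadric, with `K = connCoeff W`. -/
def conn (W X Y : Vec m) : Vec m :=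
  Matrix.of.symm (mat X * connCoeff W * mat Y + mat Y * connCoeff W * mat X)

theorem mat_conn (W X Y : Vec m) :
    mat (conn W X Y) = mat X * connCoeff W * mat Y + mat Y * connCoeff W * mat X := rfl

theorem conn_comm (W X Y : Vec m) : conn W X Y = conn W Y X := by
  apply mat_injective; rw [mat_conn, mat_conn, add_comm]

/-- The Jordan triple product `X Y^* Z`, a parallel tensor. -/
def triple (W X Y Z : Vec m) : Vec m := Matrix.of.symm (mat X * adj W Y * mat Z)

theorem mat_triple (W X Y Z : Vec m) : mat (triple W X Y Z) = mat X * adj W Y * mat Z := rfl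

/-- The curvature tensor of the quadric, `R(U, V) Z = -[[U, V], Z]` in `𝔰𝔬(2, m)`. -/
def curv (W U V Z : Vec m) : Vec m :=
  triple W V U Z - triple W U V Z + (triple W Z U V - triple W Z V U)

/-- For `2 × 2` matrices, `G⁻¹ Θᵀ G`, the adjoint for the form `G`, is `tr Θ + j Θ j`. -/
theorem gram_adjoint {W : Vec m} (hW : W ∈ domain m) (Θ : Matrix (Fin 2) (Fin 2) ℝ) :
    (gram W)⁻¹ * Θᵀ * gram W = Θ.trace • 1 + jMat W * Θ * jMat W := by
  have hdet := gram_det_pos hW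
  have hs : Real.sqrt (gram W).det * Real.sqrt (gram W).det = (gram W).det :=
    Real.mul_self_sqrt hdet.le
  have h1 : jMat W * Θ * jMat W = (gram W).det •
      ((gram W)⁻¹ * !![0, -1; 1, 0] * Θ * ((gram W)⁻¹ * !![0, -1; 1, 0])) := by
    simp only [jMat, Matrix.smul_mul, Matrix.mul_smul, smul_smul, hs]
  have h2 : (gram W)⁻¹ * !![0, -1; 1, 0] = (gram W).det⁻¹ • (!![0, -1; 1, 0] * gram W) := by
    rw [Matrix.inv_def, Matrix.adjugate_fin_two, Ring.inverse_eq_inv', Matrix.smul_mul]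
    congr 1
    have := congrFun (congrFun (gram_transpose W) 0) 1
    rw [Matrix.transpose_apply] at this
    ext i j
    fin_cases i <;> fin_cases j <;> simp [Matrix.mul_apply, Fin.sum_univ_two, this]
  have h3 : !![0, -1; 1, 0] * Θ * !![0, -1; 1, 0] = Θᵀ - Θ.trace • 1 := by
    ext i j
    fin_cases i <;> fin_cases j <;>
      simp [Matrix.mul_apply, Fin.sum_univ_two, Matrix.trace_fin_two, Matrix.vecMul,
        dotProduct]
  calc (gram W)⁻¹ * Θᵀ * gram W
      = (gram W)⁻¹ * (Θ.trace • 1 + !![0, -1; 1, 0] * Θ * !![0, -1; 1, 0]) * gram W := by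
        rw [h3]; congr 2; abel
    _ = Θ.trace • 1 + (gram W)⁻¹ * !![0, -1; 1, 0] * Θ * (!![0, -1; 1, 0] * gram W) := by
        rw [Matrix.mul_add, Matrix.add_mul, Matrix.mul_smul, Matrix.mul_one, Matrix.smul_mul,
          gram_inv_mul hW]
        simp only [Matrix.mul_assoc]
    _ = _ := by
        rw [h1]
        nth_rewrite 3 [h2]
        rw [Matrix.mul_smul, smul_smul, mul_inv_cancel₀ hdet.ne', one_smul]

theorem jMat_mul_self {W : Vec m} (hW : W ∈ domain m) : jMat W * jMat W = -1 := by
  have h := gram_adjoint hW 1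
  rw [Matrix.transpose_one, Matrix.mul_one, gram_inv_mul hW, Matrix.mul_one, Matrix.trace_one] at h
  have h2 : jMat W * jMat W = 1 - (2 : ℝ) • (1 : Matrix (Fin 2) (Fin 2) ℝ) := by
    rw [eq_sub_iff_add_eq, add_comm]; simpa using h.symm
  rw [h2, two_smul]; abel

theorem jMat_trace (W : Vec m) : (jMat W).trace = 0 := by
  have := congrFun (congrFun (gram_inv_transpose W) 0) 1
  rw [Matrix.transpose_apply] at this
  simp [jMat, Matrix.trace_fin_two, Matrix.mul_apply, Fin.sum_univ_two, this]

/-- The matrix `j` is skew for the form `G`. -/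
theorem jMat_skew {W : Vec m} (hW : W ∈ domain m) :
    (gram W)⁻¹ * (jMat W)ᵀ = -(jMat W * (gram W)⁻¹) := by
  have h := gram_adjoint hW (jMat W)
  rw [jMat_trace, zero_smul, zero_add, jMat_mul_self hW, Matrix.neg_mul, Matrix.one_mul] at h
  calc (gram W)⁻¹ * (jMat W)ᵀ = (gram W)⁻¹ * (jMat W)ᵀ * gram W * (gram W)⁻¹ := by
        rw [Matrix.mul_assoc _ (gram W), gram_mul_inv hW, Matrix.mul_one]
    _ = _ := by rw [h, Matrix.neg_mul]

theorem adj_J {W : Vec m} (hW : W ∈ domain m) (X : Vec m) :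
    adj W (J W X) = -(jMat W * adj W X) := by
  rw [adj, mat_J, Matrix.transpose_mul, ← Matrix.mul_assoc, jMat_skew hW, adj]
  simp only [Matrix.neg_mul, Matrix.mul_assoc]

theorem J_J {W : Vec m} (hW : W ∈ domain m) (X : Vec m) : J W (J W X) = -X := by
  apply mat_injective
  rw [mat_J, mat_J, Matrix.mul_assoc, jMat_mul_self hW]; simp [mat_neg]

theorem metric_J_left {W : Vec m} (hW : W ∈ domain m) (X Y : Vec m) :
    metric W (J W X) Y = -metric W X (J W Y) := by
  rw [metric_apply, metric_apply, adj_J hW, mat_J, Matrix.neg_mul, Matrix.trace_neg,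
    Matrix.mul_assoc, Matrix.trace_mul_comm, Matrix.mul_assoc]

theorem metric_J_J {W : Vec m} (hW : W ∈ domain m) (X Y : Vec m) :
    metric W (J W X) (J W Y) = metric W X Y := by
  rw [metric_J_left hW, J_J hW, map_neg, neg_neg]

end HypQuadric

/-! ### Covariant differentiation along a map into the quadric -/

namespace HypQuadric

open MatCalc

variable {m : ℕ} {E : Type*} [NormedAddCommGroup E] [NormedSpace ℝ E]

theorem contDiffAt_mat {X : E → Vec m} {x : E} {k : WithTop ℕ∞} (hX : ContDiffAt ℝ k X x) :
    ContDiffAt ℝ k (fun y => mat (X y)) x := hX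

theorem contDiffAt_of_mat {X : E → Vec m} {x : E} {k : WithTop ℕ∞}
    (hX : ContDiffAt ℝ k (fun y => mat (X y)) x) : ContDiffAt ℝ k X x := hX

theorem differentiableAt_mat {X : E → Vec m} {x : E} (hX : DifferentiableAt ℝ X x) :
    DifferentiableAt ℝ (fun y => mat (X y)) x := hX

theorem fderiv_mat_apply (X : E → Vec m) (x u : E) :
    fderiv ℝ (fun y => mat (X y)) x u = mat (fderiv ℝ X x u) := rfl

section Smooth

variable {F X Y Z : E → Vec m} {x : E} {k : WithTop ℕ∞}

theorem contDiffAt_gram (hF : ContDiffAt ℝ k F x) : ContDiffAt ℝ k (fun y => gram (F y)) x :=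
  contDiffAt_const.sub
    (contDiffAt_mul (contDiffAt_transpose (contDiffAt_mat hF)) (contDiffAt_mat hF))

theorem contDiffAt_cogram (hF : ContDiffAt ℝ k F x) : ContDiffAt ℝ k (fun y => cogram (F y)) x :=
  contDiffAt_const.sub
    (contDiffAt_mul (contDiffAt_mat hF) (contDiffAt_transpose (contDiffAt_mat hF)))

theorem contDiffAt_gram_inv (hF : ContDiffAt ℝ k F x) (hW : F x ∈ domain m) :
    ContDiffAt ℝ k (fun y => (gram (F y))⁻¹) x :=
  contDiffAt_inv (contDiffAt_gram hF) (gram_det_pos hW).ne'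

theorem contDiffAt_cogram_inv (hF : ContDiffAt ℝ k F x) (hW : F x ∈ domain m) :
    ContDiffAt ℝ k (fun y => (cogram (F y))⁻¹) x :=
  contDiffAt_inv (contDiffAt_cogram hF) (cogram_det_pos hW).ne'

theorem contDiffAt_connCoeff (hF : ContDiffAt ℝ k F x) (hW : F x ∈ domain m) :
    ContDiffAt ℝ k (fun y => connCoeff (F y)) x :=
  contDiffAt_mul (contDiffAt_gram_inv hF hW) (contDiffAt_transpose (contDiffAt_mat hF))

theorem contDiffAt_adj (hF : ContDiffAt ℝ k F x) (hW : F x ∈ domain m)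
    (hX : ContDiffAt ℝ k X x) : ContDiffAt ℝ k (fun y => adj (F y) (X y)) x :=
  contDiffAt_mul (contDiffAt_mul (contDiffAt_gram_inv hF hW)
    (contDiffAt_transpose (contDiffAt_mat hX))) (contDiffAt_cogram_inv hF hW)

theorem contDiffAt_metric (hF : ContDiffAt ℝ k F x) (hW : F x ∈ domain m)
    (hX : ContDiffAt ℝ k X x) (hY : ContDiffAt ℝ k Y x) :
    ContDiffAt ℝ k (fun y => metric (F y) (X y) (Y y)) x :=
  contDiffAt_trace (contDiffAt_mul (contDiffAt_adj hF hW hX) (contDiffAt_mat hY))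

theorem contDiffAt_conn (hF : ContDiffAt ℝ k F x) (hW : F x ∈ domain m)
    (hX : ContDiffAt ℝ k X x) (hY : ContDiffAt ℝ k Y x) :
    ContDiffAt ℝ k (fun y => conn (F y) (X y) (Y y)) x :=
  contDiffAt_of_mat ((contDiffAt_mul (contDiffAt_mul (contDiffAt_mat hX)
    (contDiffAt_connCoeff hF hW)) (contDiffAt_mat hY)).add
    (contDiffAt_mul (contDiffAt_mul (contDiffAt_mat hY)
      (contDiffAt_connCoeff hF hW)) (contDiffAt_mat hX)))

theorem contDiffAt_triple (hF : ContDiffAt ℝ k F x) (hW : F x ∈ domain m)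
    (hX : ContDiffAt ℝ k X x) (hY : ContDiffAt ℝ k Y x) (hZ : ContDiffAt ℝ k Z x) :
    ContDiffAt ℝ k (fun y => triple (F y) (X y) (Y y) (Z y)) x :=
  contDiffAt_of_mat (contDiffAt_mul (contDiffAt_mul (contDiffAt_mat hX)
    (contDiffAt_adj hF hW hY)) (contDiffAt_mat hZ))

theorem contDiffAt_curv {U : E → Vec m} (hF : ContDiffAt ℝ k F x) (hW : F x ∈ domain m)
    (hU : ContDiffAt ℝ k U x)
    (hX : ContDiffAt ℝ k X x) (hY : ContDiffAt ℝ k Y x) :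
    ContDiffAt ℝ k (fun y => curv (F y) (U y) (X y) (Y y)) x :=
  ((contDiffAt_triple hF hW hX hU hY).sub (contDiffAt_triple hF hW hU hX hY)).add
    ((contDiffAt_triple hF hW hY hU hX).sub (contDiffAt_triple hF hW hY hX hU))

theorem contDiffAt_jMat (hF : ContDiffAt ℝ k F x) (hW : F x ∈ domain m) :
    ContDiffAt ℝ k (fun y => jMat (F y)) x :=
  ((contDiffAt_det (contDiffAt_gram hF)).sqrt (gram_det_pos hW).ne').smul
    (contDiffAt_mul (contDiffAt_gram_inv hF hW) contDiffAt_const)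

theorem contDiffAt_J (hF : ContDiffAt ℝ k F x) (hW : F x ∈ domain m)
    (hX : ContDiffAt ℝ k X x) : ContDiffAt ℝ k (fun y => J (F y) (X y)) x :=
  contDiffAt_of_mat (contDiffAt_mul (contDiffAt_mat hX) (contDiffAt_jMat hF hW))

end Smooth

/-- The covariant derivative `D_u X` of the vector field `X` along the map `F`. -/
def cov (F X : E → Vec m) (x u : E) : Vec m :=
  fderiv ℝ X x u + conn (F x) (fderiv ℝ F x u) (X x)

theorem mat_cov (F X : E → Vec m) (x u : E) :
    mat (cov F X x u) = mat (fderiv ℝ X x u) + (mat (fderiv ℝ F x u) * connCoeff (F x) * mat (X x)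
      + mat (X x) * connCoeff (F x) * mat (fderiv ℝ F x u)) := rfl

section Rules

variable {F X Y Z : E → Vec m} {x : E}

theorem fderiv_gram_apply (hF : ContDiffAt ℝ 1 F x) (u : E) :
    fderiv ℝ (fun y => gram (F y)) x u =
      -((mat (F x))ᵀ * mat (fderiv ℝ F x u) + (mat (fderiv ℝ F x u))ᵀ * mat (F x)) := by
  have hd : DifferentiableAt ℝ (fun y => mat (F y)) x := hF.differentiableAt one_ne_zero
  have h := fderiv_mul_apply (differentiableAt_transpose hd) hd u
  rw [fderiv_transpose_apply hd, fderiv_mat_apply] at h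
  rw [← h]
  exact DFunLike.congr_fun (fderiv_const_sub (𝕜 := ℝ) (1 : Matrix (Fin 2) (Fin 2) ℝ)) u

theorem fderiv_cogram_apply (hF : ContDiffAt ℝ 1 F x) (u : E) :
    fderiv ℝ (fun y => cogram (F y)) x u =
      -(mat (F x) * (mat (fderiv ℝ F x u))ᵀ + mat (fderiv ℝ F x u) * (mat (F x))ᵀ) := by
  have hd : DifferentiableAt ℝ (fun y => mat (F y)) x := hF.differentiableAt one_ne_zero
  have h := fderiv_mul_apply hd (differentiableAt_transpose hd) u
  rw [fderiv_transpose_apply hd, fderiv_mat_apply] at h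
  rw [← h]
  exact DFunLike.congr_fun (fderiv_const_sub (𝕜 := ℝ) (1 : Matrix (Fin m) (Fin m) ℝ)) u

theorem fderiv_connCoeff_apply (hF : ContDiffAt ℝ 1 F x) (hW : F x ∈ domain m) (u : E) :
    fderiv ℝ (fun y => connCoeff (F y)) x u = adj (F x) (fderiv ℝ F x u)
      + connCoeff (F x) * mat (fderiv ℝ F x u) * connCoeff (F x) := by
  have hd : DifferentiableAt ℝ (fun y => mat (F y)) x := hF.differentiableAt one_ne_zero
  have h := fderiv_mul_apply ((contDiffAt_gram_inv hF hW).differentiableAt one_ne_zero)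
    (differentiableAt_transpose hd) u
  rw [fderiv_transpose_apply hd, fderiv_mat_apply,
    fderiv_inv_apply (contDiffAt_gram hF) (gram_det_pos hW).ne', fderiv_gram_apply hF] at h
  have hK : mat (F x) * ((gram (F x))⁻¹ * (mat (F x))ᵀ) = (cogram (F x))⁻¹ - 1 :=
    mul_connCoeff hW
  refine h.trans ?_
  rw [adj, connCoeff]
  simp only [Matrix.mul_neg, Matrix.neg_mul, neg_neg, Matrix.mul_add, Matrix.add_mul,
    Matrix.mul_assoc, hK, Matrix.mul_sub, Matrix.mul_one]
  abel

theorem differentiableAt_adj (hF : ContDiffAt ℝ 1 F x) (hW : F x ∈ domain m)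
    (hX : DifferentiableAt ℝ X x) : DifferentiableAt ℝ (fun y => adj (F y) (X y)) x :=
  differentiableAt_mul (differentiableAt_mul
    ((contDiffAt_gram_inv hF hW).differentiableAt one_ne_zero)
    (differentiableAt_transpose (differentiableAt_mat hX)))
    ((contDiffAt_cogram_inv hF hW).differentiableAt one_ne_zero)

theorem fderiv_adj_apply (hF : ContDiffAt ℝ 1 F x) (hW : F x ∈ domain m)
    (hX : DifferentiableAt ℝ X x) (u : E) :
    fderiv ℝ (fun y => adj (F y) (X y)) x u = adj (F x) (cov F X x u)
      + (connCoeff (F x) * mat (fderiv ℝ F x u) * adj (F x) (X x)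
        + adj (F x) (X x) * mat (fderiv ℝ F x u) * connCoeff (F x)) := by
  have hXm := differentiableAt_mat hX
  have hg := (contDiffAt_gram_inv hF hW).differentiableAt one_ne_zero
  have hc := (contDiffAt_cogram_inv hF hW).differentiableAt one_ne_zero
  have h := fderiv_mul_apply (differentiableAt_mul hg (differentiableAt_transpose hXm)) hc u
  rw [fderiv_mul_apply hg (differentiableAt_transpose hXm), fderiv_transpose_apply hXm,
    fderiv_mat_apply, fderiv_inv_apply (contDiffAt_gram hF) (gram_det_pos hW).ne',
    fderiv_inv_apply (contDiffAt_cogram hF) (cogram_det_pos hW).ne', fderiv_gram_apply hF,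
    fderiv_cogram_apply hF] at h
  refine h.trans ?_
  have e1 : adj (F x) (cov F X x u) = (gram (F x))⁻¹ * (mat (fderiv ℝ X x u))ᵀ * (cogram (F x))⁻¹
      + ((gram (F x))⁻¹ * (mat (X x))ᵀ * ((cogram (F x))⁻¹ * mat (F x))
          * (mat (fderiv ℝ F x u))ᵀ * (cogram (F x))⁻¹
        + (gram (F x))⁻¹ * (mat (fderiv ℝ F x u))ᵀ * (mat (F x) * (gram (F x))⁻¹)
          * (mat (X x))ᵀ * (cogram (F x))⁻¹) := by
    rw [adj, mat_cov, ← connCoeff_transpose, ← connCoeff_transpose' hW]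
    simp only [Matrix.transpose_add, Matrix.transpose_mul, Matrix.mul_add, Matrix.add_mul,
      Matrix.mul_assoc]
  rw [e1]
  nth_rewrite 2 [connCoeff_eq hW]
  rw [connCoeff, adj]
  simp only [Matrix.mul_neg, Matrix.neg_mul, neg_neg, Matrix.mul_add, Matrix.add_mul,
    Matrix.mul_assoc]
  abel

/-- The Levi-Civita connection of the quadric is metric. -/
theorem fderiv_metric_apply (hF : ContDiffAt ℝ 1 F x) (hW : F x ∈ domain m)
    (hX : DifferentiableAt ℝ X x) (hY : DifferentiableAt ℝ Y x) (u : E) :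
    fderiv ℝ (fun y => metric (F y) (X y) (Y y)) x u =
      metric (F x) (cov F X x u) (Y x) + metric (F x) (X x) (cov F Y x u) := by
  have hX1 := differentiableAt_adj hF hW hX
  have hd := differentiableAt_mul hX1 (differentiableAt_mat hY)
  have h := fderiv_trace_apply hd u
  rw [fderiv_mul_apply hX1 (differentiableAt_mat hY), fderiv_mat_apply,
    fderiv_adj_apply hF hW hX] at h
  refine h.trans ?_
  rw [metric_apply, metric_apply, mat_cov]
  simp only [Matrix.mul_add, Matrix.add_mul, Matrix.trace_add]
  have e1 : (connCoeff (F x) * mat (fderiv ℝ F x u) * adj (F x) (X x) * mat (Y x)).trace =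
      (adj (F x) (X x) * (mat (Y x) * connCoeff (F x) * mat (fderiv ℝ F x u))).trace := by
    simp only [Matrix.mul_assoc]
    rw [← Matrix.mul_assoc (connCoeff (F x)), Matrix.trace_mul_comm]
    simp only [Matrix.mul_assoc]
  rw [e1]
  simp only [Matrix.mul_assoc]
  ring

theorem differentiableAt_conn (hF : ContDiffAt ℝ 1 F x) (hW : F x ∈ domain m)
    (hX : DifferentiableAt ℝ X x) (hY : DifferentiableAt ℝ Y x) :
    DifferentiableAt ℝ (fun y => conn (F y) (X y) (Y y)) x :=
  have hK := (contDiffAt_connCoeff hF hW).differentiableAt one_ne_zero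
  (differentiableAt_mul (differentiableAt_mul (differentiableAt_mat hX) hK)
    (differentiableAt_mat hY)).add (differentiableAt_mul (differentiableAt_mul
    (differentiableAt_mat hY) hK) (differentiableAt_mat hX))

theorem mat_fderiv_conn (hF : ContDiffAt ℝ 1 F x) (hW : F x ∈ domain m)
    (hX : DifferentiableAt ℝ X x) (hY : DifferentiableAt ℝ Y x) (u : E) :
    mat (fderiv ℝ (fun y => conn (F y) (X y) (Y y)) x u) =
      mat (conn (F x) (fderiv ℝ X x u) (Y x)) + mat (conn (F x) (X x) (fderiv ℝ Y x u))
      + (mat (X x) * (adj (F x) (fderiv ℝ F x u)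
          + connCoeff (F x) * mat (fderiv ℝ F x u) * connCoeff (F x)) * mat (Y x)
        + mat (Y x) * (adj (F x) (fderiv ℝ F x u)
          + connCoeff (F x) * mat (fderiv ℝ F x u) * connCoeff (F x)) * mat (X x)) := by
  have hK := (contDiffAt_connCoeff hF hW).differentiableAt one_ne_zero
  have hX' := differentiableAt_mat hX
  have hY' := differentiableAt_mat hY
  have h1 := fderiv_mul_apply (differentiableAt_mul hX' hK) hY' u
  have h2 := fderiv_mul_apply (differentiableAt_mul hY' hK) hX' u
  rw [fderiv_mul_apply hX' hK, fderiv_connCoeff_apply hF hW, fderiv_mat_apply,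
    fderiv_mat_apply] at h1
  rw [fderiv_mul_apply hY' hK, fderiv_connCoeff_apply hF hW, fderiv_mat_apply,
    fderiv_mat_apply] at h2
  have h3 := DFunLike.congr_fun (fderiv_fun_add (differentiableAt_mul (differentiableAt_mul hX' hK) hY')
    (differentiableAt_mul (differentiableAt_mul hY' hK) hX')) u
  refine h3.trans ?_
  refine (congrArg₂ (· + ·) h1 h2).trans ?_
  simp only [mat_conn, Matrix.mul_add, Matrix.add_mul, Matrix.mul_assoc]
  abel

/-- The Levi-Civita connection of the quadric is torsion-free. -/
theorem cov_fderiv_comm (hF : ContDiffAt ℝ 2 F x) (u v : E) :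
    cov F (fun y => fderiv ℝ F y v) x u = cov F (fun y => fderiv ℝ F y u) x v := by
  have hd : DifferentiableAt ℝ (fderiv ℝ F) x :=
    (hF.fderiv_right (m := 1) le_rfl).differentiableAt one_ne_zero
  have h1 : ∀ w z, fderiv ℝ (fun y => fderiv ℝ F y w) x z = fderiv ℝ (fderiv ℝ F) x z w := by
    intro w z
    rw [fderiv_clm_apply hd (differentiableAt_const w)]
    simp
  rw [cov, cov, h1, h1, (hF.isSymmSndFDerivAt (by simp)).eq, conn_comm]

/-- The curvature tensor of the quadric, as the commutator of covariant derivatives along `F`. -/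
theorem cov_cov_sub (hF : ContDiffAt ℝ 2 F x) (hW : F x ∈ domain m) (hZ : ContDiffAt ℝ 2 Z x)
    (u v : E) :
    cov F (fun y => cov F Z y v) x u - cov F (fun y => cov F Z y u) x v
      = curv (F x) (fderiv ℝ F x u) (fderiv ℝ F x v) (Z x) := by
  have hF1 : ContDiffAt ℝ 1 F x := hF.of_le (by norm_num)
  have hdF : DifferentiableAt ℝ (fderiv ℝ F) x :=
    (hF.fderiv_right (m := 1) le_rfl).differentiableAt one_ne_zero
  have hdZ : DifferentiableAt ℝ (fderiv ℝ Z) x :=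
    (hZ.fderiv_right (m := 1) le_rfl).differentiableAt one_ne_zero
  have hZd : DifferentiableAt ℝ Z x := hZ.differentiableAt two_ne_zero
  have h1 : ∀ w z, fderiv ℝ (fun y => fderiv ℝ F y w) x z = fderiv ℝ (fderiv ℝ F) x z w := by
    intro w z
    rw [fderiv_clm_apply hdF (differentiableAt_const w)]
    simp
  have h2 : ∀ w z, fderiv ℝ (fun y => fderiv ℝ Z y w) x z = fderiv ℝ (fderiv ℝ Z) x z w := by
    intro w z
    rw [fderiv_clm_apply hdZ (differentiableAt_const w)]
    simp
  have key : ∀ w z, mat (cov F (fun y => cov F Z y w) x z) =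
      mat (fderiv ℝ (fderiv ℝ Z) x z w)
      + mat (conn (F x) (fderiv ℝ (fderiv ℝ F) x z w) (Z x))
      + (mat (conn (F x) (fderiv ℝ F x w) (fderiv ℝ Z x z))
        + mat (conn (F x) (fderiv ℝ F x z) (fderiv ℝ Z x w)))
      + (mat (fderiv ℝ F x w) * (adj (F x) (fderiv ℝ F x z)
          + connCoeff (F x) * mat (fderiv ℝ F x z) * connCoeff (F x)) * mat (Z x)
        + mat (Z x) * (adj (F x) (fderiv ℝ F x z)
          + connCoeff (F x) * mat (fderiv ℝ F x z) * connCoeff (F x)) * mat (fderiv ℝ F x w))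
      + mat (conn (F x) (fderiv ℝ F x z) (conn (F x) (fderiv ℝ F x w) (Z x))) := by
    intro w z
    have hFw : DifferentiableAt ℝ (fun y => fderiv ℝ F y w) x :=
      hdF.clm_apply (differentiableAt_const w)
    have hZw : DifferentiableAt ℝ (fun y => fderiv ℝ Z y w) x :=
      hdZ.clm_apply (differentiableAt_const w)
    have h3 : fderiv ℝ (fun y => cov F Z y w) x z = fderiv ℝ (fun y => fderiv ℝ Z y w) x z
        + fderiv ℝ (fun y => conn (F y) (fderiv ℝ F y w) (Z y)) x z :=
      DFunLike.congr_fun (fderiv_fun_add hZw (differentiableAt_conn hF1 hW hFw hZd)) z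
    have h4 := mat_fderiv_conn hF1 hW hFw hZd z
    rw [h1] at h4
    rw [cov, h3, h2, mat_add, mat_add, h4]
    simp only [cov, mat_conn, mat_add, Matrix.mul_add, Matrix.add_mul]
    abel
  apply mat_injective
  rw [mat_sub, key, key, (hF.isSymmSndFDerivAt (by simp)).eq u v,
    (hZ.isSymmSndFDerivAt (by simp)).eq u v]
  simp only [curv, mat_add, mat_sub, mat_triple, mat_conn, Matrix.mul_add, Matrix.add_mul,
    Matrix.mul_assoc]
  abel

/-- The Jordan triple product is parallel. -/
theorem cov_triple (hF : ContDiffAt ℝ 1 F x) (hW : F x ∈ domain m)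
    (hX : DifferentiableAt ℝ X x) (hY : DifferentiableAt ℝ Y x) (hZ : DifferentiableAt ℝ Z x)
    (u : E) :
    cov F (fun y => triple (F y) (X y) (Y y) (Z y)) x u =
      triple (F x) (cov F X x u) (Y x) (Z x) + triple (F x) (X x) (cov F Y x u) (Z x)
        + triple (F x) (X x) (Y x) (cov F Z x u) := by
  have hX' := differentiableAt_mat hX
  have hY' := differentiableAt_adj hF hW hY
  have hZ' := differentiableAt_mat hZ
  have h := fderiv_mul_apply (differentiableAt_mul hX' hY') hZ' u
  rw [fderiv_mul_apply hX' hY', fderiv_adj_apply hF hW hY, fderiv_mat_apply, fderiv_mat_apply] at h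
  apply mat_injective
  rw [mat_cov]
  refine (congrArg (· + _) h).trans ?_
  simp only [mat_add, mat_triple, mat_cov, Matrix.mul_add, Matrix.add_mul, Matrix.mul_assoc]
  abel

theorem fderiv_gram_det_apply (hF : ContDiffAt ℝ 1 F x) (hW : F x ∈ domain m) (u : E) :
    fderiv ℝ (fun y => (gram (F y)).det) x u = -2 * (gram (F x)).det *
      (connCoeff (F x) * mat (fderiv ℝ F x u)).trace := by
  have hG := (contDiffAt_gram hF).differentiableAt one_ne_zero
  have hG' : ∀ i j, HasFDerivAt (fun y => gram (F y) i j) _ x := fun i j =>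
    ((Matrix.entryLinearMap ℝ ℝ i j).toContinuousLinearMap).hasFDerivAt.comp x hG.hasFDerivAt
  have h1 := ((hG' 0 0).mul (hG' 1 1)).sub ((hG' 0 1).mul (hG' 1 0))
  have h2 : (fun y => (gram (F y)).det) = fun y =>
      gram (F y) 0 0 * gram (F y) 1 1 - gram (F y) 0 1 * gram (F y) 1 0 := by
    funext y; exact Matrix.det_fin_two _
  have h3 : (gram (F x)).det * (connCoeff (F x) * mat (fderiv ℝ F x u)).trace
      = ((gram (F x)).adjugate * ((mat (F x))ᵀ * mat (fderiv ℝ F x u))).trace := by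
    rw [connCoeff, Matrix.inv_def, Ring.inverse_eq_inv', Matrix.smul_mul, Matrix.smul_mul,
      Matrix.trace_smul, smul_eq_mul, mul_inv_cancel_left₀ (gram_det_pos hW).ne',
      Matrix.mul_assoc]
  have hsym : gram (F x) 1 0 = gram (F x) 0 1 :=
    congrFun (congrFun (gram_transpose (F x)) 0) 1
  have h4 : ∀ i j, (fderiv ℝ (fun y => gram (F y)) x u) i j =
      -(((mat (F x))ᵀ * mat (fderiv ℝ F x u)) i j
        + ((mat (F x))ᵀ * mat (fderiv ℝ F x u)) j i) := by
    intro i j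
    rw [fderiv_gram_apply hF u,
      show (mat (fderiv ℝ F x u))ᵀ * mat (F x) = ((mat (F x))ᵀ * mat (fderiv ℝ F x u))ᵀ by
      simp [Matrix.transpose_mul]]
    rfl
  have h5 : fderiv ℝ (fun y => (gram (F y)).det) x u =
      (gram (F x) 0 0 * (fderiv ℝ (fun y => gram (F y)) x u) 1 1 +
        gram (F x) 1 1 * (fderiv ℝ (fun y => gram (F y)) x u) 0 0) -
      (gram (F x) 0 1 * (fderiv ℝ (fun y => gram (F y)) x u) 1 0 +
        gram (F x) 1 0 * (fderiv ℝ (fun y => gram (F y)) x u) 0 1) := by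
    rw [h2]; exact DFunLike.congr_fun h1.fderiv u
  rw [mul_assoc, h3, h5, h4, h4, h4, h4, Matrix.adjugate_fin_two, Matrix.trace_fin_two]
  generalize (mat (F x))ᵀ * mat (fderiv ℝ F x u) = B
  simp only [Matrix.mul_apply, Fin.sum_univ_two, Matrix.of_apply, Matrix.cons_val',
    Matrix.cons_val_zero, Matrix.cons_val_one, Matrix.cons_val_fin_one, hsym]
  ring

theorem fderiv_jMat_apply (hF : ContDiffAt ℝ 1 F x) (hW : F x ∈ domain m) (u : E) :
    fderiv ℝ (fun y => jMat (F y)) x u =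
      connCoeff (F x) * mat (fderiv ℝ F x u) * jMat (F x)
        - jMat (F x) * (connCoeff (F x) * mat (fderiv ℝ F x u)) := by
  have hpos := gram_det_pos hW
  have hG := (contDiffAt_gram_inv hF hW).differentiableAt one_ne_zero
  have hdet := (contDiffAt_det (contDiffAt_gram hF)).differentiableAt one_ne_zero
  have h1 := fderiv_mul_apply hG (differentiableAt_const !![0, -1; 1, 0]) u
  rw [fderiv_inv_apply (contDiffAt_gram hF) hpos.ne', fderiv_gram_apply hF] at h1
  have h2 : fderiv ℝ (fun y => Real.sqrt (gram (F y)).det) x u = -(Real.sqrt (gram (F x)).det *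
      (connCoeff (F x) * mat (fderiv ℝ F x u)).trace) := by
    have h3 := (hdet.hasFDerivAt.sqrt hpos.ne').fderiv
    rw [h3, _root_.smul_apply, fderiv_gram_det_apply hF hW, smul_eq_mul]
    have h4 := Real.mul_self_sqrt hpos.le
    have h5 := (Real.sqrt_pos.2 hpos).ne'
    field_simp
    rw [sq, h4]
  have h6 : fderiv ℝ (fun y => jMat (F y)) x u = Real.sqrt (gram (F x)).det •
      fderiv ℝ (fun y => (gram (F y))⁻¹ * !![0, -1; 1, 0]) x u +
      fderiv ℝ (fun y => Real.sqrt (gram (F y)).det) x u • ((gram (F x))⁻¹ * !![0, -1; 1, 0]) :=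
    DFunLike.congr_fun (fderiv_fun_smul (hdet.sqrt hpos.ne')
      (differentiableAt_mul hG (differentiableAt_const !![0, -1; 1, 0]))) u
  rw [h6, h1, h2]
  set Θ := connCoeff (F x) * mat (fderiv ℝ F x u) with hΘ
  have h7 : (gram (F x))⁻¹ * (mat (fderiv ℝ F x u))ᵀ * mat (F x)
      = Θ.trace • 1 + jMat (F x) * Θ * jMat (F x) := by
    rw [← gram_adjoint hW, hΘ, Matrix.transpose_mul, connCoeff_transpose]
    simp only [Matrix.mul_assoc, gram_inv_mul hW, Matrix.mul_one]
  have h8 : (gram (F x))⁻¹ * ((mat (F x))ᵀ * mat (fderiv ℝ F x u)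
      + (mat (fderiv ℝ F x u))ᵀ * mat (F x)) = Θ + (Θ.trace • 1 + jMat (F x) * Θ * jMat (F x)) := by
    rw [← h7, hΘ, connCoeff]; simp only [Matrix.mul_add, Matrix.mul_assoc]
  have h9 : fderiv ℝ (fun _ : E => !![(0 : ℝ), -1; 1, 0]) x u = 0 := by
    rw [fderiv_fun_const]; rfl
  rw [h9, Matrix.mul_zero, zero_add, Matrix.mul_neg, h8]
  simp only [Matrix.neg_mul, neg_neg]
  rw [Matrix.mul_assoc, ← Matrix.mul_smul, neg_smul, mul_comm (Real.sqrt _), mul_smul]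
  rw [show Real.sqrt (gram (F x)).det • ((gram (F x))⁻¹ * !![0, -1; 1, 0]) = jMat (F x) from rfl]
  simp only [Matrix.add_mul, Matrix.mul_assoc, jMat_mul_self hW, Matrix.smul_mul, Matrix.mul_neg,
    Matrix.mul_one, Matrix.one_mul]
  abel

/-- The complex structure is parallel. -/
theorem cov_J (hF : ContDiffAt ℝ 1 F x) (hW : F x ∈ domain m)
    (hX : DifferentiableAt ℝ X x) (u : E) :
    cov F (fun y => J (F y) (X y)) x u = J (F x) (cov F X x u) := by
  have hX' := differentiableAt_mat hX
  have hj := (contDiffAt_jMat hF hW).differentiableAt one_ne_zero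
  have h := fderiv_mul_apply hX' hj u
  rw [fderiv_jMat_apply hF hW, fderiv_mat_apply] at h
  apply mat_injective
  rw [mat_cov]
  refine (congrArg (· + _) h).trans ?_
  simp only [mat_J, mat_cov, Matrix.add_mul, Matrix.mul_sub, Matrix.mul_assoc]
  abel

theorem cov_add (hX : DifferentiableAt ℝ X x) (hY : DifferentiableAt ℝ Y x) (u : E) :
    cov F (fun y => X y + Y y) x u = cov F X x u + cov F Y x u := by
  have h := DFunLike.congr_fun (fderiv_fun_add hX hY) u
  apply mat_injective
  simp only [mat_cov, mat_add, Matrix.mul_add, Matrix.add_mul, h, _root_.add_apply]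
  abel

theorem cov_neg (u : E) : cov F (fun y => -X y) x u = -cov F X x u := by
  have h : fderiv ℝ (fun y => -X y) x u = -fderiv ℝ X x u :=
    DFunLike.congr_fun (fderiv_fun_neg (𝕜 := ℝ)) u
  apply mat_injective
  rw [mat_neg, mat_cov, mat_cov, h]
  simp only [mat_neg, Matrix.mul_neg, Matrix.neg_mul]
  abel

theorem cov_sub (hX : DifferentiableAt ℝ X x) (hY : DifferentiableAt ℝ Y x) (u : E) :
    cov F (fun y => X y - Y y) x u = cov F X x u - cov F Y x u := by
  simp only [sub_eq_add_neg]
  rw [cov_add hX hY.fun_neg, cov_neg]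

theorem cov_smul {c : E → ℝ} (hc : DifferentiableAt ℝ c x) (hX : DifferentiableAt ℝ X x) (u : E) :
    cov F (fun y => c y • X y) x u = fderiv ℝ c x u • X x + c x • cov F X x u := by
  have h : fderiv ℝ (fun y => c y • X y) x u = c x • fderiv ℝ X x u + fderiv ℝ c x u • X x :=
    DFunLike.congr_fun (fderiv_fun_smul hc hX) u
  apply mat_injective
  simp only [mat_cov, mat_add, mat_smul, h, Matrix.mul_smul, Matrix.smul_mul, smul_add]
  abel

end Rules

end HypQuadric

end

/-! ### Levi-Civita connections in coordinates -/

/-- A family of continuous linear maps on a finite-dimensional space is `C^k` at a point if all its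
values are. -/
theorem contDiffAt_clm_of_apply {D E F : Type*} [NormedAddCommGroup D] [NormedSpace ℝ D]
    [NormedAddCommGroup E] [NormedSpace ℝ E] [NormedAddCommGroup F] [NormedSpace ℝ F]
    [FiniteDimensional ℝ E] {k : WithTop ℕ∞} {f : D → E →L[ℝ] F} {x : D}
    (h : ∀ y, ContDiffAt ℝ k (fun z => f z y) x) : ContDiffAt ℝ k f x := by
  let d := Module.finrank ℝ E
  have hd : d = Module.finrank ℝ (Fin d → ℝ) := (Module.finrank_fin_fun ℝ).symm
  let e₁ := ContinuousLinearEquiv.ofFinrankEq hd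
  let e₂ := (e₁.arrowCongr (1 : F ≃L[ℝ] F)).trans (ContinuousLinearEquiv.piRing (Fin d))
  rw [← Function.id_comp f, ← e₂.symm_comp_self]
  exact e₂.symm.contDiff.contDiffAt.comp x (contDiffAt_pi.mpr fun i => h _)

namespace Coord

variable {E : Type*} [NormedAddCommGroup E] [NormedSpace ℝ E]

theorem fderiv_clm_apply_apply {g : E → E →L[ℝ] E →L[ℝ] ℝ} {x : E} (hg : DifferentiableAt ℝ g x)
    (u v w : E) : fderiv ℝ g x u v w = fderiv ℝ (fun y => g y v w) x u := by
  have h1 := hg.clm_apply (differentiableAt_const v)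
  have h2 := fderiv_clm_apply h1 (differentiableAt_const w)
  have h3 := fderiv_clm_apply hg (differentiableAt_const v)
  rw [h2, h3]
  simp

variable [FiniteDimensional ℝ E]

theorem isInvertible_of_injective {A : E →L[ℝ] E →L[ℝ] ℝ} (hA : Function.Injective A) :
    A.IsInvertible := by
  have hd : Module.finrank ℝ E = Module.finrank ℝ (E →L[ℝ] ℝ) := by
    rw [← (LinearMap.toContinuousLinearMap : (E →ₗ[ℝ] ℝ) ≃ₗ[ℝ] _).finrank_eq,
      show Module.finrank ℝ (E →ₗ[ℝ] ℝ) = Module.finrank ℝ (Module.Dual ℝ E) from rfl,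
      Subspace.dual_finrank_eq]
  exact ⟨(LinearEquiv.ofInjectiveOfFinrankEq A.toLinearMap hA hd).toContinuousLinearEquiv,
    by ext; rfl⟩

theorem contDiffAt_inverse_apply {D : Type*} [NormedAddCommGroup D] [NormedSpace ℝ D]
    {k : WithTop ℕ∞} {g : D → E →L[ℝ] E →L[ℝ] ℝ} {φ : D → E →L[ℝ] ℝ} {x : D}
    (hg : ContDiffAt ℝ k g x) (hφ : ContDiffAt ℝ k φ x) (hx : Function.Injective (g x)) :
    ContDiffAt ℝ k (fun y => (g y).inverse (φ y)) x := by
  obtain ⟨e, he⟩ := isInvertible_of_injective hx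
  have h1 : ContDiffAt ℝ k ContinuousLinearMap.inverse (g x) := by
    rw [← he]; exact contDiffAt_map_inverse e
  exact (h1.comp x hg).clm_apply hφ

/-- The fundamental lemma of Riemannian geometry: `christoffel g` is the only symmetric bilinear map
that is compatible with `g`. -/
theorem christoffel_eq {g : E → E →L[ℝ] E →L[ℝ] ℝ} {x : E} (hx : Function.Injective (g x))
    (hsymm : ∀ u v, g x u v = g x v u) (B : E → E → E) (hB : ∀ u v, B u v = B v u)
    (hg : ∀ u v w, fderiv ℝ g x u v w = g x (B u v) w + g x v (B u w)) (u v : E) :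
    christoffel g x u v = B u v := by
  have hinv := isInvertible_of_injective hx
  rw [christoffel, hinv.inverse_apply_eq]
  ext w
  have h : koszul g x u v w = (1 / 2 : ℝ) * (fderiv ℝ g x u v w + fderiv ℝ g x v u w
      - fderiv ℝ g x w u v) := rfl
  rw [h, hg, hg, hg, hsymm v (B u w), hsymm u (B v w), hsymm u (B w v), hB w u, hB w v, hB v u]
  ring

end Coord

namespace HypQuadric

variable {m : ℕ}

theorem contDiffAt_metric_clm {E : Type*} [NormedAddCommGroup E] [NormedSpace ℝ E] {F : E → Vec m}
    {x : E} {k : WithTop ℕ∞} (hF : ContDiffAt ℝ k F x) (hW : F x ∈ domain m) :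
    ContDiffAt ℝ k (fun y => metric (F y)) x :=
  contDiffAt_clm_of_apply fun _ => contDiffAt_clm_of_apply fun _ =>
    contDiffAt_metric hF hW contDiffAt_const contDiffAt_const

theorem christoffel_metric {W : Vec m} (hW : W ∈ domain m) (X Y : Vec m) :
    Coord.christoffel metric W X Y = conn W X Y := by
  refine Coord.christoffel_eq (metric_injective hW) (metric_comm W) _ (conn_comm W) ?_ X Y
  intro u v w
  have hid : ContDiffAt ℝ 1 (fun y : Vec m => y) W := contDiffAt_id
  rw [Coord.fderiv_clm_apply_apply
    ((contDiffAt_metric_clm hid hW).differentiableAt one_ne_zero)]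
  rw [fderiv_metric_apply hid hW (differentiableAt_const v) (differentiableAt_const w)]
  simp [cov]

end HypQuadric

/-! ### Hypersurfaces of the quadric in coordinates -/

namespace HypQuadric

variable {m : ℕ} {E : Type*} [NormedAddCommGroup E] [NormedSpace ℝ E]

/-- `F` restricts to an immersion of the open set `U` as a hypersurface, with the smooth unit normal
vector field `N`. -/
structure IsHypersurfaceOn (F N : E → Vec m) (U : Set E) : Prop where
  isOpen : IsOpen U
  finrank_eq : Module.finrank ℝ E + 1 = 2 * m
  mem_domain : ∀ x ∈ U, F x ∈ domain m
  smooth : ContDiffOn ℝ ∞ F U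
  injective : ∀ x ∈ U, Function.Injective (fderiv ℝ F x)
  normal : IsUnitNormalField F U N

/-- The second fundamental form `s(u, v) = g(S u, v)`, for `S u = -D_u N`. -/
def sff (F N : E → Vec m) (x u v : E) : ℝ :=
  -metric (F x) (cov F N x u) (fderiv ℝ F x v)

theorem inducedMetric_apply (F : E → Vec m) (x u v : E) :
    inducedMetric F x u v = metric (F x) (fderiv ℝ F x u) (fderiv ℝ F x v) := rfl

theorem inducedMetric_injective {F : E → Vec m} {x : E} (hW : F x ∈ domain m)
    (hT : Function.Injective (fderiv ℝ F x)) : Function.Injective (inducedMetric F x) := by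
  rw [injective_iff_map_eq_zero]
  intro u hu
  have h1 : inducedMetric F x u u = 0 := by rw [hu]; rfl
  rw [inducedMetric_apply, metric_self_eq_zero hW] at h1
  exact (injective_iff_map_eq_zero _).1 hT u h1

theorem contDiffAt_inducedMetric [FiniteDimensional ℝ E] {F : E → Vec m} {x : E}
    (hF : ContDiffAt ℝ ∞ F x) (hW : F x ∈ domain m) : ContDiffAt ℝ ∞ (inducedMetric F) x := by
  have hT : ContDiffAt ℝ ∞ (fderiv ℝ F) x := hF.fderiv_right (by simp)
  exact contDiffAt_clm_of_apply fun _ => contDiffAt_clm_of_apply fun _ =>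
    contDiffAt_metric hF hW (hT.clm_apply contDiffAt_const) (hT.clm_apply contDiffAt_const)

theorem finrank_vec : Module.finrank ℝ (Vec m) = 2 * m := by
  simp [Vec, Module.finrank_pi_fintype, mul_comm]

namespace IsHypersurfaceOn

variable {F N : E → Vec m} {U : Set E} (h : IsHypersurfaceOn F N U) {x : E} (hx : x ∈ U)
include h hx

theorem mem_nhds : U ∈ nhds x := h.isOpen.mem_nhds hx

theorem contDiffAt : ContDiffAt ℝ ∞ F x := h.smooth.contDiffAt (h.mem_nhds hx)

theorem contDiffAt_nat (k : ℕ) : ContDiffAt ℝ k F x := (h.contDiffAt hx).of_le (by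
  exact_mod_cast le_top)

theorem contDiffAt_one : ContDiffAt ℝ 1 F x := h.contDiffAt_nat hx 1

theorem contDiffAt_normal : ContDiffAt ℝ ∞ N x := h.normal.1.contDiffAt (h.mem_nhds hx)

theorem contDiffAt_fderiv : ContDiffAt ℝ ∞ (fderiv ℝ F) x :=
  (h.contDiffAt hx).fderiv_right (by simp)

theorem metric_normal : metric (F x) (N x) (N x) = 1 := (h.normal.2 x hx).1

theorem metric_normal_tangent (u : E) : metric (F x) (N x) (fderiv ℝ F x u) = 0 :=
  (h.normal.2 x hx).2 u

theorem metric_tangent_normal (u : E) : metric (F x) (fderiv ℝ F x u) (N x) = 0 := by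
  rw [metric_comm, h.metric_normal_tangent hx]

theorem exists_fderiv_eq {Z : Vec m} (hZ : metric (F x) (N x) Z = 0) :
    ∃ z, fderiv ℝ F x z = Z := by
  have hle : LinearMap.range (fderiv ℝ F x).toLinearMap
      ≤ LinearMap.ker (metric (F x) (N x)).toLinearMap := by
    rintro _ ⟨u, rfl⟩
    exact h.metric_normal_tangent hx u
  have h1 : Module.finrank ℝ (LinearMap.range (fderiv ℝ F x).toLinearMap) = Module.finrank ℝ E :=
    LinearMap.finrank_range_of_inj (h.injective x hx)
  have h2 := LinearMap.finrank_range_add_finrank_ker (metric (F x) (N x)).toLinearMap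
  have h3 : LinearMap.range (metric (F x) (N x)).toLinearMap = ⊤ := by
    rw [LinearMap.range_eq_top]
    intro c
    exact ⟨c • N x, by simp [h.metric_normal hx]⟩
  rw [h3, finrank_top, Module.finrank_self, finrank_vec] at h2
  have h5 := Submodule.eq_of_le_of_finrank_eq hle (by have := h.finrank_eq; omega)
  have h6 : Z ∈ LinearMap.range (fderiv ℝ F x).toLinearMap := by
    rw [h5]; exact hZ
  exact h6

theorem fderiv_pullTangent {Z : Vec m} (hZ : metric (F x) (N x) Z = 0) :
    fderiv ℝ F x (pullTangent F x Z) = Z :=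
  Function.invFun_eq (h.exists_fderiv_eq hx hZ)

theorem inducedMetric_injective : Function.Injective (inducedMetric F x) :=
  HypQuadric.inducedMetric_injective (h.mem_domain x hx) (h.injective x hx)

theorem metric_cov_normal_normal (u : E) : metric (F x) (N x) (cov F N x u) = 0 := by
  have hN := (h.contDiffAt_normal hx).differentiableAt (by simp)
  have h1 := fderiv_metric_apply (h.contDiffAt_one hx) (h.mem_domain x hx) hN hN u
  have h2 : (fun y => metric (F y) (N y) (N y)) =ᶠ[nhds x] fun _ => (1 : ℝ) := by
    filter_upwards [h.mem_nhds hx] with y hy using h.metric_normal hy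
  rw [h2.fderiv_eq, metric_comm (F x) (cov F N x u)] at h1
  simp at h1
  linarith

theorem differentiableAt_fderiv_apply (v : E) :
    DifferentiableAt ℝ (fun y => fderiv ℝ F y v) x :=
  ((h.contDiffAt_fderiv hx).differentiableAt (by simp)).clm_apply (differentiableAt_const v)

theorem metric_normal_cov_fderiv (u v : E) :
    metric (F x) (N x) (cov F (fun y => fderiv ℝ F y v) x u) = sff F N x u v := by
  have hN := (h.contDiffAt_normal hx).differentiableAt (by simp)
  have h1 := fderiv_metric_apply (h.contDiffAt_one hx) (h.mem_domain x hx) hN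
    (h.differentiableAt_fderiv_apply hx v) u
  have h2 : (fun y => metric (F y) (N y) (fderiv ℝ F y v)) =ᶠ[nhds x] fun _ => (0 : ℝ) := by
    filter_upwards [h.mem_nhds hx] with y hy using h.metric_normal_tangent hy v
  rw [h2.fderiv_eq] at h1
  simp at h1
  rw [sff]; linarith

theorem cov_fderiv_symm (u v : E) :
    cov F (fun y => fderiv ℝ F y v) x u = cov F (fun y => fderiv ℝ F y u) x v :=
  cov_fderiv_comm (h.contDiffAt_nat hx 2) u v

theorem sff_symm (u v : E) : sff F N x u v = sff F N x v u := by
  rw [← h.metric_normal_cov_fderiv hx, ← h.metric_normal_cov_fderiv hx, h.cov_fderiv_symm hx]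

theorem contDiffAt_cov {Z : E → Vec m} (hZ : ContDiffAt ℝ ∞ Z x) {v : E → E}
    (hv : ContDiffAt ℝ ∞ v x) : ContDiffAt ℝ ∞ (fun y => cov F Z y (v y)) x :=
  ((hZ.fderiv_right (m := ∞) (by simp)).clm_apply hv).add
    (contDiffAt_conn (h.contDiffAt hx) (h.mem_domain x hx)
      ((h.contDiffAt_fderiv hx).clm_apply hv) hZ)

theorem contDiffAt_sff {u v : E → E} (hu : ContDiffAt ℝ ∞ u x) (hv : ContDiffAt ℝ ∞ v x) :
    ContDiffAt ℝ ∞ (fun y => sff F N y (u y) (v y)) x :=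
  (contDiffAt_metric (h.contDiffAt hx) (h.mem_domain x hx)
    (h.contDiffAt_cov hx (h.contDiffAt_normal hx) hu)
    ((h.contDiffAt_fderiv hx).clm_apply hv)).neg

/-- The curvature of the quadric, applied to the normal vector field. -/
theorem cov_cov_normal_sub (u v : E) :
    cov F (fun y => cov F N y v) x u - cov F (fun y => cov F N y u) x v
      = curv (F x) (fderiv ℝ F x u) (fderiv ℝ F x v) (N x) :=
  cov_cov_sub (h.contDiffAt_nat hx 2) (h.mem_domain x hx)
    (contDiffAt_infty.1 (h.contDiffAt_normal hx) 2) u v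

variable [FiniteDimensional ℝ E]

theorem contDiffAt_inducedMetric : ContDiffAt ℝ ∞ (inducedMetric F) x :=
  HypQuadric.contDiffAt_inducedMetric (h.contDiffAt hx) (h.mem_domain x hx)

/-- A smooth tangent vector field along `F` is the image of a smooth vector field on `U`. -/
theorem contDiffAt_pullTangent {Z : E → Vec m} (hZ : ContDiffAt ℝ ∞ Z x)
    (hZN : ∀ y ∈ U, metric (F y) (N y) (Z y) = 0) :
    ContDiffAt ℝ ∞ (fun y => pullTangent F y (Z y)) x := by
  have h1 : ContDiffAt ℝ ∞ (fun y => (metric (F y) (Z y)).comp (fderiv ℝ F y)) x :=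
    ((contDiffAt_metric_clm (h.contDiffAt hx) (h.mem_domain x hx)).clm_apply hZ).clm_comp
      (h.contDiffAt_fderiv hx)
  refine (Coord.contDiffAt_inverse_apply (h.contDiffAt_inducedMetric hx) h1
    (h.inducedMetric_injective hx)).congr_of_eventuallyEq ?_
  filter_upwards [h.mem_nhds hx] with y hy
  symm
  rw [(Coord.isInvertible_of_injective (h.inducedMetric_injective hy)).inverse_apply_eq]
  ext w
  rw [inducedMetric_apply, h.fderiv_pullTangent hy (hZN y hy)]
  rfl

/-- The Levi-Civita connection of the induced metric, on constant vector fields, is the tangential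
part of that of the quadric. -/
theorem fderiv_christoffel (u v : E) :
    fderiv ℝ F x (Coord.christoffel (inducedMetric F) x u v) =
      cov F (fun y => fderiv ℝ F y v) x u - sff F N x u v • N x := by
  have htan : ∀ u v, metric (F x) (N x)
      (cov F (fun y => fderiv ℝ F y v) x u - sff F N x u v • N x) = 0 := by
    intro u v
    rw [map_sub, map_smul, h.metric_normal_cov_fderiv hx, h.metric_normal hx]; simp
  rw [Coord.christoffel_eq (h.inducedMetric_injective hx)
    (fun u v => metric_comm _ _ _)
    (fun u v => pullTangent F x (cov F (fun y => fderiv ℝ F y v) x u - sff F N x u v • N x))]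
  · exact h.fderiv_pullTangent hx (htan u v)
  · intro u v
    rw [h.cov_fderiv_symm hx, h.sff_symm hx]
  · intro u v w
    rw [Coord.fderiv_clm_apply_apply
      ((h.contDiffAt_inducedMetric hx).differentiableAt (by simp))]
    simp only [inducedMetric_apply]
    rw [h.fderiv_pullTangent hx (htan u v), h.fderiv_pullTangent hx (htan u w)]
    rw [fderiv_metric_apply (h.contDiffAt_one hx) (h.mem_domain x hx)
      (h.differentiableAt_fderiv_apply hx v) (h.differentiableAt_fderiv_apply hx w)]
    simp [h.metric_normal_tangent hx, h.metric_tangent_normal hx]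

/-- The Gauss formula. -/
theorem cov_fderiv_apply {Y : E → E} (hY : DifferentiableAt ℝ Y x) (u : E) :
    cov F (fun y => fderiv ℝ F y (Y y)) x u =
      fderiv ℝ F x (Coord.covDeriv (inducedMetric F) Y x u) + sff F N x u (Y x) • N x := by
  have hd := (h.contDiffAt_fderiv hx).differentiableAt (by simp)
  have h1 : fderiv ℝ (fun y => fderiv ℝ F y (Y y)) x u =
      fderiv ℝ F x (fderiv ℝ Y x u) + fderiv ℝ (fun y => fderiv ℝ F y (Y x)) x u := by
    rw [fderiv_clm_apply hd hY, fderiv_clm_apply hd (differentiableAt_const (Y x))]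
    simp
  rw [Coord.covDeriv, map_add, h.fderiv_christoffel hx, cov, h1, cov]
  abel

/-- The induced connection is metric. -/
theorem fderiv_inducedMetric_apply {Y Z : E → E} (hY : DifferentiableAt ℝ Y x)
    (hZ : DifferentiableAt ℝ Z x) (u : E) :
    fderiv ℝ (fun y => inducedMetric F y (Y y) (Z y)) x u =
      inducedMetric F x (Coord.covDeriv (inducedMetric F) Y x u) (Z x) +
      inducedMetric F x (Y x) (Coord.covDeriv (inducedMetric F) Z x u) := by
  have hd := (h.contDiffAt_fderiv hx).differentiableAt (by simp)
  simp only [inducedMetric_apply]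
  rw [fderiv_metric_apply (h.contDiffAt_one hx) (h.mem_domain x hx)
      (hd.clm_apply hY) (hd.clm_apply hZ), h.cov_fderiv_apply hx hY, h.cov_fderiv_apply hx hZ]
  simp [h.metric_normal_tangent hx, h.metric_tangent_normal hx]

theorem contDiffAt_christoffel (u v : E) :
    ContDiffAt ℝ ∞ (fun y => Coord.christoffel (inducedMetric F) y u v) x := by
  refine Coord.contDiffAt_inverse_apply (h.contDiffAt_inducedMetric hx) ?_
    (h.inducedMetric_injective hx)
  refine contDiffAt_clm_of_apply fun w => ?_
  have : ∀ a b c : E, ContDiffAt ℝ ∞ (fun y => fderiv ℝ (inducedMetric F) y a b c) x := by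
    intro a b c
    have h1 : ContDiffAt ℝ ∞ (fun y => inducedMetric F y b c) x :=
      ((h.contDiffAt_inducedMetric hx).clm_apply contDiffAt_const).clm_apply contDiffAt_const
    refine ((h1.fderiv_right (m := ∞) (by simp)).clm_apply
      (contDiffAt_const (c := a))).congr_of_eventuallyEq ?_
    filter_upwards [h.mem_nhds hx] with y hy
    exact Coord.fderiv_clm_apply_apply
      ((h.contDiffAt_inducedMetric hy).differentiableAt (by simp)) a b c
  exact contDiffAt_const.mul (((this u v w).add (this v u w)).sub (this w u v))

/-- The Gauss equation. -/
theorem inducedMetric_curvature (u v w z : E) :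
    inducedMetric F x (Coord.curvature (inducedMetric F) x u v w) z =
      metric (F x) (curv (F x) (fderiv ℝ F x u) (fderiv ℝ F x v) (fderiv ℝ F x w))
        (fderiv ℝ F x z) + sff F N x v w * sff F N x u z - sff F N x u w * sff F N x v z := by
  have hN := (h.contDiffAt_normal hx).differentiableAt (by simp)
  have key : ∀ u v, fderiv ℝ F x (Coord.covDeriv (inducedMetric F)
      (fun y => Coord.christoffel (inducedMetric F) y v w) x u)
      + sff F N x u (Coord.christoffel (inducedMetric F) x v w) • N x
      + (fderiv ℝ (fun y => sff F N y v w) x u • N x + sff F N x v w • cov F N x u) =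
      cov F (fun y => cov F (fun y => fderiv ℝ F y w) y v) x u := by
    intro u v
    have hs := (h.contDiffAt_sff hx (u := fun _ => v) (v := fun _ => w) contDiffAt_const
      contDiffAt_const).differentiableAt (by simp)
    have hc := (h.contDiffAt_christoffel hx v w).differentiableAt (by simp)
    rw [← h.cov_fderiv_apply hx hc, ← cov_smul hs hN, ← cov_add]
    · have hev : (fun y => cov F (fun y => fderiv ℝ F y w) y v) =ᶠ[nhds x] fun y =>
          fderiv ℝ F y (Coord.christoffel (inducedMetric F) y v w) + sff F N y v w • N y := by
        filter_upwards [h.mem_nhds hx] with y hy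
        rw [h.fderiv_christoffel hy]; abel
      rw [cov, cov, hev.fderiv_eq, hev.eq_of_nhds]
    · exact ((h.contDiffAt_fderiv hx).differentiableAt (by simp)).clm_apply hc
    · exact hs.smul hN
  have hR := cov_cov_sub (h.contDiffAt_nat hx 2) (h.mem_domain x hx)
    (Z := fun y => fderiv ℝ F y w)
    (contDiffAt_infty.1 ((h.contDiffAt_fderiv hx).clm_apply contDiffAt_const) 2) u v
  rw [← key u v, ← key v u] at hR
  have hR' := congrArg (fun X => metric (F x) X (fderiv ℝ F x z)) hR
  simp only [map_add, map_sub, map_smul, _root_.add_apply, _root_.sub_apply,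
    _root_.smul_apply, h.metric_normal_tangent hx, smul_eq_mul, mul_zero, add_zero, zero_add]
    at hR'
  rw [Coord.curvature, map_sub, _root_.sub_apply, inducedMetric_apply, inducedMetric_apply, ← hR']
  simp only [sff]
  ring

end IsHypersurfaceOn

end HypQuadric

/-! ### The normal vector, its cube and its defect from being singular -/

namespace HypQuadric

variable {m : ℕ}

theorem adj_triple (W X Y Z : Vec m) :
    adj W (triple W X Y Z) = adj W Z * mat Y * adj W X := by
  rw [adj, mat_triple, Matrix.transpose_mul, Matrix.transpose_mul, adj_transpose, adj, adj]
  simp only [Matrix.mul_assoc]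

theorem metric_smul_left (W : Vec m) (c : ℝ) (X Y : Vec m) :
    metric W (c • X) Y = c * metric W X Y := by
  rw [map_smul]; rfl

theorem metric_sub_left (W X Y Z : Vec m) :
    metric W (X - Y) Z = metric W X Z - metric W Y Z := by
  rw [map_sub]; rfl

theorem metric_neg_left (W X Y : Vec m) : metric W (-X) Y = -metric W X Y := by
  rw [map_neg]; rfl

theorem metric_J_self {W : Vec m} (hW : W ∈ domain m) (X : Vec m) : metric W (J W X) X = 0 := by
  have h := metric_J_left hW X X
  rw [metric_comm W X] at h
  linarith

theorem J_sub (W X Y : Vec m) : J W (X - Y) = J W X - J W Y := by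
  apply mat_injective; simp only [mat_sub, mat_J, Matrix.sub_mul]

theorem J_smul (W : Vec m) (c : ℝ) (X : Vec m) : J W (c • X) = c • J W X := by
  apply mat_injective; simp only [mat_smul, mat_J, Matrix.smul_mul]

theorem J_neg (W X : Vec m) : J W (-X) = -J W X := by
  apply mat_injective; simp only [mat_neg, mat_J, Matrix.neg_mul]

/-- The cube `n n^* n` of a vector for the Jordan triple product. -/
def cube (W n : Vec m) : Vec m := triple W n n n

/-- The number `g(n n^* n, n) = tr ((n^* n)²)`.  For a unit vector
`n = cos t Z₁ + sin t J Z₂`, with `Z₁, Z₂` orthonormal in `V(A)`, it is `(1 + cos² 2t) / 2`. -/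
def quart (W n : Vec m) : ℝ := metric W (cube W n) n

/-- The component of `n n^* n` orthogonal to `n`; it vanishes if and only if the unit vector `n` is
singular. -/
def defect (W n : Vec m) : Vec m := cube W n - quart W n • n

theorem cube_eq (W n : Vec m) : cube W n = defect W n + quart W n • n := by
  rw [defect]; abel

/-- The endomorphism `n^* n` of the plane `P`. -/
def sq (W n : Vec m) : Matrix (Fin 2) (Fin 2) ℝ := adj W n * mat n

theorem trace_sq {W n : Vec m} (hn : metric W n n = 1) : (sq W n).trace = 1 := hn

theorem quart_eq (W n : Vec m) : quart W n = (sq W n * sq W n).trace := by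
  rw [quart, metric_apply, cube, adj_triple, sq]
  simp only [Matrix.mul_assoc]

theorem sq_adjoint {W : Vec m} (hW : W ∈ domain m) (n : Vec m) :
    (gram W)⁻¹ * (sq W n)ᵀ * gram W = sq W n := by
  rw [sq, Matrix.transpose_mul, adj_transpose, adj]
  simp only [Matrix.mul_assoc, gram_inv_mul hW, Matrix.mul_one]

/-- The symmetric endomorphism `n^* n - 1/2`, having trace zero, anticommutes with `j`. -/
theorem jMat_mul_sq {W : Vec m} (hW : W ∈ domain m) {n : Vec m} (hn : metric W n n = 1) :
    jMat W * sq W n = jMat W - sq W n * jMat W := by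
  have h := gram_adjoint hW (sq W n)
  rw [sq_adjoint hW, trace_sq hn, one_smul] at h
  have h2 := congrArg (· * jMat W) h
  simp only [Matrix.add_mul, Matrix.one_mul, Matrix.mul_assoc, jMat_mul_self hW, Matrix.mul_neg,
    Matrix.mul_one] at h2
  rw [h2]; abel

/-- The Cayley-Hamilton theorem for `n^* n`. -/
theorem sq_mul_sq {W n : Vec m} (hn : metric W n n = 1) :
    sq W n * sq W n = sq W n - ((1 - quart W n) / 2) • (1 : Matrix (Fin 2) (Fin 2) ℝ) := by
  have h1 : ∀ B : Matrix (Fin 2) (Fin 2) ℝ, B * B = B.trace • B - B.det • 1 := by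
    intro B
    ext i j
    fin_cases i <;> fin_cases j <;>
      simp [Matrix.mul_apply, Fin.sum_univ_two, Matrix.trace_fin_two, Matrix.det_fin_two] <;> ring
  have h2 := h1 (sq W n)
  rw [trace_sq hn, one_smul] at h2
  have h3 := quart_eq W n
  rw [h2, Matrix.trace_sub, trace_sq hn, Matrix.trace_smul, Matrix.trace_one] at h3
  rw [h2, h3]
  congr 2
  simp

theorem metric_defect_self {W n : Vec m} (hn : metric W n n = 1) :
    metric W (defect W n) n = 0 := by
  rw [defect, metric_sub_left, metric_smul_left, hn, quart]; ring

theorem metric_self_defect {W n : Vec m} (hn : metric W n n = 1) :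
    metric W n (defect W n) = 0 := by
  rw [metric_comm, metric_defect_self hn]

theorem metric_cube_defect {W n : Vec m} (hn : metric W n n = 1) :
    metric W (cube W n) (defect W n) = metric W (defect W n) (defect W n) := by
  rw [cube_eq, map_add, _root_.add_apply, metric_smul_left, metric_self_defect hn]; ring

theorem metric_defect_J {W : Vec m} (hW : W ∈ domain m) {n : Vec m} (hn : metric W n n = 1) :
    metric W (defect W n) (J W n) = 0 := by
  have h1 : metric W (cube W n) (J W n) = (sq W n * sq W n * jMat W).trace := by
    rw [metric_apply, cube, adj_triple, mat_J, sq]; simp only [Matrix.mul_assoc]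
  have h2 : (sq W n * jMat W).trace = 0 := by
    have h := congrArg Matrix.trace (jMat_mul_sq hW hn)
    rw [Matrix.trace_sub, Matrix.trace_mul_comm, jMat_trace] at h
    linarith
  rw [defect, metric_sub_left, metric_smul_left, h1, sq_mul_sq hn, Matrix.sub_mul,
    Matrix.trace_sub, h2, metric_comm, metric_J_self hW, Matrix.smul_mul, Matrix.trace_smul,
    Matrix.one_mul, jMat_trace]
  simp

theorem metric_defect_defect {W n : Vec m} (hn : metric W n n = 1) :
    metric W (defect W n) (defect W n) = (2 * quart W n - 1) * (1 - quart W n) / 2 := by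
  have h1 : metric W (cube W n) (cube W n) = (sq W n * sq W n * sq W n).trace := by
    rw [metric_apply, cube, adj_triple, mat_triple, sq]; simp only [Matrix.mul_assoc]
  have h2 := quart_eq W n
  have h3 : (sq W n * sq W n * sq W n).trace = quart W n - (1 - quart W n) / 2 := by
    nth_rewrite 1 [sq_mul_sq hn]
    rw [Matrix.sub_mul, Matrix.trace_sub, ← h2, Matrix.smul_mul, Matrix.one_mul,
      Matrix.trace_smul, trace_sq hn, smul_eq_mul, mul_one]
  rw [← metric_cube_defect hn, defect, map_sub, map_smul, h1, h3, ← quart, smul_eq_mul]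
  ring

section Curvature

variable {W n : Vec m} (hW : W ∈ domain m) (hn : metric W n n = 1)
include hW hn

theorem jMat_mul_sq_mul (B : Matrix (Fin 2) (Fin 2) ℝ) :
    jMat W * (sq W n * B) = jMat W * B - sq W n * (jMat W * B) := by
  rw [← Matrix.mul_assoc, jMat_mul_sq hW hn, Matrix.sub_mul, Matrix.mul_assoc]

omit hW in
theorem sq_mul_sq_mul (B : Matrix (Fin 2) (Fin 2) ℝ) :
    sq W n * (sq W n * B) = sq W n * B - ((1 - quart W n) / 2) • B := by
  rw [← Matrix.mul_assoc, sq_mul_sq hn, Matrix.sub_mul, Matrix.smul_mul, Matrix.one_mul]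

omit hW hn in
theorem adj_mul_mul (B : Matrix (Fin 2) (Fin 2) ℝ) : adj W n * (mat n * B) = sq W n * B := by
  rw [← Matrix.mul_assoc]; rfl

theorem curv_defect_J :
    curv W (defect W n) (-J W n) (-J W n) = (2 * quart W n - 1) • (n - cube W n) := by
  have e1 : adj W n * mat n = sq W n := rfl
  apply mat_injective
  simp only [curv, cube, defect, mat_add, mat_sub, mat_neg, mat_smul, mat_triple, mat_J,
    adj_sub, adj_neg, adj_smul, adj_J hW, adj_triple]
  simp only [Matrix.mul_sub, Matrix.sub_mul, Matrix.mul_neg, Matrix.neg_mul, Matrix.smul_mul,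
    Matrix.mul_smul, Matrix.mul_assoc, e1, adj_mul_mul]
  simp only [← Matrix.mul_smul, ← Matrix.mul_sub, ← Matrix.mul_add, ← Matrix.mul_neg]
  rw [← Matrix.mul_one (mat n)]
  simp only [Matrix.mul_assoc, Matrix.one_mul]
  simp only [← Matrix.mul_smul, ← Matrix.mul_sub]
  congr 1
  simp only [Matrix.mul_sub, Matrix.mul_neg, Matrix.mul_smul, Matrix.mul_one,
    jMat_mul_sq_mul hW hn, jMat_mul_self hW, jMat_mul_sq hW hn,
    sq_mul_sq hn, sq_mul_sq_mul hn]
  module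

theorem curv_J_defect_J : curv W (J W (defect W n)) (-J W n) (-J W n) = 0 := by
  have e1 : adj W n * mat n = sq W n := rfl
  apply mat_injective
  simp only [curv, cube, defect, mat_add, mat_sub, mat_neg, mat_smul, mat_triple, mat_J,
    adj_sub, adj_neg, adj_smul, adj_J hW, adj_triple]
  simp only [Matrix.mul_sub, Matrix.sub_mul, Matrix.mul_neg, Matrix.neg_mul, Matrix.smul_mul,
    Matrix.mul_smul, Matrix.mul_assoc, e1, adj_mul_mul]
  simp only [← Matrix.mul_smul, ← Matrix.mul_sub, ← Matrix.mul_add, ← Matrix.mul_neg]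
  rw [← Matrix.mul_one (mat n)]
  simp only [Matrix.mul_assoc, Matrix.one_mul]
  refine (congrArg (mat n * ·) ?_).trans (Matrix.mul_zero _)
  simp only [Matrix.mul_sub, Matrix.mul_neg, Matrix.mul_smul, Matrix.mul_one,
    jMat_mul_sq_mul hW hn, jMat_mul_self hW, jMat_mul_sq hW hn,
    sq_mul_sq_mul hn]
  module

theorem curv_normal_defect :
    curv W (-J W n) (defect W n) n = -((2 * quart W n - 1) • J W (n - cube W n)) := by
  have e1 : adj W n * mat n = sq W n := rfl
  apply mat_injective
  simp only [curv, cube, defect, mat_add, mat_sub, mat_neg, mat_smul, mat_triple, mat_J,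
    adj_sub, adj_neg, adj_smul, adj_J hW, adj_triple]
  simp only [Matrix.mul_sub, Matrix.sub_mul, Matrix.mul_neg, Matrix.neg_mul, Matrix.smul_mul,
    Matrix.mul_smul, Matrix.mul_assoc, e1, adj_mul_mul]
  simp only [← Matrix.mul_smul, ← Matrix.mul_sub, ← Matrix.mul_add, ← Matrix.mul_neg]
  rw [← Matrix.mul_one (mat n)]
  simp only [Matrix.mul_assoc, Matrix.one_mul]
  congr 1
  simp only [Matrix.mul_sub, Matrix.mul_neg, Matrix.mul_smul, Matrix.mul_one,
    jMat_mul_sq hW hn,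
    sq_mul_sq hn, sq_mul_sq_mul hn]
  module

theorem curv_normal_J_defect : curv W (-J W n) (J W (defect W n)) n = 0 := by
  have e1 : adj W n * mat n = sq W n := rfl
  apply mat_injective
  simp only [curv, cube, defect, mat_add, mat_sub, mat_neg, mat_smul, mat_triple, mat_J,
    adj_sub, adj_neg, adj_smul, adj_J hW, adj_triple]
  simp only [Matrix.mul_sub, Matrix.sub_mul, Matrix.mul_neg, Matrix.neg_mul, Matrix.smul_mul,
    Matrix.mul_smul, Matrix.mul_assoc, e1, adj_mul_mul]
  simp only [← Matrix.mul_smul, ← Matrix.mul_sub, ← Matrix.mul_add, ← Matrix.mul_neg]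
  rw [← Matrix.mul_one (mat n)]
  simp only [Matrix.mul_assoc, Matrix.one_mul]
  refine (congrArg (mat n * ·) ?_).trans (Matrix.mul_zero _)
  simp only [Matrix.mul_sub, Matrix.mul_neg, Matrix.mul_smul, Matrix.mul_one,
    jMat_mul_sq_mul hW hn, jMat_mul_self hW, jMat_mul_sq hW hn,
    sq_mul_sq hn, sq_mul_sq_mul hn]
  module

end Curvature

end HypQuadric

/-! ### Covariant derivatives of bilinear forms -/

namespace Coord

variable {E : Type*} [NormedAddCommGroup E] [NormedSpace ℝ E]

/-- The covariant derivative `(∇_u B)(y, z)` of a field of bilinear forms. -/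
def covDerivForm (g B : E → E →L[ℝ] E →L[ℝ] ℝ) (x u y z : E) : ℝ :=
  fderiv ℝ (fun p => B p y z) x u - B x (christoffel g x u y) z - B x y (christoffel g x u z)

theorem fderiv_form_apply (g : E → E →L[ℝ] E →L[ℝ] ℝ) {B : E → E →L[ℝ] E →L[ℝ] ℝ} {Y Z : E → E}
    {x : E} (hB : DifferentiableAt ℝ B x) (hY : DifferentiableAt ℝ Y x)
    (hZ : DifferentiableAt ℝ Z x) (u : E) :
    fderiv ℝ (fun p => B p (Y p) (Z p)) x u = covDerivForm g B x u (Y x) (Z x)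
      + B x (covDeriv g Y x u) (Z x) + B x (Y x) (covDeriv g Z x u) := by
  have h1 := fderiv_clm_apply (hB.clm_apply hY) hZ
  have h2 := fderiv_clm_apply hB hY
  have h3 := fderiv_clm_apply (hB.clm_apply (differentiableAt_const (Y x)))
    (differentiableAt_const (Z x))
  have h4 := fderiv_clm_apply hB (differentiableAt_const (Y x))
  rw [covDerivForm, h1, h2, h3, h4]
  simp [covDeriv]
  ring

end Coord

/-! ### The differential equations along the Reeb flow -/

/-- A system of differential equations along a vector field `ξ` that has no solution.  It is
satisfied on a Hopf hypersurface with Reeb parallel structure Jacobi operator, where the defect `b`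
of the normal vector does not vanish, by the values `u, v, w` of the second fundamental form on
`(J b, J b)`, `(b, b)`, `(J b, b)` and by `e = (2 q - 1) |b|²`, with `q = quart` and `β = b`. -/
theorem reeb_system_false {E : Type*} [NormedAddCommGroup E] [NormedSpace ℝ E] {V : Set E}
    (hV : IsOpen V) {x₀ : E} (hx₀ : x₀ ∈ V) {α u v w e : E → ℝ} {ξ β : E → E}
    (hα : ∀ p ∈ V, DifferentiableAt ℝ α p) (hu : ∀ p ∈ V, DifferentiableAt ℝ u p)
    (hw : ∀ p ∈ V, DifferentiableAt ℝ w p) (he : ∀ p ∈ V, DifferentiableAt ℝ e p)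
    (he0 : ∀ p ∈ V, e p ≠ 0) (heξ : ∀ p ∈ V, fderiv ℝ e p (ξ p) = 0)
    (hαβ : ∀ p ∈ V, fderiv ℝ α p (β p) ≠ 0)
    (hu' : ∀ p ∈ V, fderiv ℝ u p (ξ p) = -(α p * w p))
    (hw' : ∀ p ∈ V, fderiv ℝ w p (ξ p) = (α p * (u p - v p) - e p) / 2)
    (h1 : ∀ p ∈ V, fderiv ℝ α p (ξ p) * u p = -(α p ^ 2 * w p))
    (h2 : ∀ p ∈ V, fderiv ℝ α p (ξ p) * v p = α p ^ 2 * w p)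
    (h3 : ∀ p ∈ V, fderiv ℝ α p (ξ p) * w p =
      3 / 2 * α p * e p + α p ^ 2 / 2 * (u p - v p)) : False := by
  -- `α` vanishes on no open set
  obtain ⟨x, hx, hαx⟩ : ∃ x ∈ V, α x ≠ 0 := by
    by_contra! hcon
    apply hαβ x₀ hx₀
    have : α =ᶠ[nhds x₀] fun _ => 0 := by
      filter_upwards [hV.mem_nhds hx₀] with p hp using hcon p hp
    rw [this.fderiv_eq]; simp
  have hαne : ∀ᶠ p in nhds x, α p ≠ 0 := (hα x hx).continuousAt.eventually_ne hαx
  have hVx : ∀ᶠ p in nhds x, p ∈ V := hV.mem_nhds hx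
  by_cases hcase : ∀ᶠ p in nhds x, fderiv ℝ α p (ξ p) = 0
  · have hw0 : w =ᶠ[nhds x] fun _ => 0 := by
      filter_upwards [hαne, hVx, hcase] with p hp hpV h0
      have := h1 p hpV
      rw [h0, zero_mul] at this
      have h5 : α p ^ 2 * w p = 0 := by linarith
      simpa [hp] using h5
    have e1 := hw' x hx
    have e2 := h3 x hx
    rw [hw0.fderiv_eq] at e1
    rw [hcase.self_of_nhds] at e2
    simp only [fderiv_fun_const, Pi.zero_apply, zero_apply] at e1
    have e3 : α x * e x = 0 := by linear_combination -(1 / 2) * e2 + (1 / 2) * α x * e1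
    exact (mul_ne_zero hαx (he0 x hx)) e3
  · obtain ⟨y, ⟨hαy, hyV⟩, hy⟩ :=
      ((Filter.not_eventually.1 hcase).and_eventually (hαne.and hVx)).exists.imp
        fun y hy => And.intro hy.2 hy.1
    have hwy : w y ≠ 0 := by
      intro h0
      have e1 := h1 y hyV
      have e2 := h2 y hyV
      have e3 := h3 y hyV
      rw [h0] at e1 e2 e3
      have hu0 : u y = 0 := by simpa [hy] using e1
      have hv0 : v y = 0 := by simpa [hy] using e2
      rw [hu0, hv0] at e3
      have : α y * e y = 0 := by linarith
      exact (mul_ne_zero hαy (he0 y hyV)) this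
    have huy : u y ≠ 0 := by
      intro h0
      have e1 := h1 y hyV
      rw [h0, mul_zero] at e1
      have : α y ^ 2 * w y = 0 := by linarith
      simp [hαy, hwy] at this
    -- a first integral of the system
    have hint : (fun p => α p * (u p * u p + w p * w p) + 3 / 2 * (e p * u p)) =ᶠ[nhds y]
        fun _ => 0 := by
      filter_upwards [(hα y hyV).continuousAt.eventually_ne hαy,
        (hu y hyV).continuousAt.eventually_ne huy, (hw y hyV).continuousAt.eventually_ne hwy,
        hV.mem_nhds hyV] with p hαp hup hwp hpV
      have e1 := h1 p hpV
      have e2 := h2 p hpV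
      have e3 := h3 p hpV
      have hh : fderiv ℝ α p (ξ p) ≠ 0 := by
        intro h0
        rw [h0, zero_mul] at e1
        have : α p ^ 2 * w p = 0 := by linarith
        simp [hαp, hwp] at this
      have hv : v p = -u p := by
        apply mul_left_cancel₀ hh
        linarith
      rw [hv] at e3
      apply mul_left_cancel₀ hαp
      linear_combination w p * e1 - u p * e3
    have hd1 := ((hα y hyV).hasFDerivAt.mul (((hu y hyV).hasFDerivAt.mul (hu y hyV).hasFDerivAt).add
      ((hw y hyV).hasFDerivAt.mul (hw y hyV).hasFDerivAt))).add
      (((he y hyV).hasFDerivAt.mul (hu y hyV).hasFDerivAt).const_mul (3 / 2))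
    have hd2 : HasFDerivAt (fun p => α p * (u p * u p + w p * w p) + 3 / 2 * (e p * u p)) 0 y :=
      (hasFDerivAt_const (𝕜 := ℝ) (0 : ℝ) y).congr_of_eventuallyEq hint
    have hd := DFunLike.congr_fun (hd1.unique hd2) (ξ y)
    simp only [_root_.add_apply, _root_.smul_apply, smul_eq_mul, zero_apply, Pi.add_apply,
      Pi.mul_apply, hu' y hyV, hw' y hyV, heξ y hyV] at hd
    have e1 := h1 y hyV
    have e3 := h3 y hyV
    have hv : v y = -u y := by
      apply mul_left_cancel₀ hy
      linarith [h2 y hyV]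
    rw [hv] at hd e3
    have : α y * e y * w y = 0 := by
      linear_combination -hd + u y * e1 + w y * e3
    exact mul_ne_zero (mul_ne_zero hαy (he0 y hyV)) hwy this

/-! ### The Codazzi equation and the structure Jacobi operator -/

namespace HypQuadric

variable {m : ℕ} {E : Type*} [NormedAddCommGroup E] [NormedSpace ℝ E]

theorem cov_linear_add (F X : E → Vec m) (x u v : E) :
    cov F X x (u + v) = cov F X x u + cov F X x v := by
  apply mat_injective
  simp only [mat_cov, mat_add, map_add, Matrix.add_mul, Matrix.mul_add]
  abel

theorem cov_linear_smul (F X : E → Vec m) (x : E) (c : ℝ) (u : E) :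
    cov F X x (c • u) = c • cov F X x u := by
  apply mat_injective
  simp only [mat_cov, mat_smul, map_smul, Matrix.smul_mul, Matrix.mul_smul, smul_add]

theorem curv_add_left (W U U' V Z : Vec m) :
    curv W (U + U') V Z = curv W U V Z + curv W U' V Z := by
  apply mat_injective
  simp only [curv, mat_add, mat_sub, mat_triple, adj_add, Matrix.add_mul, Matrix.mul_add]
  abel

theorem curv_smul_left (W : Vec m) (c : ℝ) (U V Z : Vec m) :
    curv W (c • U) V Z = c • curv W U V Z := by
  apply mat_injective
  simp only [curv, mat_add, mat_sub, mat_smul, mat_triple, adj_smul, Matrix.smul_mul,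
    Matrix.mul_smul, smul_add, smul_sub]

theorem sff_add_left (F N : E → Vec m) (x u v w : E) :
    sff F N x (u + v) w = sff F N x u w + sff F N x v w := by
  rw [sff, cov_linear_add, map_add, _root_.add_apply, sff, sff]; ring

theorem sff_smul_left (F N : E → Vec m) (x : E) (c : ℝ) (u w : E) :
    sff F N x (c • u) w = c * sff F N x u w := by
  rw [sff, cov_linear_smul, metric_smul_left, sff]; ring

theorem sff_add_right (F N : E → Vec m) (x u v w : E) :
    sff F N x u (v + w) = sff F N x u v + sff F N x u w := by
  rw [sff, map_add, map_add, sff, sff]; ring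

theorem sff_smul_right (F N : E → Vec m) (x : E) (c : ℝ) (u w : E) :
    sff F N x u (c • w) = c * sff F N x u w := by
  rw [sff, map_smul, map_smul, sff, smul_eq_mul]; ring

/-- The form `g(R_ξ y, z)` of the structure Jacobi operator, as given by the Gauss equation. -/
def jacobiForm (F N : E → Vec m) (x y z : E) : ℝ :=
  metric (F x) (curv (F x) (fderiv ℝ F x y) (fderiv ℝ F x (reeb F N x))
      (fderiv ℝ F x (reeb F N x))) (fderiv ℝ F x z)
    + sff F N x (reeb F N x) (reeb F N x) * sff F N x y z
    - sff F N x y (reeb F N x) * sff F N x (reeb F N x) z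

section Forms

variable [FiniteDimensional ℝ E]

/-- The second fundamental form as a field of continuous bilinear forms. -/
def sffForm (F N : E → Vec m) (x : E) : E →L[ℝ] E →L[ℝ] ℝ :=
  (LinearMap.mk₂ ℝ (sff F N x) (sff_add_left F N x) (sff_smul_left F N x)
    (sff_add_right F N x) (sff_smul_right F N x)).toContinuousBilinearMap

theorem sffForm_apply (F N : E → Vec m) (x u v : E) : sffForm F N x u v = sff F N x u v := rfl

/-- The form of the structure Jacobi operator as a field of continuous bilinear forms. -/
def jacobiFormCLM (F N : E → Vec m) (x : E) : E →L[ℝ] E →L[ℝ] ℝ :=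
  (LinearMap.mk₂ ℝ (jacobiForm F N x)
    (fun u v w => by
      simp only [jacobiForm, map_add, curv_add_left, sff_add_left, _root_.add_apply]; ring)
    (fun c u w => by
      simp only [jacobiForm, map_smul, curv_smul_left, sff_smul_left, _root_.smul_apply,
        smul_eq_mul]; ring)
    (fun u v w => by simp only [jacobiForm, map_add, sff_add_right]; ring)
    (fun c u w => by
      simp only [jacobiForm, map_smul, sff_smul_right, smul_eq_mul]; ring)).toContinuousBilinearMap

theorem jacobiFormCLM_apply (F N : E → Vec m) (x u v : E) :
    jacobiFormCLM F N x u v = jacobiForm F N x u v := rfl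

end Forms

namespace IsHypersurfaceOn

variable {F N : E → Vec m} {U : Set E} (h : IsHypersurfaceOn F N U) {x : E} (hx : x ∈ U)
include h hx

theorem differentiableAt_normal : DifferentiableAt ℝ N x :=
  (h.contDiffAt_normal hx).differentiableAt (by simp)

theorem metric_normal_J : metric (F x) (N x) (-J (F x) (N x)) = 0 := by
  rw [map_neg, metric_comm, metric_J_self (h.mem_domain x hx), neg_zero]

theorem fderiv_reeb : fderiv ℝ F x (reeb F N x) = -J (F x) (N x) :=
  h.fderiv_pullTangent hx (h.metric_normal_J hx)

theorem metric_normal_defect : metric (F x) (N x) (defect (F x) (N x)) = 0 :=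
  metric_self_defect (h.metric_normal hx)

theorem metric_normal_J_defect : metric (F x) (N x) (J (F x) (defect (F x) (N x))) = 0 := by
  rw [metric_comm, metric_J_left (h.mem_domain x hx),
    metric_defect_J (h.mem_domain x hx) (h.metric_normal hx), neg_zero]

theorem contDiffAt_cube : ContDiffAt ℝ ∞ (fun y => cube (F y) (N y)) x :=
  contDiffAt_triple (h.contDiffAt hx) (h.mem_domain x hx) (h.contDiffAt_normal hx)
    (h.contDiffAt_normal hx) (h.contDiffAt_normal hx)

theorem contDiffAt_quart : ContDiffAt ℝ ∞ (fun y => quart (F y) (N y)) x :=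
  contDiffAt_metric (h.contDiffAt hx) (h.mem_domain x hx) (h.contDiffAt_cube hx)
    (h.contDiffAt_normal hx)

theorem contDiffAt_defect : ContDiffAt ℝ ∞ (fun y => defect (F y) (N y)) x :=
  (h.contDiffAt_cube hx).sub ((h.contDiffAt_quart hx).smul (h.contDiffAt_normal hx))

theorem contDiffAt_J_defect : ContDiffAt ℝ ∞ (fun y => J (F y) (defect (F y) (N y))) x :=
  contDiffAt_J (h.contDiffAt hx) (h.mem_domain x hx) (h.contDiffAt_defect hx)

variable [FiniteDimensional ℝ E]

theorem contDiffAt_reeb : ContDiffAt ℝ ∞ (reeb F N) x :=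
  h.contDiffAt_pullTangent hx
    (contDiffAt_J (h.contDiffAt hx) (h.mem_domain x hx) (h.contDiffAt_normal hx)).neg
    fun _ hy => h.metric_normal_J hy

theorem contDiffAt_sffForm : ContDiffAt ℝ ∞ (sffForm F N) x :=
  contDiffAt_clm_of_apply fun _ => contDiffAt_clm_of_apply fun _ =>
    h.contDiffAt_sff hx contDiffAt_const contDiffAt_const

theorem contDiffAt_jacobiFormCLM : ContDiffAt ℝ ∞ (jacobiFormCLM F N) x := by
  have hξ := h.contDiffAt_reeb hx
  have hT := h.contDiffAt_fderiv hx
  exact contDiffAt_clm_of_apply fun y => contDiffAt_clm_of_apply fun z =>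
    ((contDiffAt_metric (h.contDiffAt hx) (h.mem_domain x hx)
      (contDiffAt_curv (h.contDiffAt hx) (h.mem_domain x hx) (hT.clm_apply contDiffAt_const)
        (hT.clm_apply hξ) (hT.clm_apply hξ)) (hT.clm_apply contDiffAt_const)).add
      ((h.contDiffAt_sff hx hξ hξ).mul (h.contDiffAt_sff hx contDiffAt_const contDiffAt_const))).sub
      ((h.contDiffAt_sff hx contDiffAt_const hξ).mul (h.contDiffAt_sff hx hξ contDiffAt_const))

theorem christoffel_comm (u v : E) : Coord.christoffel (inducedMetric F) x u v =
    Coord.christoffel (inducedMetric F) x v u := by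
  apply h.injective x hx
  rw [h.fderiv_christoffel hx, h.fderiv_christoffel hx, h.cov_fderiv_symm hx, h.sff_symm hx]

/-- The covariant derivative of a vector field on the hypersurface is determined by that of its
image in the quadric. -/
theorem covDeriv_eq {Y : E → E} (hY : DifferentiableAt ℝ Y x) {Z : E → Vec m}
    (hZ : ∀ y ∈ U, fderiv ℝ F y (Y y) = Z y) {u v : E} {c : ℝ}
    (hcov : cov F Z x u = fderiv ℝ F x v + c • N x) :
    Coord.covDeriv (inducedMetric F) Y x u = v := by
  have hev : (fun y => fderiv ℝ F y (Y y)) =ᶠ[nhds x] Z := by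
    filter_upwards [h.mem_nhds hx] with y hy using hZ y hy
  have h1 := h.cov_fderiv_apply hx hY u
  rw [cov, hev.fderiv_eq, hev.eq_of_nhds, ← cov, hcov] at h1
  have h2 := congrArg (metric (F x) (N x)) h1
  simp only [map_add, map_smul, h.metric_normal_tangent hx, h.metric_normal hx, smul_eq_mul,
    zero_add, mul_one] at h2
  rw [h2] at h1
  exact (h.injective x hx (add_right_cancel h1)).symm

/-- The Codazzi equation. -/
theorem covDerivForm_sff_sub (u v z : E) :
    Coord.covDerivForm (inducedMetric F) (sffForm F N) x u v z
      - Coord.covDerivForm (inducedMetric F) (sffForm F N) x v u z =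
      -metric (F x) (curv (F x) (fderiv ℝ F x u) (fderiv ℝ F x v) (N x)) (fderiv ℝ F x z) := by
  have key : ∀ u v, Coord.covDerivForm (inducedMetric F) (sffForm F N) x u v z =
      -metric (F x) (cov F (fun y => cov F N y v) x u) (fderiv ℝ F x z)
        - sff F N x (Coord.christoffel (inducedMetric F) x u v) z := by
    intro u v
    have hc := (h.contDiffAt_cov hx (h.contDiffAt_normal hx) (v := fun _ => v)
      contDiffAt_const).differentiableAt (by simp)
    have h1 : fderiv ℝ (fun p => sff F N p v z) x u =
        -fderiv ℝ (fun p => metric (F p) (cov F N p v) (fderiv ℝ F p z)) x u := by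
      exact DFunLike.congr_fun (fderiv_fun_neg (𝕜 := ℝ)) u
    have h2 := h.fderiv_christoffel hx u z
    rw [eq_sub_iff_add_eq] at h2
    rw [Coord.covDerivForm]
    simp only [sffForm_apply]
    rw [h1, fderiv_metric_apply (h.contDiffAt_one hx) (h.mem_domain x hx) hc
      (h.differentiableAt_fderiv_apply hx z), ← h2, map_add, map_smul,
      metric_comm (F x) (cov F N x v) (N x), h.metric_cov_normal_normal hx,
      sff.eq_def F N x v (Coord.christoffel _ _ _ _)]
    simp only [smul_zero]
    ring
  rw [key, key, h.christoffel_comm hx u v, ← h.cov_cov_normal_sub hx, metric_sub_left]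
  ring

/-- On the hypersurface, `jacobiForm` is the form of the structure Jacobi operator. -/
theorem inducedMetric_structureJacobi (y z : E) :
    inducedMetric F x (structureJacobi F N x y) z = jacobiForm F N x y z := by
  rw [structureJacobi, Coord.jacobiOp, h.inducedMetric_curvature hx, jacobiForm]

theorem differentiableAt_structureJacobi (y : E) :
    DifferentiableAt ℝ (fun p => structureJacobi F N p y) x := by
  have h1 : ContDiffAt ℝ ∞ (fun p => jacobiFormCLM F N p y) x :=
    (h.contDiffAt_jacobiFormCLM hx).clm_apply contDiffAt_const
  refine ((Coord.contDiffAt_inverse_apply (h.contDiffAt_inducedMetric hx) h1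
    (h.inducedMetric_injective hx)).differentiableAt (by simp)).congr_of_eventuallyEq ?_
  filter_upwards [h.mem_nhds hx] with p hp
  symm
  rw [(Coord.isInvertible_of_injective (h.inducedMetric_injective hp)).inverse_apply_eq]
  ext z
  rw [h.inducedMetric_structureJacobi hp, jacobiFormCLM_apply]

/-- If `∇_u R_ξ = 0`, then the form of `R_ξ` is parallel in the direction `u`. -/
theorem covDerivForm_jacobiFormCLM {u : E}
    (hR : ∀ y, Coord.covDerivEnd (inducedMetric F) (structureJacobi F N) x u y = 0) (y z : E) :
    Coord.covDerivForm (inducedMetric F) (jacobiFormCLM F N) x u y z = 0 := by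
  have hconst : ∀ w : E, Coord.covDeriv (inducedMetric F) (fun _ => w) x u =
      Coord.christoffel (inducedMetric F) x u w := by
    intro w; simp [Coord.covDeriv]
  have h1 := h.fderiv_inducedMetric_apply hx (h.differentiableAt_structureJacobi hx y)
    (differentiableAt_const z) u
  have h2 : (fun p => inducedMetric F p (structureJacobi F N p y) z) =ᶠ[nhds x]
      fun p => jacobiFormCLM F N p y z := by
    filter_upwards [h.mem_nhds hx] with p hp using h.inducedMetric_structureJacobi hp y z
  have h3 : Coord.covDeriv (inducedMetric F) (fun p => structureJacobi F N p y) x u =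
      structureJacobi F N x (Coord.christoffel (inducedMetric F) x u y) := by
    have := hR y
    rw [Coord.covDerivEnd, sub_eq_zero, hconst] at this
    exact this
  rw [h2.fderiv_eq, h3, hconst, h.inducedMetric_structureJacobi hx,
    h.inducedMetric_structureJacobi hx] at h1
  rw [Coord.covDerivForm, h1]
  simp only [jacobiFormCLM_apply]
  ring

end IsHypersurfaceOn

end HypQuadric

/-! ### Hopf hypersurfaces and the defect of the normal vector -/

namespace HypQuadric

variable {m : ℕ} {E : Type*} [NormedAddCommGroup E] [NormedSpace ℝ E]

/-- The function `α` with `S ξ = α ξ` on a Hopf hypersurface. -/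
def hopfFn (F N : E → Vec m) (x : E) : ℝ := sff F N x (reeb F N x) (reeb F N x)

/-- The vector field on the hypersurface given by the defect of the normal vector. -/
def defectField (F N : E → Vec m) (x : E) : E := pullTangent F x (defect (F x) (N x))

/-- The image of `defectField` under the complex structure. -/
def defectFieldJ (F N : E → Vec m) (x : E) : E := pullTangent F x (J (F x) (defect (F x) (N x)))

theorem triple_smul_left (W : Vec m) (c : ℝ) (X Y Z : Vec m) :
    triple W (c • X) Y Z = c • triple W X Y Z := by
  apply mat_injective; simp only [mat_smul, mat_triple, Matrix.smul_mul]

theorem triple_smul_mid (W : Vec m) (c : ℝ) (X Y Z : Vec m) :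
    triple W X (c • Y) Z = c • triple W X Y Z := by
  apply mat_injective
  simp only [mat_smul, mat_triple, adj_smul, Matrix.smul_mul, Matrix.mul_smul]

theorem triple_smul_right (W : Vec m) (c : ℝ) (X Y Z : Vec m) :
    triple W X Y (c • Z) = c • triple W X Y Z := by
  apply mat_injective; simp only [mat_smul, mat_triple, Matrix.mul_smul]

/-- The derivative of the cube in the direction `J n` is `J` of the cube. -/
theorem triple_J_add {W : Vec m} (hW : W ∈ domain m) (n : Vec m) :
    triple W (J W n) n n + triple W n (J W n) n + triple W n n (J W n) = J W (cube W n) := by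
  apply mat_injective
  simp only [cube, mat_add, mat_triple, mat_J, adj_J hW, Matrix.mul_neg, Matrix.neg_mul,
    Matrix.mul_assoc]
  abel

namespace IsHypersurfaceOn

variable {F N : E → Vec m} {U : Set E} (h : IsHypersurfaceOn F N U) {x : E} (hx : x ∈ U)
include h hx

theorem metric_defect_normal : metric (F x) (defect (F x) (N x)) (N x) = 0 :=
  metric_defect_self (h.metric_normal hx)

theorem fderiv_defectField : fderiv ℝ F x (defectField F N x) = defect (F x) (N x) :=
  h.fderiv_pullTangent hx (h.metric_normal_defect hx)

theorem fderiv_defectFieldJ : fderiv ℝ F x (defectFieldJ F N x) = J (F x) (defect (F x) (N x)) :=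
  h.fderiv_pullTangent hx (h.metric_normal_J_defect hx)

theorem ambientDeriv_eq (u : E) : ambientDeriv F N x u = cov F N x u := by
  rw [ambientDeriv, christoffel_metric (h.mem_domain x hx), cov]

theorem cov_normal_reeb
    (hH : ∃ α : ℝ, shapeOperator F N x (reeb F N x) = α • reeb F N x) :
    cov F N x (reeb F N x) = hopfFn F N x • J (F x) (N x) := by
  obtain ⟨α, hα⟩ := hH
  have h1 := congrArg (fderiv ℝ F x) hα
  rw [shapeOperator, h.ambientDeriv_eq hx, h.fderiv_pullTangent hx (by
    rw [map_neg, h.metric_cov_normal_normal hx, neg_zero]), map_smul, h.fderiv_reeb hx,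
    smul_neg, neg_inj] at h1
  have h2 : hopfFn F N x = α := by
    rw [hopfFn, sff, h1, h.fderiv_reeb hx, metric_smul_left, map_neg,
      metric_J_J (h.mem_domain x hx), h.metric_normal hx]
    ring
  rw [h2, h1]

theorem inducedMetric_reeb_reeb :
    inducedMetric F x (reeb F N x) (reeb F N x) = 1 := by
  rw [inducedMetric_apply, h.fderiv_reeb hx, map_neg, metric_neg_left,
    metric_J_J (h.mem_domain x hx), h.metric_normal hx, neg_neg]

theorem inducedMetric_reeb_defectField :
    inducedMetric F x (reeb F N x) (defectField F N x) = 0 := by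
  rw [inducedMetric_apply, h.fderiv_reeb hx, h.fderiv_defectField hx, metric_neg_left, metric_comm,
    metric_defect_J (h.mem_domain x hx) (h.metric_normal hx), neg_zero]

theorem inducedMetric_reeb_defectFieldJ :
    inducedMetric F x (reeb F N x) (defectFieldJ F N x) = 0 := by
  rw [inducedMetric_apply, h.fderiv_reeb hx, h.fderiv_defectFieldJ hx, metric_neg_left,
    metric_J_J (h.mem_domain x hx), metric_comm, h.metric_defect_normal hx, neg_zero]

theorem metric_defect_defect_eq :
    metric (F x) (defect (F x) (N x)) (defect (F x) (N x)) =
      (2 * quart (F x) (N x) - 1) * (1 - quart (F x) (N x)) / 2 :=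
  metric_defect_defect (h.metric_normal hx)

section Hopf

variable (hH : ∀ y ∈ U, ∃ α : ℝ, shapeOperator F N y (reeb F N y) = α • reeb F N y)
include hH

theorem sff_reeb (v : E) :
    sff F N x (reeb F N x) v = hopfFn F N x * inducedMetric F x (reeb F N x) v := by
  rw [sff, h.cov_normal_reeb hx (hH x hx), inducedMetric_apply, h.fderiv_reeb hx, metric_neg_left,
    metric_smul_left]
  ring

theorem cov_cube_reeb : cov F (fun y => cube (F y) (N y)) x (reeb F N x) =
    hopfFn F N x • J (F x) (cube (F x) (N x)) := by
  have hN := h.differentiableAt_normal hx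
  have h1 := cov_triple (h.contDiffAt_one hx) (h.mem_domain x hx) hN hN hN (reeb F N x)
  rw [h.cov_normal_reeb hx (hH x hx), triple_smul_left, triple_smul_mid, triple_smul_right,
    ← smul_add, ← smul_add, triple_J_add (h.mem_domain x hx)] at h1
  exact h1

theorem fderiv_quart_reeb : fderiv ℝ (fun y => quart (F y) (N y)) x (reeb F N x) = 0 := by
  have h1 := fderiv_metric_apply (h.contDiffAt_one hx) (h.mem_domain x hx)
    ((h.contDiffAt_cube hx).differentiableAt (by simp)) (h.differentiableAt_normal hx)
    (reeb F N x)
  rw [h.cov_cube_reeb hx hH, h.cov_normal_reeb hx (hH x hx), metric_smul_left, map_smul,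
    metric_J_left (h.mem_domain x hx)] at h1
  refine h1.trans ?_
  rw [smul_eq_mul]; ring

theorem cov_defect_reeb : cov F (fun y => defect (F y) (N y)) x (reeb F N x) =
    hopfFn F N x • J (F x) (defect (F x) (N x)) := by
  have hq := (h.contDiffAt_quart hx).differentiableAt (by simp)
  have hN := h.differentiableAt_normal hx
  simp only [defect]
  rw [cov_sub ((h.contDiffAt_cube hx).differentiableAt (by simp)) (hq.fun_smul hN),
    cov_smul hq hN, h.fderiv_quart_reeb hx hH, h.cov_cube_reeb hx hH,
    h.cov_normal_reeb hx (hH x hx), J_sub, J_smul]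
  module

theorem cov_J_defect_reeb : cov F (fun y => J (F y) (defect (F y) (N y))) x (reeb F N x) =
    -(hopfFn F N x • defect (F x) (N x)) := by
  rw [cov_J (h.contDiffAt_one hx) (h.mem_domain x hx)
    ((h.contDiffAt_defect hx).differentiableAt (by simp)), h.cov_defect_reeb hx hH, J_smul,
    J_J (h.mem_domain x hx), smul_neg]

variable [FiniteDimensional ℝ E]

omit hH in
theorem contDiffAt_defectField : ContDiffAt ℝ ∞ (defectField F N) x :=
  h.contDiffAt_pullTangent hx (h.contDiffAt_defect hx) fun _ hy => h.metric_normal_defect hy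

omit hH in
theorem contDiffAt_defectFieldJ : ContDiffAt ℝ ∞ (defectFieldJ F N) x :=
  h.contDiffAt_pullTangent hx (h.contDiffAt_J_defect hx) fun _ hy => h.metric_normal_J_defect hy

omit hH in
theorem contDiffAt_hopfFn : ContDiffAt ℝ ∞ (hopfFn F N) x :=
  h.contDiffAt_sff hx (h.contDiffAt_reeb hx) (h.contDiffAt_reeb hx)

theorem covDeriv_defectField :
    Coord.covDeriv (inducedMetric F) (defectField F N) x (reeb F N x) =
      hopfFn F N x • defectFieldJ F N x := by
  refine h.covDeriv_eq hx ((h.contDiffAt_defectField hx).differentiableAt (by simp))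
    (fun y hy => h.fderiv_defectField hy) (c := 0) ?_
  rw [h.cov_defect_reeb hx hH, map_smul, h.fderiv_defectFieldJ hx, zero_smul, add_zero]

theorem covDeriv_defectFieldJ :
    Coord.covDeriv (inducedMetric F) (defectFieldJ F N) x (reeb F N x) =
      -(hopfFn F N x • defectField F N x) := by
  refine h.covDeriv_eq hx ((h.contDiffAt_defectFieldJ hx).differentiableAt (by simp))
    (fun y hy => h.fderiv_defectFieldJ hy) (c := 0) ?_
  rw [h.cov_J_defect_reeb hx hH, map_neg, map_smul, h.fderiv_defectField hx, zero_smul, add_zero]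

theorem covDeriv_reeb_reeb :
    Coord.covDeriv (inducedMetric F) (reeb F N) x (reeb F N x) = 0 := by
  refine h.covDeriv_eq hx ((h.contDiffAt_reeb hx).differentiableAt (by simp))
    (fun y hy => h.fderiv_reeb hy) (c := hopfFn F N x) ?_
  rw [cov_neg, cov_J (h.contDiffAt_one hx) (h.mem_domain x hx) (h.differentiableAt_normal hx),
    h.cov_normal_reeb hx (hH x hx), J_smul, J_J (h.mem_domain x hx), map_zero]
  module

omit hH in
theorem fderiv_covDeriv_reeb (y : E) :
    fderiv ℝ F x (Coord.covDeriv (inducedMetric F) (reeb F N) x y) =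
      -J (F x) (cov F N x y) - sff F N x y (reeb F N x) • N x := by
  have h0 : -J (F x) (cov F N x y) - sff F N x y (reeb F N x) • N x ∈
      Set.range (fderiv ℝ F x) := by
    refine h.exists_fderiv_eq hx ?_
    rw [map_sub, map_neg, map_smul, h.metric_normal hx, metric_comm,
      metric_J_left (h.mem_domain x hx), sff, h.fderiv_reeb hx, map_neg]
    simp
  obtain ⟨v, hv⟩ := h0
  rw [← hv]
  congr 1
  refine h.covDeriv_eq hx ((h.contDiffAt_reeb hx).differentiableAt (by simp))
    (fun y hy => h.fderiv_reeb hy) (c := sff F N x y (reeb F N x)) ?_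
  rw [cov_neg, cov_J (h.contDiffAt_one hx) (h.mem_domain x hx) (h.differentiableAt_normal hx), hv]
  module

/-- On a Hopf hypersurface, `(∇_y S) ξ = (y α) ξ + α ∇_y ξ - S ∇_y ξ`. -/
theorem covDerivForm_sff_reeb (y z : E) :
    Coord.covDerivForm (inducedMetric F) (sffForm F N) x y (reeb F N x) z =
      fderiv ℝ (hopfFn F N) x y * inducedMetric F x (reeb F N x) z
      + hopfFn F N x * inducedMetric F x
        (Coord.covDeriv (inducedMetric F) (reeb F N) x y) z
      - sff F N x (Coord.covDeriv (inducedMetric F) (reeb F N) x y) z := by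
  have hξ := (h.contDiffAt_reeb hx).differentiableAt (by simp)
  have hα := (h.contDiffAt_hopfFn hx).differentiableAt (by simp)
  have hg := (h.contDiffAt_inducedMetric hx).differentiableAt (by simp)
  have h1 := Coord.fderiv_form_apply (inducedMetric F)
    ((h.contDiffAt_sffForm hx).differentiableAt (by simp)) hξ (differentiableAt_const z) y
  have h2 : (fun p => sffForm F N p (reeb F N p) z) =ᶠ[nhds x]
      fun p => hopfFn F N p * inducedMetric F p (reeb F N p) z := by
    filter_upwards [h.mem_nhds hx] with p hp using h.sff_reeb hp hH z
  have h3 := h.fderiv_inducedMetric_apply hx hξ (differentiableAt_const z) y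
  have h4 : fderiv ℝ (fun p => hopfFn F N p * inducedMetric F p (reeb F N p) z) x y =
      hopfFn F N x * fderiv ℝ (fun p => inducedMetric F p (reeb F N p) z) x y +
      inducedMetric F x (reeb F N x) z * fderiv ℝ (hopfFn F N) x y :=
    DFunLike.congr_fun (fderiv_fun_mul hα
      ((hg.clm_apply hξ).clm_apply (differentiableAt_const z))) y
  rw [h2.fderiv_eq, h4, h3] at h1
  simp only [sffForm_apply, h.sff_reeb hx hH] at h1
  linear_combination -h1

/-- The Codazzi equation in the Reeb direction of a Hopf hypersurface. -/
theorem covDerivForm_sff_along_reeb (y z : E) (hz : inducedMetric F x (reeb F N x) z = 0) :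
    Coord.covDerivForm (inducedMetric F) (sffForm F N) x (reeb F N x) y z =
      hopfFn F N x * metric (F x) (cov F N x y) (J (F x) (fderiv ℝ F x z))
      - metric (F x) (cov F N x z) (J (F x) (cov F N x y))
      - metric (F x) (curv (F x) (-J (F x) (N x)) (fderiv ℝ F x y) (N x)) (fderiv ℝ F x z) := by
  have h1 := h.covDerivForm_sff_sub hx (reeb F N x) y z
  rw [h.covDerivForm_sff_reeb hx hH, hz, inducedMetric_apply, h.sff_symm hx _ z, sff,
    h.fderiv_covDeriv_reeb hx, h.fderiv_reeb hx, map_sub, map_sub, map_neg, map_neg, map_smul,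
    map_smul, metric_comm (F x) (cov F N x z) (N x), h.metric_cov_normal_normal hx] at h1
  simp only [_root_.sub_apply, _root_.neg_apply, _root_.smul_apply, h.metric_normal_tangent hx,
    metric_J_left (h.mem_domain x hx)] at h1
  simp only [smul_zero] at h1
  linear_combination h1

end Hopf

end IsHypersurfaceOn

end HypQuadric

/-! ### The Reeb parallel structure Jacobi operator and the vanishing of the defect -/

namespace HypQuadric

variable {m : ℕ} {E : Type*} [NormedAddCommGroup E] [NormedSpace ℝ E]

namespace IsHypersurfaceOn

variable {F N : E → Vec m} {U : Set E} (h : IsHypersurfaceOn F N U) {x : E} (hx : x ∈ U)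
include h hx

theorem metric_cov_J_defectField (y : E) : metric (F x) (cov F N x y)
    (J (F x) (fderiv ℝ F x (defectField F N x))) = -sff F N x y (defectFieldJ F N x) := by
  rw [h.fderiv_defectField hx, ← h.fderiv_defectFieldJ hx, sff, neg_neg]

theorem metric_cov_J_defectFieldJ (y : E) : metric (F x) (cov F N x y)
    (J (F x) (fderiv ℝ F x (defectFieldJ F N x))) = sff F N x y (defectField F N x) := by
  rw [h.fderiv_defectFieldJ hx, J_J (h.mem_domain x hx), ← h.fderiv_defectField hx, map_neg, sff]

/-- The curvature term of the Codazzi equation in the direction of the defect. -/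
theorem metric_curv_defect (Z : Vec m) :
    metric (F x) (curv (F x) (-J (F x) (N x)) (defect (F x) (N x)) (N x)) Z =
      (2 * quart (F x) (N x) - 1) *
        metric (F x) (N x - cube (F x) (N x)) (J (F x) Z) := by
  rw [curv_normal_defect (h.mem_domain x hx) (h.metric_normal hx), metric_neg_left,
    metric_smul_left, metric_J_left (h.mem_domain x hx)]
  ring

theorem metric_sub_cube_defect :
    metric (F x) (N x - cube (F x) (N x)) (defect (F x) (N x)) =
      -metric (F x) (defect (F x) (N x)) (defect (F x) (N x)) := by
  rw [metric_sub_left, h.metric_normal_defect hx, metric_cube_defect (h.metric_normal hx)]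
  ring

theorem metric_sub_cube_J_defect :
    metric (F x) (N x - cube (F x) (N x)) (J (F x) (defect (F x) (N x))) = 0 := by
  have h1 : N x - cube (F x) (N x) = (1 - quart (F x) (N x)) • N x - defect (F x) (N x) := by
    rw [cube_eq]; module
  rw [h1, metric_sub_left, metric_smul_left, h.metric_normal_J_defect hx, metric_comm,
    metric_J_self (h.mem_domain x hx)]
  ring

section Hopf

variable (hH : ∀ y ∈ U, ∃ α : ℝ, shapeOperator F N y (reeb F N y) = α • reeb F N y)
include hH

theorem jacobiForm_eq (y z : E) (hy : inducedMetric F x (reeb F N x) y = 0) :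
    jacobiForm F N x y z = metric (F x) (curv (F x) (fderiv ℝ F x y) (-J (F x) (N x))
      (-J (F x) (N x))) (fderiv ℝ F x z) + hopfFn F N x * sff F N x y z := by
  rw [jacobiForm, h.sff_symm hx y (reeb F N x), h.sff_reeb hx hH y, hy, h.fderiv_reeb hx, hopfFn]
  ring

theorem jacobiForm_defectFieldJ (z : E) :
    jacobiForm F N x (defectFieldJ F N x) z =
      hopfFn F N x * sff F N x (defectFieldJ F N x) z := by
  rw [h.jacobiForm_eq hx hH _ _ (h.inducedMetric_reeb_defectFieldJ hx), h.fderiv_defectFieldJ hx,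
    curv_J_defect_J (h.mem_domain x hx) (h.metric_normal hx), map_zero, _root_.zero_apply, zero_add]

theorem jacobiForm_defectField (z : E) :
    jacobiForm F N x (defectField F N x) z = (2 * quart (F x) (N x) - 1) *
        metric (F x) (N x - cube (F x) (N x)) (fderiv ℝ F x z)
      + hopfFn F N x * sff F N x (defectField F N x) z := by
  rw [h.jacobiForm_eq hx hH _ _ (h.inducedMetric_reeb_defectField hx), h.fderiv_defectField hx,
    curv_defect_J (h.mem_domain x hx) (h.metric_normal hx), metric_smul_left]

variable [FiniteDimensional ℝ E]

/-- The derivative along `ξ` of the second fundamental form, on fields orthogonal to `ξ`. -/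
theorem fderiv_sff_reeb {Y Z : E → E} (hY : DifferentiableAt ℝ Y x) (hZ : DifferentiableAt ℝ Z x)
    (hz : inducedMetric F x (reeb F N x) (Z x) = 0) :
    fderiv ℝ (fun p => sff F N p (Y p) (Z p)) x (reeb F N x) =
      hopfFn F N x * metric (F x) (cov F N x (Y x)) (J (F x) (fderiv ℝ F x (Z x)))
      - metric (F x) (cov F N x (Z x)) (J (F x) (cov F N x (Y x)))
      - metric (F x) (curv (F x) (-J (F x) (N x)) (fderiv ℝ F x (Y x)) (N x))
          (fderiv ℝ F x (Z x))
      + sff F N x (Coord.covDeriv (inducedMetric F) Y x (reeb F N x)) (Z x)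
      + sff F N x (Y x) (Coord.covDeriv (inducedMetric F) Z x (reeb F N x)) := by
  rw [← h.covDerivForm_sff_along_reeb hx hH _ _ hz]
  exact Coord.fderiv_form_apply (inducedMetric F)
    ((h.contDiffAt_sffForm hx).differentiableAt (by simp)) hY hZ (reeb F N x)

theorem fderiv_sff_JJ :
    fderiv ℝ (fun p => sff F N p (defectFieldJ F N p) (defectFieldJ F N p)) x (reeb F N x) =
      -(hopfFn F N x * sff F N x (defectFieldJ F N x) (defectField F N x)) := by
  have ha := (h.contDiffAt_defectFieldJ hx).differentiableAt (by simp)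
  rw [h.fderiv_sff_reeb hx hH ha ha (h.inducedMetric_reeb_defectFieldJ hx),
    h.metric_cov_J_defectFieldJ hx, h.fderiv_defectFieldJ hx,
    curv_normal_J_defect (h.mem_domain x hx) (h.metric_normal hx), h.covDeriv_defectFieldJ hx hH,
    metric_comm (F x) _ (J (F x) (cov F N x _)), metric_J_self (h.mem_domain x hx), ← neg_smul,
    sff_smul_left, sff_smul_right, h.sff_symm hx (defectField F N x), map_zero]
  simp only [_root_.zero_apply]
  ring

theorem fderiv_sff_defect_defect :
    fderiv ℝ (fun p => sff F N p (defectField F N p) (defectField F N p)) x (reeb F N x) =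
      hopfFn F N x * sff F N x (defectFieldJ F N x) (defectField F N x) := by
  have hb := (h.contDiffAt_defectField hx).differentiableAt (by simp)
  rw [h.fderiv_sff_reeb hx hH hb hb (h.inducedMetric_reeb_defectField hx),
    h.metric_cov_J_defectField hx, h.fderiv_defectField hx, h.metric_curv_defect hx,
    h.metric_sub_cube_J_defect hx, h.covDeriv_defectField hx hH,
    metric_comm (F x) _ (J (F x) (cov F N x _)), metric_J_self (h.mem_domain x hx),
    sff_smul_left, sff_smul_right, h.sff_symm hx (defectField F N x)]
  ring

theorem fderiv_sff_J_defect :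
    fderiv ℝ (fun p => sff F N p (defectFieldJ F N p) (defectField F N p)) x (reeb F N x) =
      (hopfFn F N x * (sff F N x (defectFieldJ F N x) (defectFieldJ F N x)
        - sff F N x (defectField F N x) (defectField F N x))
      - (2 * quart (F x) (N x) - 1) *
          metric (F x) (defect (F x) (N x)) (defect (F x) (N x))) / 2 := by
  have ha := (h.contDiffAt_defectFieldJ hx).differentiableAt (by simp)
  have hb := (h.contDiffAt_defectField hx).differentiableAt (by simp)
  -- the Codazzi equation is used for both orders of the two fields
  have h1 := h.fderiv_sff_reeb hx hH ha hb (h.inducedMetric_reeb_defectField hx)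
  have h2 := h.fderiv_sff_reeb hx hH hb ha (h.inducedMetric_reeb_defectFieldJ hx)
  have h3 : (fun p => sff F N p (defectField F N p) (defectFieldJ F N p)) =ᶠ[nhds x]
      fun p => sff F N p (defectFieldJ F N p) (defectField F N p) := by
    filter_upwards [h.mem_nhds hx] with p hp using h.sff_symm hp _ _
  rw [h3.fderiv_eq, h.metric_cov_J_defectFieldJ hx, h.fderiv_defectField hx,
    h.metric_curv_defect hx, h.fderiv_defectFieldJ hx, J_J (h.mem_domain x hx), map_neg,
    h.metric_sub_cube_defect hx, h.covDeriv_defectField hx hH, h.covDeriv_defectFieldJ hx hH,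
    ← neg_smul, sff_smul_left, sff_smul_right, metric_comm (F x) (cov F N x (defectFieldJ F N x)),
    metric_J_left (h.mem_domain x hx)] at h2
  rw [h.metric_cov_J_defectField hx, h.fderiv_defectFieldJ hx,
    curv_normal_J_defect (h.mem_domain x hx) (h.metric_normal hx),
    h.covDeriv_defectField hx hH, h.covDeriv_defectFieldJ hx hH, ← neg_smul, sff_smul_left,
    sff_smul_right, map_zero, _root_.zero_apply] at h1
  linear_combination (h1 + h2) / 2

/-- In the direction of the defect `b`, `α` has the derivative `2 |b|²`; so `α` cannot vanish on an
open set on which `b ≠ 0`. -/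
theorem fderiv_hopfFn_defectField :
    fderiv ℝ (hopfFn F N) x (defectField F N x) =
      2 * metric (F x) (defect (F x) (N x)) (defect (F x) (N x)) := by
  have hb := (h.contDiffAt_defectField hx).differentiableAt (by simp)
  have hξ := (h.contDiffAt_reeb hx).differentiableAt (by simp)
  have h1 := Coord.fderiv_form_apply (inducedMetric F)
    ((h.contDiffAt_sffForm hx).differentiableAt (by simp)) hb hξ (reeb F N x)
  have h2 : (fun p => sffForm F N p (defectField F N p) (reeb F N p)) =ᶠ[nhds x]
      fun _ => (0 : ℝ) := by
    filter_upwards [h.mem_nhds hx] with p hp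
    rw [sffForm_apply, h.sff_symm hp, h.sff_reeb hp hH, h.inducedMetric_reeb_defectField hp,
      mul_zero]
  have h3 := h.covDerivForm_sff_sub hx (reeb F N x) (defectField F N x) (reeb F N x)
  rw [h2.fderiv_eq, h.covDeriv_defectField hx hH, h.covDeriv_reeb_reeb hx hH, map_zero,
    sffForm_apply, sff_smul_left, h.sff_symm hx, h.sff_reeb hx hH,
    h.inducedMetric_reeb_defectFieldJ hx] at h1
  simp only [fderiv_fun_const, Pi.zero_apply, _root_.zero_apply, mul_zero, add_zero] at h1
  rw [← h1, h.covDerivForm_sff_reeb hx hH, h.inducedMetric_reeb_reeb hx, h.sff_symm hx,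
    h.sff_reeb hx hH, h.fderiv_reeb hx, h.fderiv_defectField hx, h.metric_curv_defect hx] at h3
  rw [J_neg, J_J (h.mem_domain x hx), neg_neg, metric_sub_left, h.metric_normal hx,
    show inducedMetric F x (Coord.covDeriv (inducedMetric F) (reeb F N) x (defectField F N x))
      (reeb F N x) = inducedMetric F x (reeb F N x)
      (Coord.covDeriv (inducedMetric F) (reeb F N) x (defectField F N x)) from metric_comm _ _ _,
    show metric (F x) (cube (F x) (N x)) (N x) = quart (F x) (N x) from rfl] at h3
  rw [h.metric_defect_defect_eq hx]
  linear_combination -h3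

variable (hR : ∀ y ∈ U, ∀ z,
  Coord.covDerivEnd (inducedMetric F) (structureJacobi F N) y (reeb F N y) z = 0)
include hR

omit hH in
theorem fderiv_jacobiForm_reeb {Y Z : E → E} (hY : DifferentiableAt ℝ Y x)
    (hZ : DifferentiableAt ℝ Z x) :
    fderiv ℝ (fun p => jacobiForm F N p (Y p) (Z p)) x (reeb F N x) =
      jacobiForm F N x (Coord.covDeriv (inducedMetric F) Y x (reeb F N x)) (Z x)
      + jacobiForm F N x (Y x) (Coord.covDeriv (inducedMetric F) Z x (reeb F N x)) := by
  have h1 := Coord.fderiv_form_apply (inducedMetric F)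
    ((h.contDiffAt_jacobiFormCLM hx).differentiableAt (by simp)) hY hZ (reeb F N x)
  rw [h.covDerivForm_jacobiFormCLM hx (hR x hx), zero_add] at h1
  exact h1

/-- The normal vector of a Hopf hypersurface with Reeb parallel structure Jacobi operator has no
defect from being singular. -/
theorem defect_eq_zero : defect (F x) (N x) = 0 := by
  by_contra hne
  set V := {p | p ∈ U ∧ defect (F p) (N p) ≠ 0} with hVdef
  have hVo : IsOpen V := by
    rw [isOpen_iff_mem_nhds]
    rintro p ⟨hp, hpb⟩
    filter_upwards [h.mem_nhds hp, (h.contDiffAt_defect hp).continuousAt.eventually_ne hpb]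
      with y hy hyb using ⟨hy, hyb⟩
  have hbb : ∀ p ∈ V, metric (F p) (defect (F p) (N p)) (defect (F p) (N p)) ≠ 0 :=
    fun p hp => (metric_self_pos (h.mem_domain p hp.1) hp.2).ne'
  have hα : ∀ p ∈ V, DifferentiableAt ℝ (hopfFn F N) p := fun p hp =>
    (h.contDiffAt_hopfFn hp.1).differentiableAt (by simp)
  have ha : ∀ p ∈ V, DifferentiableAt ℝ (defectFieldJ F N) p := fun p hp =>
    (h.contDiffAt_defectFieldJ hp.1).differentiableAt (by simp)
  have hb : ∀ p ∈ V, DifferentiableAt ℝ (defectField F N) p := fun p hp =>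
    (h.contDiffAt_defectField hp.1).differentiableAt (by simp)
  have hs : ∀ {Y Z : E → E} {p : E}, p ∈ V → ContDiffAt ℝ ∞ Y p → ContDiffAt ℝ ∞ Z p →
      DifferentiableAt ℝ (fun q => sff F N q (Y q) (Z q)) p := fun hp hY hZ =>
    (h.contDiffAt_sff hp.1 hY hZ).differentiableAt (by simp)
  have hq : ∀ p ∈ V, DifferentiableAt ℝ (fun q => quart (F q) (N q)) p := fun p hp =>
    (h.contDiffAt_quart hp.1).differentiableAt (by simp)
  -- the polynomial `e = (2 q - 1) |b|²` of `q = quart`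
  set f : ℝ → ℝ := fun t => (2 * t - 1) * ((2 * t - 1) * (1 - t) / 2) with hf
  have hfd : Differentiable ℝ f := by fun_prop
  have hfe : ∀ p ∈ U, f (quart (F p) (N p)) = (2 * quart (F p) (N p) - 1) *
      metric (F p) (defect (F p) (N p)) (defect (F p) (N p)) := fun p hp => by
    rw [h.metric_defect_defect_eq hp]
  have he : ∀ p ∈ V, HasFDerivAt (fun y => f (quart (F y) (N y))) _ p := fun p hp =>
    (hfd _).hasDerivAt.comp_hasFDerivAt p (hq p hp).hasFDerivAt
  have heξ : ∀ p ∈ V, fderiv ℝ (fun y => f (quart (F y) (N y))) p (reeb F N p) = 0 := by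
    intro p hp
    rw [(he p hp).fderiv, _root_.smul_apply, h.fderiv_quart_reeb hp.1 hH, smul_zero]
  -- `∇_ξ R_ξ = 0`, on fields `Y, Z` on which the form of `R_ξ` is `k + α s`
  have hdj : ∀ {Y Z : E → E} {p : E} {k : E → ℝ}, p ∈ V → DifferentiableAt ℝ Y p →
      DifferentiableAt ℝ Z p → ContDiffAt ℝ ∞ (fun q => sff F N q (Y q) (Z q)) p →
      DifferentiableAt ℝ k p →
      (∀ y ∈ U, jacobiForm F N y (Y y) (Z y) = k y + hopfFn F N y * sff F N y (Y y) (Z y)) →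
      fderiv ℝ k p (reeb F N p) + (hopfFn F N p *
          fderiv ℝ (fun q => sff F N q (Y q) (Z q)) p (reeb F N p)
        + sff F N p (Y p) (Z p) * fderiv ℝ (hopfFn F N) p (reeb F N p)) =
      jacobiForm F N p (Coord.covDeriv (inducedMetric F) Y p (reeb F N p)) (Z p)
      + jacobiForm F N p (Y p) (Coord.covDeriv (inducedMetric F) Z p (reeb F N p)) := by
    intro Y Z p k hp hY hZ hsm hk hj
    rw [← h.fderiv_jacobiForm_reeb hp.1 hR hY hZ]
    have hev : (fun y => jacobiForm F N y (Y y) (Z y)) =ᶠ[nhds p]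
        fun y => k y + hopfFn F N y * sff F N y (Y y) (Z y) := by
      filter_upwards [h.mem_nhds hp.1] with y hy using hj y hy
    have hsd := hsm.differentiableAt (by simp)
    rw [hev.fderiv_eq]
    exact (DFunLike.congr_fun (hk.hasFDerivAt.add
      ((hα p hp).hasFDerivAt.mul hsd.hasFDerivAt)).fderiv (reeb F N p)).symm
  have hself : ∀ p ∈ U, ∀ z, jacobiForm F N p (-(hopfFn F N p • defectField F N p)) z =
      -(hopfFn F N p * jacobiForm F N p (defectField F N p) z) := by
    intro p _ z
    rw [← jacobiFormCLM_apply, map_neg, map_smul]; rfl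
  have hself' : ∀ p ∈ U, ∀ z, jacobiForm F N p (hopfFn F N p • defectFieldJ F N p) z =
      hopfFn F N p * jacobiForm F N p (defectFieldJ F N p) z := by
    intro p _ z
    rw [← jacobiFormCLM_apply, map_smul]; rfl
  have hself2 : ∀ p ∈ U, ∀ y, jacobiForm F N p y (-(hopfFn F N p • defectField F N p)) =
      -(hopfFn F N p * jacobiForm F N p y (defectField F N p)) := by
    intro p _ z
    rw [← jacobiFormCLM_apply, map_neg, map_smul]; rfl
  have hself2' : ∀ p ∈ U, ∀ y, jacobiForm F N p y (hopfFn F N p • defectFieldJ F N p) =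
      hopfFn F N p * jacobiForm F N p y (defectFieldJ F N p) := by
    intro p _ z
    rw [← jacobiFormCLM_apply, map_smul]; rfl
  have hbJ : ∀ p ∈ U, jacobiForm F N p (defectField F N p) (defectFieldJ F N p) =
      hopfFn F N p * sff F N p (defectFieldJ F N p) (defectField F N p) := by
    intro p hp
    rw [h.jacobiForm_defectField hp hH, h.fderiv_defectFieldJ hp, h.metric_sub_cube_J_defect hp,
      h.sff_symm hp]
    ring
  have hb2 : ∀ p ∈ U, jacobiForm F N p (defectField F N p) (defectField F N p) =
      -f (quart (F p) (N p)) + hopfFn F N p * sff F N p (defectField F N p) (defectField F N p) := by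
    intro p hp
    rw [h.jacobiForm_defectField hp hH, h.fderiv_defectField hp, h.metric_sub_cube_defect hp,
      hfe p hp]
    ring
  refine reeb_system_false hVo (x₀ := x) ⟨hx, hne⟩ (α := hopfFn F N)
    (u := fun p => sff F N p (defectFieldJ F N p) (defectFieldJ F N p))
    (v := fun p => sff F N p (defectField F N p) (defectField F N p))
    (w := fun p => sff F N p (defectFieldJ F N p) (defectField F N p))
    (e := fun p => f (quart (F p) (N p))) (ξ := reeb F N) (β := defectField F N) hα
    (fun p hp => hs hp (h.contDiffAt_defectFieldJ hp.1) (h.contDiffAt_defectFieldJ hp.1))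
    (fun p hp => hs hp (h.contDiffAt_defectFieldJ hp.1) (h.contDiffAt_defectField hp.1))
    (fun p hp => (he p hp).differentiableAt) ?_ heξ ?_
    (fun p hp => h.fderiv_sff_JJ hp.1 hH) ?_ ?_ ?_ ?_
  · intro p hp h0
    have h1 := h.metric_defect_defect_eq hp.1
    have h2 := hbb p hp
    rw [h1] at h2
    simp only [hf] at h0
    rcases mul_eq_zero.1 h0 with h3 | h3
    · exact h2 (by rw [h3]; ring)
    · exact h2 h3
  · intro p hp
    rw [h.fderiv_hopfFn_defectField hp.1 hH]
    exact mul_ne_zero two_ne_zero (hbb p hp)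
  · intro p hp
    rw [h.fderiv_sff_J_defect hp.1 hH, hfe p hp.1]
  · intro p hp
    have h1 := hdj hp (ha p hp) (ha p hp)
      (h.contDiffAt_sff hp.1 (h.contDiffAt_defectFieldJ hp.1) (h.contDiffAt_defectFieldJ hp.1))
      (differentiableAt_const (0 : ℝ))
      fun y hy => by rw [h.jacobiForm_defectFieldJ hy hH, zero_add]
    rw [h.fderiv_sff_JJ hp.1 hH, h.covDeriv_defectFieldJ hp.1 hH, hself p hp.1, hself2 p hp.1,
      hbJ p hp.1, h.jacobiForm_defectFieldJ hp.1 hH] at h1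
    simp only [fderiv_fun_const, Pi.zero_apply, _root_.zero_apply] at h1
    linear_combination h1
  · intro p hp
    have h1 := hdj hp (hb p hp) (hb p hp)
      (h.contDiffAt_sff hp.1 (h.contDiffAt_defectField hp.1) (h.contDiffAt_defectField hp.1))
      (he p hp).differentiableAt.fun_neg hb2
    have h2 : fderiv ℝ (fun y => -f (quart (F y) (N y))) p (reeb F N p) = 0 := by
      have := DFunLike.congr_fun (fderiv_fun_neg (𝕜 := ℝ)
        (f := fun y => f (quart (F y) (N y))) (x := p)) (reeb F N p)
      refine this.trans ?_
      rw [_root_.neg_apply, heξ p hp, neg_zero]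
    rw [h2, h.fderiv_sff_defect_defect hp.1 hH, h.covDeriv_defectField hp.1 hH, hself' p hp.1,
      hself2' p hp.1, hbJ p hp.1, h.jacobiForm_defectFieldJ hp.1 hH] at h1
    linear_combination h1
  · intro p hp
    have h1 := hdj hp (ha p hp) (hb p hp)
      (h.contDiffAt_sff hp.1 (h.contDiffAt_defectFieldJ hp.1) (h.contDiffAt_defectField hp.1))
      (differentiableAt_const (0 : ℝ))
      fun y hy => by rw [h.jacobiForm_defectFieldJ hy hH, zero_add]
    rw [h.fderiv_sff_J_defect hp.1 hH, h.covDeriv_defectFieldJ hp.1 hH,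
      h.covDeriv_defectField hp.1 hH, hself p hp.1, hself2' p hp.1,
      hb2 p hp.1, h.jacobiForm_defectFieldJ hp.1 hH, ← hfe p hp.1] at h1
    simp only [fderiv_fun_const, Pi.zero_apply, _root_.zero_apply] at h1
    linear_combination h1

end Hopf

end IsHypersurfaceOn

end HypQuadric

/-! ### Singular tangent vectors -/

namespace HypQuadric

variable {m : ℕ} {W : Vec m}

theorem commuting_self (W X : Vec m) : Commuting W X X := ⟨rfl, rfl⟩

theorem Commuting.symm {X Y : Vec m} (h : Commuting W X Y) : Commuting W Y X :=
  ⟨h.1.symm, h.2.symm⟩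

theorem Commuting.add_right {X Y Z : Vec m} (h : Commuting W X Y) (h' : Commuting W X Z) :
    Commuting W X (Y + Z) := by
  refine ⟨?_, ?_⟩
  · rw [mat_add, adj_add, Matrix.mul_add, Matrix.add_mul, h.1, h'.1]
  · rw [mat_add, adj_add, Matrix.mul_add, Matrix.add_mul, h.2, h'.2]

theorem Commuting.smul_right {X Y : Vec m} (h : Commuting W X Y) (c : ℝ) :
    Commuting W X (c • Y) := by
  refine ⟨?_, ?_⟩
  · rw [mat_smul, adj_smul, Matrix.mul_smul, Matrix.smul_mul, h.1]
  · rw [mat_smul, adj_smul, Matrix.mul_smul, Matrix.smul_mul, h.2]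

theorem exists_isCartan_of_commuting {X Y : Vec m} (h : Commuting W X Y) :
    ∃ L, IsCartan W L ∧ X ∈ L ∧ Y ∈ L := by
  have hspan : ∀ A ∈ Submodule.span ℝ {X, Y}, ∀ B ∈ Submodule.span ℝ {X, Y}, Commuting W A B := by
    intro A hA B hB
    obtain ⟨a, b, rfl⟩ := Submodule.mem_span_pair.1 hA
    obtain ⟨c, d, rfl⟩ := Submodule.mem_span_pair.1 hB
    have h1 : ∀ Z, Commuting W Z X → Commuting W Z Y → Commuting W Z (a • X + b • Y) :=
      fun Z hX hY => (hX.smul_right a).add_right (hY.smul_right b)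
    exact ((h1 X (commuting_self W X) h).symm.smul_right c).add_right
      ((h1 Y h.symm (commuting_self W Y)).symm.smul_right d)
  obtain ⟨L, hL, hmax⟩ := exists_maximal_ge_of_wellFoundedGT
    (fun L' : Submodule ℝ (Vec m) => ∀ X ∈ L', ∀ Y ∈ L', Commuting W X Y) _ hspan
  exact ⟨L, hmax, hL (Submodule.subset_span (by simp)), hL (Submodule.subset_span (by simp))⟩

/-- A vector is singular if it commutes with two vectors that do not commute. -/
theorem isSingular_of_commuting {n Y₁ Y₂ : Vec m} (hn : n ≠ 0) (h₁ : Commuting W n Y₁)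
    (h₂ : Commuting W n Y₂) (h₁₂ : ¬Commuting W Y₁ Y₂) : IsSingular W n := by
  obtain ⟨L₁, hL₁, hn₁, hY₁⟩ := exists_isCartan_of_commuting h₁
  obtain ⟨L₂, hL₂, hn₂, hY₂⟩ := exists_isCartan_of_commuting h₂
  refine ⟨hn, L₁, L₂, hL₁, hL₂, ?_, hn₁, hn₂⟩
  rintro rfl
  exact h₁₂ (hL₁.1 _ hY₁ _ hY₂)

/-- The tangent vector `n σ`, for a tangent vector `n : P → Pᗮ` and an endomorphism `σ` of `P`. -/
def mulRight (n : Vec m) (σ : Matrix (Fin 2) (Fin 2) ℝ) : Vec m := Matrix.of.symm (mat n * σ)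

theorem mat_mulRight (n : Vec m) (σ : Matrix (Fin 2) (Fin 2) ℝ) :
    mat (mulRight n σ) = mat n * σ := rfl

theorem adj_mulRight (hW : W ∈ domain m) (n : Vec m) (σ : Matrix (Fin 2) (Fin 2) ℝ) :
    adj W (mulRight n σ) = (gram W)⁻¹ * σᵀ * gram W * adj W n := by
  rw [adj, adj, mat_mulRight, Matrix.transpose_mul]
  simp only [Matrix.mul_assoc]
  rw [← Matrix.mul_assoc (gram W) (gram W)⁻¹, gram_mul_inv hW, Matrix.one_mul]

theorem metric_mulRight (hW : W ∈ domain m) (n : Vec m) (σ τ : Matrix (Fin 2) (Fin 2) ℝ) :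
    metric W (mulRight n σ) (mulRight n τ) =
      ((gram W)⁻¹ * σᵀ * gram W * sq W n * τ).trace := by
  rw [metric_apply, adj_mulRight hW, mat_mulRight, sq]
  simp only [Matrix.mul_assoc]

theorem ne_zero_of_metric_eq_one {n : Vec m} (hn : metric W n n = 1) : n ≠ 0 := by
  rintro rfl
  simp at hn

/-- A reflection of the plane `P` that is orthogonal for the form `G`. -/
theorem exists_reflection (hW : W ∈ domain m) : ∃ r : Matrix (Fin 2) (Fin 2) ℝ,
    (gram W)⁻¹ * rᵀ * gram W = r ∧ r * r = 1 ∧ r.trace = 0 := by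
  obtain ⟨C, hC, hG⟩ := exists_eq_transpose_mul_self (gram_posDef hW)
  have hC' : IsUnit (Cᵀ).det := by rwa [Matrix.det_transpose]
  have h1 : C * C⁻¹ = 1 := Matrix.mul_nonsing_inv _ hC
  have h2 : (Cᵀ)⁻¹ * Cᵀ = 1 := Matrix.nonsing_inv_mul _ hC'
  have hD : !![(1 : ℝ), 0; 0, -1] * !![1, 0; 0, -1] = 1 := by
    ext i j; fin_cases i <;> fin_cases j <;> simp
  have hDt : (!![(1 : ℝ), 0; 0, -1])ᵀ = !![1, 0; 0, -1] := by
    ext i j; fin_cases i <;> fin_cases j <;> simp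
  refine ⟨C⁻¹ * !![1, 0; 0, -1] * C, ?_, ?_, ?_⟩
  · rw [hG, Matrix.mul_inv_rev, Matrix.transpose_mul, Matrix.transpose_mul, hDt,
      Matrix.transpose_nonsing_inv]
    simp only [Matrix.mul_assoc]
    rw [← Matrix.mul_assoc (Cᵀ)⁻¹ Cᵀ, h2, Matrix.one_mul, ← Matrix.mul_assoc (Cᵀ)⁻¹ Cᵀ, h2,
      Matrix.one_mul]
  · simp only [Matrix.mul_assoc]
    rw [← Matrix.mul_assoc C C⁻¹, h1, Matrix.one_mul, ← Matrix.mul_assoc !![1, 0; 0, -1], hD,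
      Matrix.one_mul, Matrix.nonsing_inv_mul _ hC]
  · rw [Matrix.mul_assoc, Matrix.trace_mul_comm, Matrix.mul_assoc, h1, Matrix.mul_one]
    simp [Matrix.trace_fin_two]

/-- A `G`-symmetric involution of trace zero is a reflection. -/
theorem mulRight_mem_conjugations (hW : W ∈ domain m) {r : Matrix (Fin 2) (Fin 2) ℝ}
    (hr : (gram W)⁻¹ * rᵀ * gram W = r) (hrr : r * r = 1) (htr : r.trace = 0) :
    (fun X => mulRight X r) ∈ conjugations W := by
  refine ⟨r, ?_, ?_, rfl⟩
  · have h1 : rᵀ * gram W = gram W * r := by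
      nth_rewrite 2 [← hr]
      rw [← Matrix.mul_assoc, ← Matrix.mul_assoc, gram_mul_inv hW, Matrix.one_mul]
    rw [h1, Matrix.mul_assoc, hrr, Matrix.mul_one]
  · have h1 := congrFun (congrFun hrr 0) 0
    rw [Matrix.trace_fin_two] at htr
    simp only [Matrix.mul_apply, Fin.sum_univ_two, Matrix.one_apply_eq] at h1
    rw [Matrix.det_fin_two]
    linear_combination r 0 0 * htr - h1

theorem reflection_mul_jMat (hW : W ∈ domain m) {r : Matrix (Fin 2) (Fin 2) ℝ}
    (hr : (gram W)⁻¹ * rᵀ * gram W = r) (htr : r.trace = 0) : jMat W * r = -(r * jMat W) := by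
  have h := gram_adjoint hW r
  rw [hr, htr, zero_smul, zero_add] at h
  nth_rewrite 1 [h]
  rw [← Matrix.mul_assoc, ← Matrix.mul_assoc, jMat_mul_self hW]
  simp

section Isotropic

variable {n : Vec m}

theorem sq_eq_of_quart_eq_half (hn : metric W n n = 1) (hd : defect W n = 0) (hq : quart W n = 1 / 2) :
    sq W n = (1 / 2 : ℝ) • (1 : Matrix (Fin 2) (Fin 2) ℝ) := by
  have h1 : cube W n = (1 / 2 : ℝ) • n := by
    rw [cube_eq, hd, hq, zero_add]
  have h2 : sq W n * sq W n = (1 / 2 : ℝ) • sq W n := by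
    have := congrArg (fun X => adj W n * mat X) h1
    simp only [cube, mat_triple, mat_smul, Matrix.mul_smul] at this
    change adj W n * mat n * (adj W n * mat n) = (1 / 2 : ℝ) • (adj W n * mat n)
    rw [← this]
    simp only [Matrix.mul_assoc]
  have h3 := sq_mul_sq hn
  rw [h2, hq] at h3
  have h4 : sq W n = (2 : ℝ) • (sq W n - (1 / 2 : ℝ) • sq W n) := by module
  rw [h4]
  conv_lhs => rw [h3]
  module

theorem isIsotropic_of_quart_eq_half (hW : W ∈ domain m) (hn : metric W n n = 1)
    (hd : defect W n = 0) (hq : quart W n = 1 / 2) :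
    IsIsotropic W n := by
  have hM := sq_eq_of_quart_eq_half hn hd hq
  obtain ⟨r, hr, hrr, htr⟩ := exists_reflection hW
  have hjr := reflection_mul_jMat hW hr htr
  have hjj := jMat_mul_self hW
  have hdag1 : (gram W)⁻¹ * (1 + r)ᵀ * gram W = 1 + r := by
    rw [Matrix.transpose_add, Matrix.transpose_one, Matrix.mul_add, Matrix.add_mul, hr,
      Matrix.mul_one, gram_inv_mul hW]
  have hdag2 : (gram W)⁻¹ * ((1 - r) * jMat W)ᵀ * gram W = -(jMat W * (1 - r)) := by
    rw [gram_adjoint hW, Matrix.mul_assoc, Matrix.mul_assoc, hjj]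
    simp [Matrix.sub_mul, jMat_trace, Matrix.trace_sub]
    have h1 := congrArg Matrix.trace hjr
    rw [Matrix.trace_mul_comm, Matrix.trace_neg] at h1
    have h2 : (r * jMat W).trace = 0 := by linarith
    rw [h2, zero_smul, neg_zero, zero_add, ← Matrix.mul_neg, neg_sub]
  have h11 : (1 + r) * (1 + r) = (2 : ℝ) • (1 + r) := by
    rw [Matrix.add_mul, Matrix.mul_add, Matrix.one_mul, Matrix.mul_add, hrr]
    simp only [Matrix.mul_one, Matrix.one_mul]
    module
  have h22 : (1 - r) * (1 - r) = (2 : ℝ) • (1 - r) := by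
    rw [Matrix.sub_mul, Matrix.mul_sub, Matrix.one_mul, Matrix.mul_sub, hrr]
    simp only [Matrix.mul_one, Matrix.one_mul]
    module
  have h12 : (1 + r) * (1 - r) = 0 := by
    rw [Matrix.add_mul, Matrix.mul_sub, Matrix.one_mul, Matrix.mul_sub, hrr]
    simp only [Matrix.mul_one, Matrix.one_mul]
    abel
  have hs2 : Real.sqrt 2 * Real.sqrt 2 = 2 := Real.mul_self_sqrt (by norm_num)
  have hs0 : Real.sqrt 2 ≠ 0 := by positivity
  have htr1 : (1 + r).trace = 2 := by simp [Matrix.trace_add, htr]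
  have htr2 : (1 - r).trace = 2 := by simp [Matrix.trace_sub, htr]
  refine ⟨ne_zero_of_metric_eq_one hn, _, mulRight_mem_conjugations hW hr hrr htr,
    (Real.sqrt 2 / 2) • mulRight n (1 + r), -((Real.sqrt 2 / 2) • mulRight n ((1 - r) * jMat W)),
    ?_, ?_, ?_, ?_, ?_, ?_⟩
  · apply mat_injective
    simp only [mat_mulRight, mat_smul, Matrix.smul_mul, Matrix.mul_assoc, Matrix.add_mul, hrr,
      Matrix.one_mul, add_comm]
  · apply mat_injective
    simp only [mat_mulRight, mat_smul, mat_neg, Matrix.smul_mul, Matrix.neg_mul, Matrix.mul_assoc,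
      hjr, Matrix.mul_neg]
    rw [← Matrix.mul_assoc (1 - r) r, Matrix.sub_mul, hrr, Matrix.one_mul,
      ← neg_sub (1 : Matrix (Fin 2) (Fin 2) ℝ) r, Matrix.neg_mul, Matrix.mul_neg, smul_neg, neg_neg, smul_neg]
  · rw [metric_smul_left, map_smul, metric_mulRight hW, hdag1, hM, Matrix.mul_smul, Matrix.mul_one,
      Matrix.smul_mul, h11, Matrix.trace_smul, Matrix.trace_smul, htr1]
    simp only [smul_eq_mul]
    linear_combination hs2 / 2
  · rw [metric_neg_left, map_neg, neg_neg, metric_smul_left, map_smul, metric_mulRight hW, hdag2,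
      hM, Matrix.mul_smul, Matrix.mul_one, Matrix.smul_mul, Matrix.neg_mul, Matrix.mul_assoc,
      ← Matrix.mul_assoc (1 - r), h22, Matrix.trace_smul, Matrix.trace_neg, Matrix.trace_mul_comm,
      Matrix.mul_assoc, hjj, Matrix.mul_neg, Matrix.mul_one, Matrix.trace_neg, Matrix.trace_smul,
      htr2]
    simp only [smul_eq_mul]
    linear_combination hs2 / 2
  · rw [map_neg, metric_smul_left, map_smul, metric_mulRight hW, hdag1, hM, Matrix.mul_smul,
      Matrix.mul_one, Matrix.smul_mul, ← Matrix.mul_assoc, h12]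
    simp
  · rw [hn, Real.sqrt_one, inv_one, one_smul, J_neg, J_smul]
    apply mat_injective
    simp only [mat_smul, mat_add, mat_neg, mat_mulRight, mat_J, Matrix.mul_assoc, hjj]
    have e : (Real.sqrt 2)⁻¹ * (Real.sqrt 2 / 2) = 1 / 2 := by field_simp
    simp only [Matrix.mul_add, Matrix.mul_sub, Matrix.mul_neg, Matrix.mul_one, smul_add, smul_sub, smul_neg, smul_smul, e]
    module

theorem isSingular_of_quart_eq_half (hW : W ∈ domain m) (hn : metric W n n = 1)
    (hd : defect W n = 0) (hq : quart W n = 1 / 2) :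
    IsSingular W n := by
  have hM := sq_eq_of_quart_eq_half hn hd hq
  obtain ⟨r, hr, hrr, htr⟩ := exists_reflection hW
  have hjr := reflection_mul_jMat hW hr htr
  have hjj := jMat_mul_self hW
  have hdag : (gram W)⁻¹ * (r * jMat W)ᵀ * gram W = r * jMat W := by
    have h1 := congrArg Matrix.trace hjr
    rw [Matrix.trace_mul_comm, Matrix.trace_neg] at h1
    have h2 : (r * jMat W).trace = 0 := by linarith
    rw [gram_adjoint hW, h2, Matrix.mul_assoc, Matrix.mul_assoc, hjj, zero_smul, zero_add,
      Matrix.mul_neg, Matrix.mul_one, Matrix.mul_neg, hjr, neg_neg]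
  have hcomm : ∀ B : Matrix (Fin 2) (Fin 2) ℝ, (gram W)⁻¹ * Bᵀ * gram W = B →
      Commuting W n (mulRight n B) := by
    intro B hB
    refine ⟨?_, ?_⟩
    · rw [adj_mulRight hW, hB, mat_mulRight, Matrix.mul_assoc, ← Matrix.mul_assoc (adj W n), ← sq,
        hM, Matrix.smul_mul, Matrix.mul_smul, Matrix.mul_one, Matrix.one_mul]
    · rw [adj_mulRight hW, hB, mat_mulRight, Matrix.mul_assoc]
  refine isSingular_of_commuting (ne_zero_of_metric_eq_one hn) (hcomm r hr) (hcomm _ hdag) ?_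
  rintro ⟨h1, -⟩
  rw [adj_mulRight hW, hr, adj_mulRight hW, hdag, mat_mulRight, mat_mulRight] at h1
  have h2 : r * (sq W n * (r * jMat W)) = r * jMat W * (sq W n * r) := by
    rw [sq]
    simpa only [Matrix.mul_assoc] using h1
  rw [hM, Matrix.smul_mul, Matrix.one_mul, Matrix.smul_mul, Matrix.one_mul, Matrix.mul_smul,
    Matrix.mul_smul, Matrix.mul_assoc, hjr, Matrix.mul_neg, ← Matrix.mul_assoc, hrr,
    Matrix.one_mul] at h2
  have h3 : jMat W = 0 := by
    have h4 : jMat W = (1 / 2 : ℝ) • jMat W - (1 / 2 : ℝ) • -jMat W := by module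
    rw [h4, h2, sub_self]
  have h5 := hjj
  rw [h3, Matrix.mul_zero] at h5
  have h6 := congrFun (congrFun h5 0) 0
  simp at h6

end Isotropic

section Principal

variable {n : Vec m}

theorem isPrincipal_of_quart_eq_one (hW : W ∈ domain m) (hn : metric W n n = 1)
    (hd : defect W n = 0) (hq : quart W n = 1) :
    IsPrincipal W n := by
  have h1 : cube W n = n := by rw [cube_eq, hd, hq, zero_add, one_smul]
  have hM := sq_mul_sq hn
  rw [hq, sub_self, zero_div, zero_smul, sub_zero] at hM
  refine ⟨ne_zero_of_metric_eq_one hn, _, mulRight_mem_conjugations hW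
    (r := (2 : ℝ) • sq W n - 1) ?_ ?_ ?_, ?_⟩
  · rw [Matrix.transpose_sub, Matrix.transpose_smul, Matrix.transpose_one, Matrix.mul_sub,
      Matrix.sub_mul, Matrix.mul_smul, Matrix.smul_mul, sq_adjoint hW, Matrix.mul_one,
      gram_inv_mul hW]
  · simp only [Matrix.mul_sub, Matrix.sub_mul, Matrix.mul_smul, Matrix.smul_mul, hM, Matrix.mul_one,
      Matrix.one_mul]
    module
  · simp [Matrix.trace_sub, Matrix.trace_smul, trace_sq hn]
  · apply mat_injective
    have h2 : mat n * sq W n = mat n := by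
      conv_rhs => rw [← h1]
      rw [cube, mat_triple, sq, Matrix.mul_assoc]
    rw [mat_mulRight, Matrix.mul_sub, Matrix.mul_smul, h2, Matrix.mul_one]
    module

theorem isSingular_of_quart_eq_one (hm : 3 ≤ m) (hW : W ∈ domain m) (hn : metric W n n = 1)
    (hd : defect W n = 0) (hq : quart W n = 1) :
    IsSingular W n := by
  have h1 : cube W n = n := by rw [cube_eq, hd, hq, zero_add, one_smul]
  have h2 : sq W n * adj W n = adj W n := by
    conv_rhs => rw [← h1]
    rw [cube, adj_triple, sq]
  -- `n^* n` is a projection onto a line, so that the kernel of `n^*` is a hyperplane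
  have hne : sq W n ≠ 1 := by
    intro h
    have := trace_sq hn
    rw [h] at this
    simp at this
  -- a row vector annihilating `n^*`
  obtain ⟨k, hk⟩ : ∃ k, (1 - sq W n) k ≠ 0 := by
    by_contra! h
    apply hne
    have : 1 - sq W n = 0 := by ext i j; rw [h i]; rfl
    exact (sub_eq_zero.1 this).symm
  set f := (1 - sq W n) k with hf
  have hfn : f ᵥ* adj W n = 0 := by
    have h3 : (1 - sq W n) * adj W n = 0 := by
      rw [Matrix.sub_mul, Matrix.one_mul, h2, sub_self]
    have h4 := congrFun h3 k
    rw [Matrix.mul_apply_eq_vecMul] at h4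
    exact h4
  have hrk : (adj W n).rank ≤ 1 := by
    have h3 := LinearMap.finrank_range_add_finrank_ker (adj W n)ᵀ.mulVecLin
    rw [← Matrix.rank, Matrix.rank_transpose] at h3
    have h4 : 0 < Module.finrank ℝ (LinearMap.ker (adj W n)ᵀ.mulVecLin) :=
      Module.finrank_pos_iff_exists_ne_zero.2
        ⟨⟨f, by simp [hfn]⟩, fun h => hk (congrArg Subtype.val h)⟩
    simp at h3
    omega
  have hker : 1 < Module.finrank ℝ (LinearMap.ker (adj W n).mulVecLin) := by
    have h3 := LinearMap.finrank_range_add_finrank_ker (adj W n).mulVecLin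
    rw [← Matrix.rank] at h3
    simp at h3
    omega
  obtain ⟨y₁, hy₁⟩ := Module.finrank_pos_iff_exists_ne_zero.1 (zero_lt_one.trans hker)
  obtain ⟨y₂, hy₂⟩ := exists_linearIndependent_pair_of_one_lt_finrank hker hy₁
  have hcomm : ∀ y : LinearMap.ker (adj W n).mulVecLin,
      Commuting W n (Matrix.of.symm (Matrix.vecMulVec (y : Fin m → ℝ) f)) := by
    intro y
    have hy : adj W n *ᵥ (y : Fin m → ℝ) = 0 := y.2
    have e1 : adj W n * Matrix.vecMulVec (y : Fin m → ℝ) f = 0 := by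
      rw [Matrix.mul_vecMulVec, hy, Matrix.zero_vecMulVec]
    have e2 : Matrix.vecMulVec (y : Fin m → ℝ) f * adj W n = 0 := by
      rw [Matrix.vecMulVec_mul, hfn, Matrix.vecMulVec_zero]
    set Y : Vec m := Matrix.of.symm (Matrix.vecMulVec (y : Fin m → ℝ) f) with hY
    have e3 : mat Y = Matrix.vecMulVec (y : Fin m → ℝ) f := rfl
    rw [← e3] at e1 e2
    refine ⟨?_, ?_⟩
    · have e4 : adj W Y * mat n = (gram W)⁻¹ * (adj W n * mat Y)ᵀ * gram W := by
        rw [Matrix.transpose_mul, adj_transpose, adj]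
        simp only [Matrix.mul_assoc, gram_inv_mul hW, Matrix.mul_one]
      rw [e4, e1]; simp
    · have e4 : mat n * adj W Y = cogram W * (mat Y * adj W n)ᵀ * (cogram W)⁻¹ := by
        rw [Matrix.transpose_mul, adj_transpose, adj]
        simp only [← Matrix.mul_assoc, cogram_mul_inv hW, Matrix.one_mul]
      rw [e4, e2]; simp
  refine isSingular_of_commuting (ne_zero_of_metric_eq_one hn) (hcomm y₁) (hcomm y₂) ?_
  rintro ⟨-, h3⟩
  have hc : 0 < f ⬝ᵥ ((gram W)⁻¹ *ᵥ f) := by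
    have := (gram_posDef hW).inv.dotProduct_mulVec_pos hk
    simpa using this
  have e1 : ∀ y z : Fin m → ℝ, mat (Matrix.of.symm (Matrix.vecMulVec y f)) *
      adj W (Matrix.of.symm (Matrix.vecMulVec z f)) * cogram W =
      (f ⬝ᵥ ((gram W)⁻¹ *ᵥ f)) • Matrix.vecMulVec y z := by
    intro y z
    rw [adj, mat_of, mat_of, Matrix.mul_assoc, Matrix.mul_assoc _ _ (cogram W), cogram_inv_mul hW,
      Matrix.mul_one, Matrix.transpose_vecMulVec, Matrix.mul_vecMulVec, Matrix.vecMulVec_mul_vecMulVec]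
    ext i j
    simp [Matrix.vecMulVec_apply, mul_comm]
    ring
  have h4 := congrArg (· * cogram W) h3
  simp only [e1] at h4
  have h5 : Matrix.vecMulVec (y₁ : Fin m → ℝ) (y₂ : Fin m → ℝ) = Matrix.vecMulVec y₂ y₁ :=
    smul_right_injective _ hc.ne' h4
  rw [LinearIndependent.pair_iff] at hy₂
  apply hy₁
  ext j
  have h6 := hy₂ ((y₂ : Fin m → ℝ) j) (-(y₁ : Fin m → ℝ) j) (by
    ext i
    have := congrFun (congrFun h5 i) j
    simp only [Matrix.vecMulVec_apply] at this
    simp only [Submodule.coe_add, Submodule.coe_smul, Pi.add_apply, Pi.smul_apply, smul_eq_mul]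
    simp
    linear_combination this)
  simpa using h6.2

end Principal

/-- A unit vector without defect has `quart = 1 / 2` or `quart = 1`. -/
theorem quart_eq_of_defect_eq_zero {n : Vec m} (hn : metric W n n = 1) (hd : defect W n = 0) :
    quart W n = 1 / 2 ∨ quart W n = 1 := by
  have h1 := metric_defect_defect hn
  rw [hd, map_zero] at h1
  have h2 : (2 * quart W n - 1) * (1 - quart W n) = 0 := by linarith
  rcases mul_eq_zero.1 h2 with h | h
  · left; linarith
  · right; linarith

end HypQuadric

/-! ### Unit normal vectors of a hypersurface -/

namespace HypQuadric

section Normal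

variable {m : ℕ} {E : Type*} [NormedAddCommGroup E] [NormedSpace ℝ E]

theorem exists_isUnitNormal [FiniteDimensional ℝ E] {W : Vec m} (hW : W ∈ domain m)
    (hE : Module.finrank ℝ E + 1 = 2 * m) (T : E →L[ℝ] Vec m) : ∃ n, IsUnitNormal W T n := by
  let Φ : Vec m →ₗ[ℝ] Module.Dual ℝ E :=
    (Module.Dual.transpose (R := ℝ) T.toLinearMap).comp
      ((ContinuousLinearMap.coeLM ℝ).comp (metric W).toLinearMap)
  have hlt : Module.finrank ℝ (Module.Dual ℝ E) < Module.finrank ℝ (Vec m) := by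
    rw [Subspace.dual_finrank_eq, finrank_vec]; omega
  obtain ⟨X, hX, hX0⟩ := Submodule.exists_mem_ne_zero_of_ne_bot
    (LinearMap.ker_ne_bot_of_finrank_lt (f := Φ) hlt)
  have hpos := metric_self_pos hW hX0
  refine ⟨(Real.sqrt (metric W X X))⁻¹ • X, ?_, fun u => ?_⟩
  · rw [metric_smul_left, map_smul, smul_eq_mul, ← mul_assoc, ← mul_inv,
      Real.mul_self_sqrt hpos.le, inv_mul_cancel₀ hpos.ne']
  · have h1 : metric W X (T u) = 0 := LinearMap.congr_fun hX u
    rw [metric_smul_left, h1, mul_zero]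

/-- A unit normal vector extends to a local unit normal vector field: remove from the constant
field its tangential part, and normalize. -/
theorem exists_isHypersurfaceOn [FiniteDimensional ℝ E] (hE : Module.finrank ℝ E + 1 = 2 * m)
    {F : E → Vec m} {V : Set E} (hV : IsOpen V) (hF : ContDiffOn ℝ ∞ F V)
    (hdom : ∀ y ∈ V, F y ∈ domain m) (hinj : ∀ y ∈ V, Function.Injective (fderiv ℝ F y))
    {x : E} (hx : x ∈ V) {n : Vec m} (hn : IsUnitNormal (F x) (fderiv ℝ F x) n) :
    ∃ U ⊆ V, ∃ N : E → Vec m, x ∈ U ∧ N x = n ∧ IsHypersurfaceOn F N U := by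
  let φ : E → E →L[ℝ] ℝ := fun y => (metric (F y) n).comp (fderiv ℝ F y)
  let N₀ : E → Vec m := fun y => n - fderiv ℝ F y ((inducedMetric F y).inverse (φ y))
  have hFx : ∀ y ∈ V, ContDiffAt ℝ ∞ F y := fun y hy => hF.contDiffAt (hV.mem_nhds hy)
  have hdF : ∀ y ∈ V, ContDiffAt ℝ ∞ (fderiv ℝ F) y := fun y hy =>
    (hFx y hy).fderiv_right (by simp)
  have hgi : ∀ y ∈ V, Function.Injective (inducedMetric F y) := fun y hy =>
    inducedMetric_injective (hdom y hy) (hinj y hy)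
  have hg : ∀ y ∈ V, ContDiffAt ℝ ∞ (inducedMetric F) y := fun y hy =>
    contDiffAt_inducedMetric (hFx y hy) (hdom y hy)
  have hφ : ∀ y ∈ V, ContDiffAt ℝ ∞ φ y := fun y hy =>
    contDiffAt_clm_of_apply fun _ => contDiffAt_metric (hFx y hy) (hdom y hy) contDiffAt_const
      ((hdF y hy).clm_apply contDiffAt_const)
  have hN₀ : ∀ y ∈ V, ContDiffAt ℝ ∞ N₀ y := fun y hy =>
    contDiffAt_const.sub ((hdF y hy).clm_apply
      (Coord.contDiffAt_inverse_apply (hg y hy) (hφ y hy) (hgi y hy)))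
  have horth : ∀ y ∈ V, ∀ u, metric (F y) (N₀ y) (fderiv ℝ F y u) = 0 := by
    intro y hy u
    obtain ⟨e, he⟩ := Coord.isInvertible_of_injective (hgi y hy)
    have h1 : inducedMetric F y ((inducedMetric F y).inverse (φ y)) u = φ y u := by
      rw [← he]; simp
    rw [inducedMetric_apply] at h1
    rw [metric_sub_left, h1]
    exact sub_self _
  have hN₀x : N₀ x = n := by
    have h1 : φ x = 0 := ContinuousLinearMap.ext fun u => hn.2 u
    simp only [N₀, h1, map_zero, sub_zero]
  let q : E → ℝ := fun y => metric (F y) (N₀ y) (N₀ y)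
  have hq : ∀ y ∈ V, ContDiffAt ℝ ∞ q y := fun y hy =>
    contDiffAt_metric (hFx y hy) (hdom y hy) (hN₀ y hy) (hN₀ y hy)
  have hqx : q x = 1 := by simp only [q, hN₀x]; exact hn.1
  refine ⟨V ∩ q ⁻¹' Set.Ioi 0, Set.inter_subset_left, fun y => (Real.sqrt (q y))⁻¹ • N₀ y,
    ⟨hx, ?_⟩, ?_, ?_⟩
  · rw [Set.mem_preimage, hqx]; exact Set.mem_Ioi.2 one_pos
  · simp only [hqx, Real.sqrt_one, inv_one, one_smul, hN₀x]
  · refine ⟨ContinuousOn.isOpen_inter_preimage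
      (fun y hy => (hq y hy).continuousAt.continuousWithinAt) hV isOpen_Ioi, hE,
      fun y hy => hdom y hy.1, hF.mono Set.inter_subset_left, fun y hy => hinj y hy.1, ?_, ?_⟩
    · intro y hy
      exact ((((hq y hy.1).sqrt hy.2.ne').inv (Real.sqrt_pos.2 hy.2).ne').smul
        (hN₀ y hy.1)).contDiffWithinAt
    · rintro y ⟨hy, hpos : 0 < q y⟩
      refine ⟨?_, fun u => ?_⟩
      · rw [metric_smul_left, map_smul, smul_eq_mul, ← mul_assoc, ← mul_inv,
          Real.mul_self_sqrt hpos.le]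
        exact inv_mul_cancel₀ hpos.ne'
      · rw [metric_smul_left, horth y hy, mul_zero]

theorem IsHypersurfaceOn.eq_or_eq_neg_normal {F N : E → Vec m} {U : Set E}
    (h : IsHypersurfaceOn F N U) {x : E} (hx : x ∈ U) {n : Vec m}
    (hn : IsUnitNormal (F x) (fderiv ℝ F x) n) : n = N x ∨ n = -N x := by
  set a := metric (F x) (N x) n with ha
  have h1 : metric (F x) (N x) (n - a • N x) = 0 := by
    rw [map_sub, map_smul, h.metric_normal hx, ← ha]; simp
  obtain ⟨z, hz⟩ := h.exists_fderiv_eq hx h1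
  have h2 : metric (F x) (n - a • N x) (n - a • N x) = 0 := by
    rw [metric_sub_left, metric_smul_left, h1, ← hz, hn.2, mul_zero, sub_zero]
  have h3 := sub_eq_zero.1 ((metric_self_eq_zero (h.mem_domain x hx)).1 h2)
  have h4 := hn.1
  rw [h3, metric_smul_left, map_smul, h.metric_normal hx, smul_eq_mul, mul_one] at h4
  rcases mul_self_eq_one_iff.1 h4 with h5 | h5
  · left; rw [h3, h5, one_smul]
  · right; rw [h3, h5, neg_one_smul]

theorem quart_neg (W n : Vec m) : quart W (-n) = quart W n := by
  simp only [quart, cube, triple, metric_apply, adj_neg, mat_neg, Matrix.neg_mul, Matrix.mul_neg,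
    neg_neg]
  rw [show Matrix.of.symm (-(mat n * adj W n * mat n)) =
    -Matrix.of.symm (mat n * adj W n * mat n) from rfl, adj_neg, Matrix.neg_mul, neg_neg]

end Normal

/-! ### From coordinates to the manifold -/

section Manifold

variable {m : ℕ} {M : Type*} [TopologicalSpace M]
  [ChartedSpace (EuclideanSpace ℝ (Fin (2 * m - 1))) M]
  [IsManifold 𝓘(ℝ, EuclideanSpace ℝ (Fin (2 * m - 1))) ∞ M] {f : M → Vec m}

theorem finrank_model (hm : 3 ≤ m) :
    Module.finrank ℝ (EuclideanSpace ℝ (Fin (2 * m - 1))) + 1 = 2 * m := by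
  rw [finrank_euclideanSpace_fin]; omega

namespace IsRealHypersurface

variable (hf : IsRealHypersurface f)
  {c : OpenPartialHomeomorph M (EuclideanSpace ℝ (Fin (2 * m - 1)))}
  (hc : c ∈ atlas (EuclideanSpace ℝ (Fin (2 * m - 1))) M)
include hf hc

theorem contDiffOn_comp_symm : ContDiffOn ℝ ∞ (f ∘ c.symm) c.target :=
  contMDiffOn_iff_contDiffOn.1 (hf.2.1.comp_contMDiffOn
    (contMDiffOn_symm_of_mem_maximalAtlas (IsManifold.subset_maximalAtlas hc)))

/-- The differential of `f`, read in a chart at one of its points. -/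
theorem exists_fderiv_comp_symm {x : EuclideanSpace ℝ (Fin (2 * m - 1))} (hx : x ∈ c.target) :
    ∃ L : EuclideanSpace ℝ (Fin (2 * m - 1)) →L[ℝ] EuclideanSpace ℝ (Fin (2 * m - 1)),
      Function.Bijective L ∧ ∀ v, fderiv ℝ (f ∘ c.symm) x v =
        mfderiv 𝓘(ℝ, EuclideanSpace ℝ (Fin (2 * m - 1))) 𝓘(ℝ, Vec m) f (c.symm x) (L v) := by
  have : IsManifold 𝓘(ℝ, EuclideanSpace ℝ (Fin (2 * m - 1))) 1 M :=
    IsManifold.of_le (n := ∞) (by simp)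
  have hd := mdifferentiable_of_mem_atlas (I := 𝓘(ℝ, EuclideanSpace ℝ (Fin (2 * m - 1)))) hc
  refine ⟨mfderiv 𝓘(ℝ, EuclideanSpace ℝ (Fin (2 * m - 1)))
    𝓘(ℝ, EuclideanSpace ℝ (Fin (2 * m - 1))) c.symm x, hd.symm.mfderiv_bijective hx, ?_⟩
  intro v
  rw [← mfderiv_eq_fderiv]
  exact DFunLike.congr_fun (mfderiv_comp x ((hf.2.1 _).mdifferentiableAt (by simp))
    (hd.symm.mdifferentiableAt hx)) v

theorem fderiv_comp_symm_injective {x : EuclideanSpace ℝ (Fin (2 * m - 1))} (hx : x ∈ c.target) :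
    Function.Injective (fderiv ℝ (f ∘ c.symm) x) := by
  obtain ⟨L, hL, h⟩ := hf.exists_fderiv_comp_symm hc hx
  intro u v huv
  rw [h, h] at huv
  exact hL.1 (hf.2.2 _ huv)

theorem isUnitNormal_comp_symm_iff {x : EuclideanSpace ℝ (Fin (2 * m - 1))} (hx : x ∈ c.target)
    {n : Vec m} : IsUnitNormal ((f ∘ c.symm) x) (fderiv ℝ (f ∘ c.symm) x) n ↔
      IsUnitNormalAt f (c.symm x) n := by
  obtain ⟨L, hL, h⟩ := hf.exists_fderiv_comp_symm hc hx
  refine and_congr_right fun _ => ⟨fun h1 u => ?_, fun h1 v => ?_⟩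
  · obtain ⟨v, hv⟩ := hL.2 u
    have h2 := h1 v
    rw [h, hv] at h2
    exact h2
  · rw [h]
    exact h1 (L v)

omit hc in
/-- Near `p`, the hypersurface has a parametrization with a unit normal vector field that extends a
given unit normal vector `n` at `p`. -/
theorem exists_isHypersurfaceOn_chartAt (hm : 3 ≤ m) {p : M} {n : Vec m}
    (hn : IsUnitNormalAt f p n) :
    ∃ U ⊆ (chartAt (EuclideanSpace ℝ (Fin (2 * m - 1))) p).target, ∃ N,
      chartAt (EuclideanSpace ℝ (Fin (2 * m - 1))) p p ∈ U ∧
      N (chartAt (EuclideanSpace ℝ (Fin (2 * m - 1))) p p) = n ∧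
      IsHypersurfaceOn (f ∘ (chartAt (EuclideanSpace ℝ (Fin (2 * m - 1))) p).symm) N U := by
  have hc := chart_mem_atlas (EuclideanSpace ℝ (Fin (2 * m - 1))) p
  have hp := mem_chart_source (EuclideanSpace ℝ (Fin (2 * m - 1))) p
  set c := chartAt (EuclideanSpace ℝ (Fin (2 * m - 1))) p
  refine exists_isHypersurfaceOn (finrank_model hm) c.open_target (hf.contDiffOn_comp_symm hc)
    (fun y _ => hf.1 _) (fun y hy => hf.fderiv_comp_symm_injective hc hy) (c.map_source hp) ?_
  rw [hf.isUnitNormal_comp_symm_iff hc (c.map_source hp), c.left_inv hp]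
  exact hn

end IsRealHypersurface

theorem IsRealHypersurface.defect_eq_zero (hf : IsRealHypersurface f) (hm : 3 ≤ m)
    (hHopf : IsHopf f) (hReeb : HasReebParallelJacobi f) {p : M} {n : Vec m}
    (hn : IsUnitNormalAt f p n) : defect (f p) n = 0 := by
  obtain ⟨U, hU, N, hp, hN, h⟩ := hf.exists_isHypersurfaceOn_chartAt hm hn
  have hc := chart_mem_atlas (EuclideanSpace ℝ (Fin (2 * m - 1))) p
  have h1 := h.defect_eq_zero hp (hHopf _ hc U h.isOpen hU N h.normal)
    (hReeb _ hc U h.isOpen hU N h.normal)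
  rwa [hN, Function.comp_apply, OpenPartialHomeomorph.left_inv _ (mem_chart_source _ p)] at h1

/-- If `quart` takes only the values `1 / 2` and `1` on the unit normal vectors, then it is locally
constant, by continuity. -/
theorem IsRealHypersurface.eventually_quart_eq (hf : IsRealHypersurface f) (hm : 3 ≤ m)
    (hval : ∀ p n, IsUnitNormalAt f p n → quart (f p) n = 1 / 2 ∨ quart (f p) n = 1)
    {p : M} {n : Vec m} (hn : IsUnitNormalAt f p n) :
    ∀ᶠ p' in nhds p, ∀ n', IsUnitNormalAt f p' n' → quart (f p') n' = quart (f p) n := by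
  obtain ⟨U, hU, N, hp, hN, h⟩ := hf.exists_isHypersurfaceOn_chartAt hm hn
  have hc := chart_mem_atlas (EuclideanSpace ℝ (Fin (2 * m - 1))) p
  have hps := mem_chart_source (EuclideanSpace ℝ (Fin (2 * m - 1))) p
  set c := chartAt (EuclideanSpace ℝ (Fin (2 * m - 1))) p
  have hcont : ContinuousAt (fun y => quart ((f ∘ c.symm) y) (N y)) (c p) :=
    (contDiffAt_metric (h.contDiffAt hp) (h.mem_domain _ hp)
      (contDiffAt_triple (h.contDiffAt hp) (h.mem_domain _ hp) (h.contDiffAt_normal hp)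
        (h.contDiffAt_normal hp) (h.contDiffAt_normal hp)) (h.contDiffAt_normal hp)).continuousAt
  have hcp : ContinuousAt c p := c.continuousAt hps
  have hlt := (ContinuousAt.comp (f := c) (x := p) hcont hcp).eventually
    (Metric.ball_mem_nhds _ (show (0 : ℝ) < 1 / 2 by norm_num))
  filter_upwards [hlt, hcp.preimage_mem_nhds (h.mem_nhds hp), c.open_source.mem_nhds hps]
    with p' h1 h2 h3 n' hn'
  have h4 : quart (f p') n' = quart (f p') (N (c p')) := by
    have h5 := (hf.isUnitNormal_comp_symm_iff hc (c.map_source h3) (n := n')).2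
      (by rwa [c.left_inv h3])
    rcases h.eq_or_eq_neg_normal h2 h5 with h6 | h6
    · rw [h6]
    · rw [h6, quart_neg]
  simp only [Function.comp_apply, c.left_inv h3, c.left_inv hps, hN, ← h4] at h1
  rw [Real.dist_eq, abs_lt] at h1
  rcases hval p n hn with h7 | h7 <;> rcases hval p' n' hn' with h8 | h8 <;> rw [h7, h8] at h1 ⊢ <;>
    norm_num at h1

end Manifold

end HypQuadric

end

open HypQuadric in
theorem theorem1 (m : ℕ) (hm : 3 ≤ m) {M : Type*} [TopologicalSpace M]
    [ChartedSpace (EuclideanSpace ℝ (Fin (2 * m - 1))) M]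
    [IsManifold 𝓘(ℝ, EuclideanSpace ℝ (Fin (2 * m - 1))) ∞ M]
    (f : M → Vec m) (hf : IsRealHypersurface f)
    (hHopf : IsHopf f) (hReeb : HasReebParallelJacobi f) :
    (∀ p n, IsUnitNormalAt f p n →
      IsSingular (f p) n ∧ (IsIsotropic (f p) n ∨ IsPrincipal (f p) n)) ∧
    (PreconnectedSpace M →
      (∀ p n, IsUnitNormalAt f p n → IsIsotropic (f p) n) ∨
      (∀ p n, IsUnitNormalAt f p n → IsPrincipal (f p) n)) := by
  have hd : ∀ {p n}, IsUnitNormalAt f p n → defect (f p) n = 0 := fun hn =>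
    hf.defect_eq_zero hm hHopf hReeb hn
  have hval : ∀ p n, IsUnitNormalAt f p n → quart (f p) n = 1 / 2 ∨ quart (f p) n = 1 :=
    fun p n hn => quart_eq_of_defect_eq_zero hn.1 (hd hn)
  refine ⟨fun p n hn => ?_, fun hM => ?_⟩
  · rcases hval p n hn with h | h
    · exact ⟨isSingular_of_quart_eq_half (hf.1 p) hn.1 (hd hn) h,
        Or.inl (isIsotropic_of_quart_eq_half (hf.1 p) hn.1 (hd hn) h)⟩
    · exact ⟨isSingular_of_quart_eq_one hm (hf.1 p) hn.1 (hd hn) h,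
        Or.inr (isPrincipal_of_quart_eq_one (hf.1 p) hn.1 (hd hn) h)⟩
  · have hex : ∀ p, ∃ n, IsUnitNormalAt f p n := fun p =>
      exists_isUnitNormal (hf.1 p) (finrank_model hm)
        (mfderiv 𝓘(ℝ, EuclideanSpace ℝ (Fin (2 * m - 1))) 𝓘(ℝ, Vec m) f p)
    choose ν hν using hex
    have hconst : IsLocallyConstant fun p => quart (f p) (ν p) := by
      rw [IsLocallyConstant.iff_eventually_eq]
      intro p
      filter_upwards [hf.eventually_quart_eq hm hval (hν p)] with p' hp' using hp' _ (hν p')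
    have hq : ∀ p₀ p n, IsUnitNormalAt f p n → quart (f p) n = quart (f p₀) (ν p₀) := by
      intro p₀ p n hn
      rw [(hf.eventually_quart_eq hm hval (hν p)).self_of_nhds n hn]
      exact hconst.apply_eq_of_preconnectedSpace p p₀
    rcases isEmpty_or_nonempty M with hE | ⟨⟨p₀⟩⟩
    · exact Or.inl fun p => isEmptyElim p
    rcases hval p₀ _ (hν p₀) with h | h
    · exact Or.inl fun p n hn => isIsotropic_of_quart_eq_half (hf.1 p) hn.1 (hd hn)
        ((hq p₀ p n hn).trans h)
    · exact Or.inr fun p n hn => isPrincipal_of_quart_eq_one (hf.1 p) hn.1 (hd hn)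
        ((hq p₀ p n hn).trans h)
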